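/- **Theorem (Down-Fisher–Fisher inequality).** *Notation.* A density is a function $f\ge 0$ on $\mathbb R$ with $\int f=1$, whose support $\Omega=\{f\neq0\}$ is an open interval; $f$ is extended by $0$. For real parameters put (with values in $[0,\infty]$) $$F_{s,\lambda}[f]=\int_\Omega |f^{\lambda-2}f'|^{s} f\,dx,\qquad N_\lambda[f]=\Big(\int_\Omega f^\lambda dx\Big)^{\frac1{1-\lambda}}\ (\lambda\ne1),$$ $$\varphi_{p,q,\lambda}[f]=\int_\Omega f^{1+p(\lambda-2)}|f'|^{q}\Big|\tfrac{p\lambda}{p-q}-\tfrac{f f''}{(f')^2}\Big|^p dx .$$ For $\alpha\neq2$ and $f$ with $f'<0$ on $\Omega$, the down transform $\mathfrak D_\alpha[f]$ is the density $s\mapsto f(x)^\alpha/|f'(x)|$ at $s=s(x)=\frac{f(x)^{2-\alpha}}{\alpha-2}$, $x\in\Omega$. The up transform $\mathfrak U_\alpha[g]$ of a density $g$ is $u\mapsto |(\alpha-2)x|^{1/(2-\alpha)}$ at $u=u(x)$, where $u$ is an increasing primitive of $|(\alpha-2)x|^{1/(\alpha-2)}g(x)$ on the support of $g$; it is defined (up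 to a translation) when this weight is locally integrable on the support of $g$. Let $p,q,s,\lambda$ be real with $p\neq q$, $\lambda\ne0$, $s\neq0$, and put $\beta=\frac{p-q}{p}$ ($p\ne0$). Assume either $p\ge1$ and $$\operatorname{sign}\Big(\frac{p-q}{p-1}-s\Big)=\operatorname{sign}\Big(\frac{p-q}{p}+s\Big)\neq0$$ (for $p=1$ the left side means $\operatorname{sign}(p-q)$), or $p<1$, $p\neq 0$ and $$\operatorname{sign}\Big(\frac{p-q}{p-1}-s\Big)=\operatorname{sign}\Big(\frac{p-q}{p}-s\Big)\neq0,\qquad \operatorname{sign}(s)=\operatorname{sign}\Big(\frac{q-p}{p}\Big)\neq0 .$$ Let $\theta_2=1-\frac qp+s$ if $p\ge1$ and $\theta_2=\frac qp-1$ if $p<1$, and $r=\frac{(2-\lambda)(p-q)}p$. *Stam minimizers and the constant.* Let $G_{\rho,\mu}(y)=a\,(1-(\mu-1)|y|^{\rho})_+^{1/(\mu-1)}$, normalized to a density. For $p>1$ let $\theta=\beta+s$ and let $\widetilde g$ be given by $\widetilde g(x(y))=G(y)^{1/\theta}$, $x(y)=\int_0^yG^{1-1/\theta}$, with $G=G_{p/(p-1),\,\beta/\theta}$.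 For $p<1$ let $\widetilde g=\mathfrak U_{2-\beta}[H]$, where $H$ is $G_{-s/\beta,\,1-p}$ restricted to the half-line $\{x:\beta x<0\}$ and renormalized. Let $$\kappa^{(2)}_{s,p,q}=\Big[N_{1-s}[\widetilde g]\;F_{p,\beta}[\widetilde g]^{\frac1{p-q}}\Big]^{\theta_2}\quad(p\neq1),\qquad \kappa^{(2)}_{s,1,q}=\Big(\frac{2}{|\beta|}\Big)^{\theta_2/\beta},$$ the latter being the value at the uniform density on a unit interval, with $F_{1,\beta}[g]$ read as the total variation of $g^\beta/|\beta|$ with its jumps. *Absolute continuity.* A density $g$ is called admissible if: for $p\ge1$, $\theta_2>0$: $g$ (extended by $0$) is absolutely continuous on every compact interval of $\mathbb R$; for $p\ge1$, $\theta_2<0$: $g$ is absolutely continuous on the compact subintervals of its support and tends to $+\infty$ at each finite endpoint of its support; for $p<1$: $g$ is absolutely continuous on the compact subintervals of its support, with $g'<0$ almost everywhere there. Then: 1. $0<\kappa^{(2)}_{s,p,q}<\infty$. 2. For every density $f$ with $f'<0$ on its support such that $\mathfrak D_{2-\lambda}[f]$ is admissible, and also for every $f=\mathfrak U_{2-\lambda}[g]$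 with $g$ an admissible density for which $\mathfrak U_{2-\lambda}[g]$ is defined, $$\Big[F_{s,\lambda}[f]^{\frac1s}\;\varphi_{p,q,r}[f]^{\frac1{p-q}}\Big]^{\theta_2}\ \ge\ \kappa^{(2)}_{s,p,q},$$ whenever the product inside the brackets is not of the form $0\cdot\infty$ (in particular whenever both functionals are finite). 3. Let $p\neq1$ and let $g$ be any translate of $\widetilde g$. Then $g$ is an admissible density, and, whenever $f_{\min}=\mathfrak U_{2-\lambda}[g]$ is defined, $\int f_{\min}=1$ and equality holds in 2 for $f=f_{\min}$. If moreover the support of $g$ lies in $\{x:\lambda x<0\}$, then $f_{\min}$ is defined, is a density with $f_{\min}'<0$ on its support, and $\mathfrak D_{2-\lambda}[f_{\min}]=g$. 4. The constant is sharp: unless $p>1$ and $0<\beta\le\frac{p-1}p$, no number larger than $\kappa^{(2)}_{s,p,q}$ can replace it in 2, even for the densities with $f'<0$ only. -/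

import Mathlib

open MeasureTheory Set Filter Topology
open scoped ENNReal

noncomputable section

namespace DownFisher

/-! ### Probability densities, classical functionals -/

/-- A probability density on the real line whose support `Ω = {f ≠ 0}` is an open interval
(bounded or not); `f` is extended by zero outside `Ω`. -/
structure IsDensity (f : ℝ → ℝ) : Prop where
  nonneg : ∀ x, 0 ≤ f x
  isOpen_support : IsOpen (Function.support f)
  ordConnected_support : (Function.support f).OrdConnected
  lintegral_eq_one : ∫⁻ x, ENNReal.ofReal (f x) = 1

/-- The densities to which the down transformation applies: `f' < 0` at every point of the
support. (`deriv f x < 0` includes differentiability at `x`; the left end of the support is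
automatically finite.) -/
structure IsDecreasingDensity (f : ℝ → ℝ) : Prop extends IsDensity f where
  deriv_neg : ∀ x ∈ Function.support f, deriv f x < 0

/-- `(p, l)`-Fisher information `F_{p,l}[f] = ∫_Ω |f^{l-2} f'|^p f`, with values in `[0, ∞]`. -/
def fisher (p l : ℝ) (f : ℝ → ℝ) : ℝ≥0∞ :=
  ∫⁻ x in Function.support f,
    ENNReal.ofReal |f x ^ (l - 2) * deriv f x| ^ p * ENNReal.ofReal (f x)

/-- Rényi entropy power `N_l[f] = (∫_Ω f^l)^{1/(1-l)}`, for `l ≠ 1`. -/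
def renyiPower (l : ℝ) (f : ℝ → ℝ) : ℝ≥0∞ :=
  (∫⁻ x in Function.support f, ENNReal.ofReal (f x ^ l)) ^ (1 / (1 - l))

/-- Down-Fisher measure
`φ_{p,q,l}[f] = ∫_Ω f^{1+p(l-2)} |f'|^q |p l/(p-q) - f f''/(f')²|^p`, with values in `[0, ∞]`. -/
def downFisher (p q l : ℝ) (f : ℝ → ℝ) : ℝ≥0∞ :=
  ∫⁻ v in Function.support f,
    ENNReal.ofReal (f v ^ (1 + p * (l - 2))) * ENNReal.ofReal |deriv f v| ^ q *
      ENNReal.ofReal |p * l / (p - q) - f v * deriv (deriv f) v / (deriv f v) ^ 2| ^ p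

/-! ### Transformations of densities -/

/-- The function `F` given in parametric form by `F (X t) = v t` for `t ∈ I` (with `X` injective
on `I`), and `F = 0` outside `X '' I`. -/
def reparam (I : Set ℝ) (X v : ℝ → ℝ) : ℝ → ℝ :=
  (X '' I).indicator fun y => v (Function.invFunOn X I y)

open Classical in
/-- Canonical variable of the down transformation, a primitive of `f^{1-a} |f'|`. -/
def downVar (a : ℝ) (f : ℝ → ℝ) (x : ℝ) : ℝ :=
  if a = 2 then -Real.log (f x) else f x ^ (2 - a) / (a - 2)

/-- Down transformation: `down a f (s(x)) = f(x)^a / |f'(x)|`, with `s = downVar a f`. -/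
def down (a : ℝ) (f : ℝ → ℝ) : ℝ → ℝ :=
  reparam (Function.support f) (downVar a f) fun x => f x ^ a * |deriv f x|⁻¹

/-- The weight `|(a-2) v|^{1/(a-2)} g(v)` (and `e^v g(v)` for `a = 2`), whose primitive is the
variable of the up transformation. -/
def upWeight (a : ℝ) (g : ℝ → ℝ) (v : ℝ) : ℝ :=
  if a = 2 then Real.exp v * g v else |(a - 2) * v| ^ (1 / (a - 2)) * g v

/-- The up transformation of `g` makes sense when the weight is locally integrable on the
(open) support of `g`. -/
def UpDefined (a : ℝ) (g : ℝ → ℝ) : Prop :=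
  LocallyIntegrableOn (upWeight a g) (Function.support g)

/-- Some point of the support of `g`. -/
def basePoint (g : ℝ → ℝ) : ℝ := Classical.epsilon fun x => x ∈ Function.support g

/-- Up transformation: `up a g (u(x)) = |(a-2) x|^{1/(2-a)}` (and `e^{-x}` for `a = 2`), where
`u` is a primitive of the weight. The choice of the primitive only translates the result; `u` is
taken increasing, so that `up a` inverts `down a` up to a translation. -/
def up (a : ℝ) (g : ℝ → ℝ) : ℝ → ℝ :=
  reparam (Function.support g) (fun x => ∫ v in (basePoint g)..x, upWeight a g v)
    fun x => if a = 2 then Real.exp (-x) else |(a - 2) * x| ^ (1 / (2 - a))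

/-- Differential-escort transformation of a density that is positive around `0`:
`escort a h (y(x)) = h(x)^a`, with `y(x) = ∫_0^x h^{1-a}`. -/
def escort (a : ℝ) (h : ℝ → ℝ) : ℝ → ℝ :=
  reparam (Function.support h) (fun x => ∫ t in (0 : ℝ)..x, h t ^ (1 - a)) fun x => h x ^ a

/-! ### Generalized Gaussians and the minimizers of the tri-parametric Stam inequality -/

/-- Tsallis exponential `exp_l(x) = (1 + (1-l) x)_+^{1/(1-l)}`, `exp_1 = exp`. -/
def qExp (l x : ℝ) : ℝ :=
  if l = 1 then Real.exp x else (max (1 + (1 - l) * x) 0) ^ (1 / (1 - l))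

/-- Stretched deformed Gaussian: the density proportional to `exp_{2-l}(-|x|^r)`. -/
def gaussian (r l : ℝ) (x : ℝ) : ℝ :=
  qExp (2 - l) (-|x| ^ r) / ∫ y, qExp (2 - l) (-|y| ^ r)

/-- The stretched deformed Gaussian restricted to the half-line `{x | 0 < c * x}`, renormalized. -/
def halfGaussian (c r l : ℝ) (x : ℝ) : ℝ :=
  if 0 < c * x then 2 * gaussian r l x else 0

/-- Minimizer `g̃_{p,b,l}` of the tri-parametric Stam inequality. For `p > 1` it is a differential
escort of the minimizer of the bi-parametric one. For `p < 1` it is the up transform (of order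
`2 - b`) of the half Gaussian that minimizes the moment-entropy quotient with moment of order
`(l - 1) / b` and entropy of order `1 - p` on the half-line `{x | 0 < -b * x}`. -/
def stamMinimizer (p b l : ℝ) : ℝ → ℝ :=
  if 1 < p then escort (1 / (1 + b - l)) (gaussian (p / (p - 1)) (b / (1 + b - l)))
  else up (2 - b) (halfGaussian (-b) ((l - 1) / b) (1 - p))

/-- Exponent in the tri-parametric Stam inequality. -/
def theta1 (p b l : ℝ) : ℝ := if 1 ≤ p then 1 + b - l else -b

/-- Optimal constant of the tri-parametric Stam inequality: the value of
`(φ_{p,b} N_l)^{θ₁}`, `φ_{p,b} = F_{p,b}^{1/(p b)}`, at the minimizer. For `p = 1` the minimizer is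
the uniform density `g` on an interval of length one, where `N_l[g] = 1` and `F_{1,b}[g]` is the
total variation of `g^b / |b|`, counting the two jumps, that is `2 / |b|`. -/
def kappa1 (p b l : ℝ) : ℝ≥0∞ :=
  if p = 1 then ENNReal.ofReal ((2 / |b|) ^ (theta1 p b l / b))
  else (fisher p b (stamMinimizer p b l) ^ (1 / (p * b)) *
    renyiPower l (stamMinimizer p b l)) ^ theta1 p b l

/-! ### Regularity classes -/

/-- Absolute continuity on every compact interval contained in `I`. -/
def LocallyAC (g : ℝ → ℝ) (I : Set ℝ) : Prop :=
  ∀ a b : ℝ, a ≤ b → Icc a b ⊆ I → AbsolutelyContinuousOnInterval g a b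

/-- Absolute continuity as required by the tri-parametric Stam inequality.
* `p ≥ 1` and `1 + b - l > 0`: `g`, extended by zero, is absolutely continuous on `ℝ`.
* `p ≥ 1` and `1 + b - l < 0`: `g` is absolutely continuous inside its support and diverges at
  the finite endpoints of its support.
* `p < 1`: `g` is absolutely continuous inside its support, with negative derivative there. -/
def StamClass (p b l : ℝ) (g : ℝ → ℝ) : Prop :=
  (1 ≤ p → 0 < 1 + b - l → LocallyAC g univ) ∧
  (1 ≤ p → 1 + b - l < 0 → LocallyAC g (Function.support g) ∧
    ∀ e ∈ frontier (Function.support g), Tendsto g (𝓝[Function.support g] e) atTop) ∧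
  (p < 1 → LocallyAC g (Function.support g) ∧
    ∀ᵐ x, x ∈ Function.support g → deriv g x < 0)

/-! ### The Down-Fisher--Fisher inequality -/

/-- Sign condition for `p ≥ 1`. For `p = 1`, `(p-q)/(p-1) = p^* (p-q)/p` is understood as
`(p-q) · ∞`, whose difference with `s` has the sign of `p - q`. -/
def ClassicalRange (p q s : ℝ) : Prop :=
  1 ≤ p ∧
  (if p = 1 then SignType.sign (p - q) else SignType.sign ((p - q) / (p - 1) - s))
    = SignType.sign ((p - q) / p + s) ∧
  SignType.sign ((p - q) / p + s) ≠ 0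

/-- Sign conditions for `p < 1`. -/
def MirroredRange (p q s : ℝ) : Prop :=
  p < 1 ∧ p ≠ 0 ∧
  SignType.sign ((p - q) / (p - 1) - s) = SignType.sign ((p - q) / p - s) ∧
  SignType.sign ((p - q) / p - s) ≠ 0 ∧
  SignType.sign s = SignType.sign ((q - p) / p) ∧ SignType.sign s ≠ 0

/-- Exponent in the Down-Fisher--Fisher inequality. -/
def theta2 (s p q : ℝ) : ℝ := if 1 ≤ p then 1 - q / p + s else q / p - 1

/-- Constant in the Down-Fisher--Fisher inequality. -/
def kappa2 (s p q : ℝ) : ℝ≥0∞ := kappa1 p ((p - q) / p) (1 - s)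

/-- First factor, `F_{s,l}[f]^{1/s}`. -/
def factorF (s l : ℝ) (f : ℝ → ℝ) : ℝ≥0∞ := fisher s l f ^ (1 / s)

/-- Second factor, `φ_{p,q,r}[f]^{1/(p-q)}` with `r = (2-l)(p-q)/p`. -/
def factorPhi (p q l : ℝ) (f : ℝ → ℝ) : ℝ≥0∞ :=
  downFisher p q ((2 - l) * (p - q) / p) f ^ (1 / (p - q))

/-- The product of the two factors is not of the form `0 · ∞`. -/
def ProductDefined (p q s l : ℝ) (f : ℝ → ℝ) : Prop :=
  ¬ (factorF s l f = 0 ∧ factorPhi p q l f = ∞) ∧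
  ¬ (factorF s l f = ∞ ∧ factorPhi p q l f = 0)

/-- `[F_{s,l}[f]^{1/s} φ_{p,q,r}[f]^{1/(p-q)}]^{θ₂}`. -/
def dffProduct (p q s l : ℝ) (f : ℝ → ℝ) : ℝ≥0∞ :=
  (factorF s l f * factorPhi p q l f) ^ theta2 s p q

/-- The densities of the theorem: decreasing densities `f` whose down transform of order `2 - l`
is absolutely continuous. -/
def Admissible (p q s l : ℝ) (f : ℝ → ℝ) : Prop :=
  IsDecreasingDensity f ∧ StamClass p ((p - q) / p) (1 - s) (down (2 - l) f)

end DownFisher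

end

open MeasureTheory Set Filter Topology
open scoped ENNReal

noncomputable section

namespace DownFisher

/-! ### Absolutely continuous functions -/

theorem _root_.AbsolutelyContinuousOnInterval.lipschitz_comp {φ f : ℝ → ℝ} {a b : ℝ} {K : NNReal}
    {S : Set ℝ} (hφ : LipschitzOnWith K φ S) (hf : AbsolutelyContinuousOnInterval f a b)
    (hS : MapsTo f (uIcc a b) S) : AbsolutelyContinuousOnInterval (fun x => φ (f x)) a b := by
  have h0 : Tendsto (fun E : ℕ × (ℕ → ℝ × ℝ) =>
      (K : ℝ) * ∑ i ∈ Finset.range E.1, dist (f (E.2 i).1) (f (E.2 i).2))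
      (AbsolutelyContinuousOnInterval.totalLengthFilter ⊓
        𝓟 (AbsolutelyContinuousOnInterval.disjWithin a b)) (𝓝 0) := by
    simpa using Tendsto.const_mul (K : ℝ) hf
  refine squeeze_zero' (Eventually.of_forall fun E => Finset.sum_nonneg fun i _ => dist_nonneg)
    ?_ h0
  have hmem : ∀ᶠ E in (AbsolutelyContinuousOnInterval.totalLengthFilter ⊓
      𝓟 (AbsolutelyContinuousOnInterval.disjWithin a b)),
      E ∈ AbsolutelyContinuousOnInterval.disjWithin a b :=
    mem_inf_of_right (mem_principal_self _)
  filter_upwards [hmem] with E hE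
  rw [Finset.mul_sum]
  refine Finset.sum_le_sum fun i hi => ?_
  exact hφ.dist_le_mul _ (hS (hE.1 i hi).1) _ (hS (hE.1 i hi).2)

theorem LocallyAC.mono {g : ℝ → ℝ} {I J : Set ℝ} (h : LocallyAC g I) (hJ : J ⊆ I) :
    LocallyAC g J :=
  fun a b hab hs => h a b hab (hs.trans hJ)

theorem exists_Icc_subset_of_isOpen {I : Set ℝ} (hI : IsOpen I) {x : ℝ} (hx : x ∈ I) :
    ∃ a b : ℝ, a < x ∧ x < b ∧ Icc a b ⊆ I := by
  obtain ⟨ε, hε, h⟩ := Metric.isOpen_iff.1 hI x hx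
  refine ⟨x - ε / 2, x + ε / 2, by linarith, by linarith, fun y hy => h ?_⟩
  rw [Metric.mem_ball, Real.dist_eq, abs_lt]
  constructor <;> linarith [hy.1, hy.2]

theorem LocallyAC.continuousOn {g : ℝ → ℝ} {I : Set ℝ} (h : LocallyAC g I) (hI : IsOpen I) :
    ContinuousOn g I := by
  intro x hx
  obtain ⟨a, b, ha, hb, hab⟩ := exists_Icc_subset_of_isOpen hI hx
  have := (h a b (by linarith) hab).continuousOn
  rw [uIcc_of_le (by linarith)] at this
  exact (this.continuousAt (Icc_mem_nhds ha hb)).continuousWithinAt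

theorem LocallyAC.ae_differentiableAt {g : ℝ → ℝ} {I : Set ℝ} (h : LocallyAC g I)
    (hI : IsOpen I) : ∀ᵐ x, x ∈ I → DifferentiableAt ℝ g x := by
  have key : ∀ᵐ x, ∀ q : ℚ × ℚ, (q.1 : ℝ) ≤ q.2 → Icc (q.1 : ℝ) q.2 ⊆ I →
      x ∈ Icc (q.1 : ℝ) q.2 → DifferentiableAt ℝ g x := by
    rw [ae_all_iff]
    intro q
    by_cases hq : (q.1 : ℝ) ≤ q.2 ∧ Icc (q.1 : ℝ) q.2 ⊆ I
    · filter_upwards [(h _ _ hq.1 hq.2).ae_differentiableAt] with x hx _ _ hx'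
      exact hx (by rwa [uIcc_of_le hq.1])
    · filter_upwards with x h1 h2
      exact absurd ⟨h1, h2⟩ hq
  filter_upwards [key] with x hx hxI
  obtain ⟨a, b, ha, hb, hab⟩ := exists_Icc_subset_of_isOpen hI hxI
  obtain ⟨q1, h1, h1'⟩ := exists_rat_btwn ha
  obtain ⟨q2, h2, h2'⟩ := exists_rat_btwn hb
  exact hx (q1, q2) (by simp only; linarith)
    ((Icc_subset_Icc h1.le h2'.le).trans hab) ⟨h1'.le, h2.le⟩

theorem LocallyAC.rpow {g : ℝ → ℝ} {I : Set ℝ} (h : LocallyAC g I) (hg : ∀ x ∈ I, 0 < g x)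
    (b : ℝ) : LocallyAC (fun x => g x ^ b) I := by
  intro x y hxy hs
  have hac := h x y hxy hs
  have hc := hac.continuousOn
  rw [uIcc_of_le hxy] at hc
  obtain ⟨z1, hz1, h1⟩ := isCompact_Icc.exists_isMinOn ⟨x, left_mem_Icc.2 hxy⟩ hc
  obtain ⟨z2, hz2, h2⟩ := isCompact_Icc.exists_isMaxOn ⟨x, left_mem_Icc.2 hxy⟩ hc
  have hpos : 0 < g z1 := hg _ (hs hz1)
  have hcd : ContDiffOn ℝ 1 (fun t : ℝ => t ^ b) (Icc (g z1) (g z2)) := fun t ht =>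
    (Real.contDiffAt_rpow_const_of_ne (hpos.trans_le ht.1).ne').contDiffWithinAt
  obtain ⟨K, hK⟩ := hcd.exists_lipschitzOnWith one_ne_zero (convex_Icc _ _) isCompact_Icc
  refine AbsolutelyContinuousOnInterval.lipschitz_comp (φ := fun t : ℝ => t ^ b) (f := g) hK hac ?_
  rw [uIcc_of_le hxy]
  exact fun t ht => ⟨h1 ht, h2 ht⟩

theorem AC_abs_sub_le_lintegral {w : ℝ → ℝ} {a x : ℝ}
    (h : AbsolutelyContinuousOnInterval w a x) (hax : a ≤ x) :
    ENNReal.ofReal |w x - w a| ≤ ∫⁻ t in Ioo a x, ENNReal.ofReal |deriv w t| := by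
  rw [← h.integral_deriv_eq_sub, intervalIntegral.integral_of_le hax,
    integral_Ioc_eq_integral_Ioo]
  have := ENNReal.ofReal_le_ofReal
    (norm_integral_le_integral_norm (μ := volume.restrict (Ioo a x)) (deriv w))
  refine this.trans ?_
  simp_rw [Real.norm_eq_abs]
  refine (ENNReal.ofReal_le_ofReal le_rfl).trans ?_
  rw [ofReal_integral_eq_lintegral_ofReal _ (Eventually.of_forall fun _ => abs_nonneg _)]
  have hi := h.intervalIntegrable_deriv
  rw [intervalIntegrable_iff_integrableOn_Ioo_of_le hax] at hi
  exact hi.abs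

theorem absolutelyContinuousOnInterval_of_hasDerivAt_off_countable {f f' : ℝ → ℝ} {a b : ℝ}
    {s : Set ℝ} (hab : a ≤ b) (hs : s.Countable) (hc : ContinuousOn f (Icc a b))
    (hd : ∀ x ∈ Ioo a b \ s, HasDerivAt f (f' x) x) (hi : IntervalIntegrable f' volume a b) :
    AbsolutelyContinuousOnInterval f a b := by
  have h1 := hi.absolutelyContinuousOnInterval_intervalIntegral (c := a) (by simp)
  have h2 : AbsolutelyContinuousOnInterval (fun _ : ℝ => f a) a b :=
    (LipschitzWith.const (f a)).lipschitzOnWith.absolutelyContinuousOnInterval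
  have h3 := h2.add h1
  have heq : ∀ x ∈ uIcc a b, f x = ((fun _ : ℝ => f a) + fun x : ℝ => ∫ v in a..x, f' v) x := by
    intro x hx
    rw [uIcc_of_le hab] at hx
    have := integral_eq_of_hasDerivAt_off_countable_of_le f f' hx.1 hs
      (hc.mono (Icc_subset_Icc_right hx.2))
      (fun y hy => hd y ⟨⟨hy.1.1, hy.1.2.trans_le hx.2⟩, hy.2⟩)
      (hi.mono_set (by rw [uIcc_of_le hx.1, uIcc_of_le hab]; exact Icc_subset_Icc_right hx.2))
    simp [this]
  refine Tendsto.congr' ?_ h3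
  have hmem : ∀ᶠ E in (AbsolutelyContinuousOnInterval.totalLengthFilter ⊓
      𝓟 (AbsolutelyContinuousOnInterval.disjWithin a b)),
      E ∈ AbsolutelyContinuousOnInterval.disjWithin a b :=
    mem_inf_of_right (mem_principal_self _)
  filter_upwards [hmem] with E hE
  refine Finset.sum_congr rfl fun i hi => ?_
  rw [← heq _ (hE.1 i hi).1, ← heq _ (hE.1 i hi).2]

/-- A continuous function which is increasing before `c` and decreasing after `c`, or conversely,
and differentiable off a countable set is absolutely continuous. -/
theorem absolutelyContinuousOnInterval_of_unimodal {f : ℝ → ℝ} {a b c : ℝ} {s : Set ℝ}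
    (hab : a ≤ b) (hs : s.Countable) (hc : ContinuousOn f (Icc a b))
    (hd : ∀ x ∈ Ioo a b \ s, DifferentiableAt ℝ f x)
    (h1 : MonotoneOn f (Icc a b ∩ Iic c) ∨ AntitoneOn f (Icc a b ∩ Iic c))
    (h2 : MonotoneOn f (Icc a b ∩ Ici c) ∨ AntitoneOn f (Icc a b ∩ Ici c)) :
    AbsolutelyContinuousOnInterval f a b := by
  refine absolutelyContinuousOnInterval_of_hasDerivAt_off_countable hab hs hc
    (fun x hx => (hd x hx).hasDerivAt) ?_
  have piece : ∀ u v : ℝ, (MonotoneOn f (uIcc u v) ∨ AntitoneOn f (uIcc u v)) →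
      IntervalIntegrable (deriv f) volume u v := by
    rintro u v (h | h)
    · exact h.intervalIntegrable_deriv
    · have := h.neg.intervalIntegrable_deriv.neg
      refine this.congr (fun x _ => ?_)
      simp
  set m := max a (min b c)
  have ham : a ≤ m := le_max_left _ _
  have hmb : m ≤ b := max_le hab (min_le_left _ _)
  refine (piece a m ?_).trans (piece m b ?_)
  · rw [uIcc_of_le ham]
    rcases le_or_gt a c with hac | hac
    · have : Icc a m ⊆ Icc a b ∩ Iic c := fun x hx => ⟨⟨hx.1, hx.2.trans hmb⟩,
        hx.2.trans (max_le hac (min_le_right _ _))⟩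
      exact h1.imp (fun h => h.mono this) (fun h => h.mono this)
    · have : m = a := max_eq_left ((min_le_right _ _).trans hac.le)
      rw [this, Icc_self]; left; simp
  · rw [uIcc_of_le hmb]
    rcases le_or_gt c b with hcb | hcb
    · have : Icc m b ⊆ Icc a b ∩ Ici c := fun x hx => ⟨⟨ham.trans hx.1, hx.2⟩, by
        have := hx.1; simp only [m, min_eq_right hcb] at this; exact (le_max_right _ _).trans this⟩
      exact h2.imp (fun h => h.mono this) (fun h => h.mono this)
    · have : m = b := by simp [m, min_eq_left hcb.le, hab]
      rw [this, Icc_self]; left; simp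

/-! ### Inverses of increasing functions -/

theorem isOpen_image_of_strictMonoOn {u : ℝ → ℝ} {I : Set ℝ} (hI : IsOpen I)
    (hc : ContinuousOn u I) (hu : StrictMonoOn u I) : IsOpen (u '' I) := by
  rw [isOpen_iff_mem_nhds]
  rintro _ ⟨x, hx, rfl⟩
  obtain ⟨a, b, ha, hb, hab⟩ := exists_Icc_subset_of_isOpen hI hx
  have h1 : Icc (u a) (u b) ⊆ u '' Icc a b :=
    intermediate_value_Icc (by linarith) (hc.mono hab)
  refine mem_of_superset (Icc_mem_nhds (hu (hab ⟨le_rfl, by linarith⟩) hx ha)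
    (hu hx (hab ⟨by linarith, le_rfl⟩) hb)) (h1.trans (image_mono hab))

theorem ordConnected_image {u : ℝ → ℝ} {I : Set ℝ} (hI : I.OrdConnected)
    (hc : ContinuousOn u I) : (u '' I).OrdConnected :=
  (hI.isPreconnected.image u hc).ordConnected

theorem strictMonoOn_invFunOn {u : ℝ → ℝ} {I : Set ℝ} (hu : StrictMonoOn u I) :
    StrictMonoOn (Function.invFunOn u I) (u '' I) := by
  rintro _ ⟨x, hx, rfl⟩ _ ⟨y, hy, rfl⟩ hxy
  rw [hu.injOn.leftInvOn_invFunOn hx, hu.injOn.leftInvOn_invFunOn hy]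
  exact (hu.lt_iff_lt hx hy).1 hxy

theorem invFunOn_image_eq {u : ℝ → ℝ} {I : Set ℝ} (hu : InjOn u I) :
    Function.invFunOn u I '' (u '' I) = I := by
  rw [image_image]
  exact (image_congr fun x hx => hu.leftInvOn_invFunOn hx).trans (image_id I)

theorem continuousAt_invFunOn {u : ℝ → ℝ} {I : Set ℝ} (hI : IsOpen I)
    (hc : ContinuousOn u I) (hu : StrictMonoOn u I) {x : ℝ} (hx : x ∈ I) :
    ContinuousAt (Function.invFunOn u I) (u x) := by
  refine (strictMonoOn_invFunOn hu).continuousAt_of_image_mem_nhds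
    ((isOpen_image_of_strictMonoOn hI hc hu).mem_nhds (mem_image_of_mem u hx)) ?_
  rw [invFunOn_image_eq hu.injOn, hu.injOn.leftInvOn_invFunOn hx]
  exact hI.mem_nhds hx

theorem hasDerivAt_invFunOn {u : ℝ → ℝ} {I : Set ℝ} (hI : IsOpen I)
    (hc : ContinuousOn u I) (hu : StrictMonoOn u I) {x d : ℝ} (hx : x ∈ I)
    (hd : HasDerivAt u d x) (hd0 : d ≠ 0) :
    HasDerivAt (Function.invFunOn u I) d⁻¹ (u x) := by
  refine HasDerivAt.of_local_left_inverse (f := u) (continuousAt_invFunOn hI hc hu hx) ?_ hd0 ?_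
  · rwa [hu.injOn.leftInvOn_invFunOn hx]
  · filter_upwards [(isOpen_image_of_strictMonoOn hI hc hu).mem_nhds (mem_image_of_mem u hx)]
      with y hy
    exact Function.invFunOn_eq hy

/-! ### Change of variables between a density and its up transform -/

/-- `f` is, up to a translation and up to the point `0` of the support of `g`, the up transform of
order `2 - l` of `g`, and `v` is the inverse of the canonical variable. -/
structure UpPair (l : ℝ) (f g v : ℝ → ℝ) : Prop where
  isOpen : IsOpen (Function.support f)
  nonneg : ∀ y, 0 ≤ f y
  nonneg_right : ∀ y, 0 ≤ g y
  injOn : InjOn v (Function.support f)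
  image : v '' Function.support f = Function.support g \ {0}
  hasDerivAt : ∀ y ∈ Function.support f, HasDerivAt v (f y / g (v y)) y
  eq : ∀ y ∈ Function.support f, f y = |l * v y| ^ (1 / l)

theorem setLIntegral_support_ofReal (f : ℝ → ℝ) :
    ∫⁻ x in Function.support f, ENNReal.ofReal (f x) = ∫⁻ x, ENNReal.ofReal (f x) := by
  refine setLIntegral_eq_of_support_subset ?_
  intro x hx h0
  simp [h0] at hx

namespace UpPair

variable {l : ℝ} {f g v : ℝ → ℝ}

theorem pos (h : UpPair l f g v) {y : ℝ} (hy : y ∈ Function.support f) : 0 < f y :=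
  lt_of_le_of_ne (h.nonneg y) (Ne.symm hy)

theorem mem (h : UpPair l f g v) {y : ℝ} (hy : y ∈ Function.support f) :
    v y ∈ Function.support g \ {0} :=
  h.image ▸ mem_image_of_mem v hy

theorem pos_right (h : UpPair l f g v) {y : ℝ} (hy : y ∈ Function.support f) : 0 < g (v y) :=
  lt_of_le_of_ne (h.nonneg_right _) (Ne.symm (h.mem hy).1)

theorem lintegral (h : UpPair l f g v) (Φ : ℝ → ℝ≥0∞) :
    ∫⁻ x in Function.support g, Φ x
      = ∫⁻ y in Function.support f, ENNReal.ofReal (f y / g (v y)) * Φ (v y) := by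
  have h1 : (Function.support g : Set ℝ) =ᵐ[volume] (Function.support g \ {0} : Set ℝ) :=
    (sdiff_null_ae_eq_self (measure_singleton 0)).symm
  rw [setLIntegral_congr h1, ← h.image, lintegral_image_eq_lintegral_abs_deriv_mul
    h.isOpen.measurableSet (fun y hy => (h.hasDerivAt y hy).hasDerivWithinAt) h.injOn]
  refine setLIntegral_congr_fun h.isOpen.measurableSet fun y hy => ?_
  rw [abs_of_pos (div_pos (h.pos hy) (h.pos_right hy))]

theorem lintegral_ofReal_eq (h : UpPair l f g v) :
    ∫⁻ y, ENNReal.ofReal (f y) = ∫⁻ x, ENNReal.ofReal (g x) := by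
  rw [← setLIntegral_support_ofReal f, ← setLIntegral_support_ofReal g, h.lintegral]
  refine setLIntegral_congr_fun h.isOpen.measurableSet fun y hy => ?_
  rw [← ENNReal.ofReal_mul (div_pos (h.pos hy) (h.pos_right hy)).le,
    div_mul_cancel₀ _ (h.pos_right hy).ne']

theorem continuousOn (h : UpPair l f g v) : ContinuousOn v (Function.support f) :=
  fun y hy => (h.hasDerivAt y hy).continuousAt.continuousWithinAt

theorem ae_of_ae (h : UpPair l f g v) {S : Set ℝ} (hS : MeasurableSet S)
    (hg : ∀ᵐ x, x ∈ Function.support g → x ∈ S) :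
    ∀ᵐ y, y ∈ Function.support f → v y ∈ S := by
  have hm := h.isOpen.measurableSet
  have h0 : ∫⁻ x in Function.support g, Sᶜ.indicator (1 : ℝ → ℝ≥0∞) x = 0 := by
    rw [lintegral_eq_zero_iff (measurable_one.indicator hS.compl)]
    have : ∀ᵐ x ∂volume.restrict (Function.support g), x ∈ S := (ae_restrict_iff hS).2 hg
    filter_upwards [this] with x hx
    simp [hx]
  rw [h.lintegral] at h0
  have hvm : AEMeasurable v (volume.restrict (Function.support f)) :=
    h.continuousOn.aemeasurable hm
  have hd : (fun y => ENNReal.ofReal (f y / g (v y)) * Sᶜ.indicator (1 : ℝ → ℝ≥0∞) (v y))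
      =ᵐ[volume.restrict (Function.support f)]
      fun y => ENNReal.ofReal (deriv v y) * Sᶜ.indicator (1 : ℝ → ℝ≥0∞) (v y) := by
    rw [EventuallyEq, ae_restrict_iff' hm]
    filter_upwards with y hy
    rw [(h.hasDerivAt y hy).deriv]
  rw [lintegral_congr_ae hd, lintegral_eq_zero_iff'] at h0
  · rw [← ae_restrict_iff' hm]
    have h1 := hd.trans h0
    rw [EventuallyEq, ae_restrict_iff' hm] at h1
    rw [ae_restrict_iff' hm]
    filter_upwards [h1] with y hy hyf
    by_contra hc
    have h2 := hy hyf
    have h3 : 0 < f y / g (v y) := div_pos (h.pos hyf) (h.pos_right hyf)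
    simp [hc] at h2
    exact absurd h2 (not_le.2 h3)
  · exact ((measurable_deriv v).ennreal_ofReal.aemeasurable).mul
      ((measurable_one.indicator hS.compl).comp_aemeasurable hvm)

theorem ne_zero (h : UpPair l f g v) {y : ℝ} (hy : y ∈ Function.support f) : v y ≠ 0 :=
  (h.mem hy).2

theorem abs_rpow (h : UpPair l f g v) (hl : l ≠ 0) {y : ℝ} (hy : y ∈ Function.support f) (c : ℝ) :
    |l * v y| ^ c = f y ^ (l * c) := by
  rw [h.eq y hy, ← Real.rpow_mul (abs_nonneg _)]
  congr 1
  field_simp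

theorem hasDerivAt_left (h : UpPair l f g v) (hl : l ≠ 0) {y : ℝ} (hy : y ∈ Function.support f) :
    HasDerivAt f ((SignType.sign (l * v y) : ℝ) * (f y ^ (2 - l) / g (v y))) y := by
  have hlv : l * v y ≠ 0 := mul_ne_zero hl (h.ne_zero hy)
  have h1 : HasDerivAt (fun y => |l * v y| ^ (1 / l)) _ y :=
    ((hasDerivAt_abs hlv).comp y ((h.hasDerivAt y hy).const_mul l)).rpow_const
      (p := 1 / l) (Or.inl (abs_ne_zero.2 hlv))
  have h2 : HasDerivAt f _ y := h1.congr_of_eventuallyEq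
    (by filter_upwards [h.isOpen.mem_nhds hy] with z hz using h.eq z hz)
  convert h2 using 1
  simp only [Function.comp]
  rw [h.abs_rpow hl hy]
  have hf := h.pos hy
  have hg := h.pos_right hy
  have e1 : f y ^ (2 - l) = f y * f y ^ (l * (1 / l - 1)) := by
    nth_rw 2 [← Real.rpow_one (f y)]
    rw [← Real.rpow_add hf]
    congr 1
    field_simp
    ring
  rw [e1]
  field_simp

theorem abs_deriv_left (h : UpPair l f g v) (hl : l ≠ 0) {y : ℝ} (hy : y ∈ Function.support f) :
    |deriv f y| = f y ^ (2 - l) / g (v y) := by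
  have hlv : l * v y ≠ 0 := mul_ne_zero hl (h.ne_zero hy)
  have hp : 0 < f y ^ (2 - l) / g (v y) := div_pos (Real.rpow_pos_of_pos (h.pos hy) _)
    (h.pos_right hy)
  rw [(h.hasDerivAt_left hl hy).deriv, abs_mul, abs_of_pos hp]
  rcases lt_or_gt_of_ne hlv with h1 | h1 <;> simp [h1]

theorem sign_mul_self (x : ℝ) (hx : x ≠ 0) :
    (SignType.sign x : ℝ) * (SignType.sign x : ℝ) = 1 := by
  rcases lt_or_gt_of_ne hx with h1 | h1 <;> simp [h1]

theorem deriv_deriv_left (h : UpPair l f g v) (hl : l ≠ 0) {y : ℝ} (hy : y ∈ Function.support f)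
    (hd : DifferentiableAt ℝ g (v y)) :
    |(2 - l) - f y * deriv (deriv f) y / (deriv f y) ^ 2|
      = f y ^ l / g (v y) * |deriv g (v y)| := by
  have hlv : l * v y ≠ 0 := mul_ne_zero hl (h.ne_zero hy)
  have hf := h.pos hy
  have hg := h.pos_right hy
  set σ : ℝ := (SignType.sign (l * v y) : ℝ) with hσ
  have hσ2 : σ * σ = 1 := sign_mul_self _ hlv
  have hev : deriv f =ᶠ[𝓝 y] fun z => σ * (f z ^ (2 - l) / g (v z)) := by
    have hc : ∀ᶠ z in 𝓝 y, SignType.sign (l * v z) = SignType.sign (l * v y) := by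
      have hcont : ContinuousAt (fun z => l * v z) y :=
        continuousAt_const.mul (h.hasDerivAt y hy).continuousAt
      rcases lt_or_gt_of_ne hlv with h1 | h1
      · filter_upwards [hcont.eventually (gt_mem_nhds h1)] with z hz
        rw [sign_neg h1, sign_neg hz]
      · filter_upwards [hcont.eventually (lt_mem_nhds h1)] with z hz
        rw [sign_pos h1, sign_pos hz]
    filter_upwards [h.isOpen.mem_nhds hy, hc] with z hz hs
    rw [(h.hasDerivAt_left hl hz).deriv, hs]
  have hfd := h.hasDerivAt_left hl hy
  have hgd : HasDerivAt (fun z => g (v z)) (deriv g (v y) * (f y / g (v y))) y :=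
    hd.hasDerivAt.comp y (h.hasDerivAt y hy)
  have h1 := ((hfd.rpow_const (p := 2 - l) (Or.inl hf.ne')).div hgd hg.ne').const_mul σ
  rw [hev.deriv_eq, hfd.deriv]
  rw [← hσ] at h1 ⊢
  have h1' := h1.deriv
  simp only [Pi.div_def] at h1'
  rw [h1']
  have e1 : f y ^ (2 - l - 1) = f y ^ (2 - l) / f y := by
    rw [Real.rpow_sub hf, Real.rpow_one]
  have e2 : f y ^ l * f y ^ (2 - l) = f y ^ 2 := by
    rw [← Real.rpow_add hf, ← Real.rpow_natCast]
    norm_num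
  rw [e1]
  set A := f y ^ (2 - l) with hA
  have hA0 : 0 < A := Real.rpow_pos_of_pos hf _
  set B := f y ^ l with hB
  set D := deriv g (v y)
  set G := g (v y)
  have key : (2 - l) - f y * (σ * ((σ * (A / G) * (2 - l) * (A / f y) * G - A * (D * (f y / G)))
      / G ^ 2)) / (σ * (A / G)) ^ 2 = σ * (B / G * D) := by
    have hB' : B = f y ^ 2 / A := by rw [← e2]; field_simp
    have hs2 : σ ^ 2 = 1 := by rw [sq, hσ2]
    have hs3 : σ ≠ 0 := fun h0 => by simp [h0] at hσ2
    rw [hB']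
    have hfy := hf.ne'
    field_simp
    ring_nf
    simp only [hs2]
    ring
  rw [key, abs_mul, abs_mul, abs_of_pos (div_pos (Real.rpow_pos_of_pos hf _) hg)]
  have : |σ| = 1 := by
    rcases lt_or_gt_of_ne hlv with h1 | h1 <;> simp [hσ, h1]
  rw [this, one_mul]

theorem fisher_eq (h : UpPair l f g v) (hl : l ≠ 0) (s : ℝ) :
    fisher s l f = ∫⁻ x in Function.support g, ENNReal.ofReal (g x ^ (1 - s)) := by
  rw [h.lintegral, fisher]
  refine setLIntegral_congr_fun h.isOpen.measurableSet fun y hy => ?_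
  have hf := h.pos hy
  have hg := h.pos_right hy
  rw [abs_mul, h.abs_deriv_left hl hy, abs_of_pos (Real.rpow_pos_of_pos hf _)]
  obtain ⟨F, hF⟩ : ∃ F, Real.exp F = f y := ⟨_, Real.exp_log hf⟩
  obtain ⟨G, hG⟩ : ∃ G, Real.exp G = g (v y) := ⟨_, Real.exp_log hg⟩
  rw [← hF, ← hG]
  simp only [← Real.exp_mul, ← Real.exp_sub, ← Real.exp_add,
    ENNReal.ofReal_rpow_of_pos (Real.exp_pos _), ← ENNReal.ofReal_mul (Real.exp_pos _).le]
  ring_nf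

theorem downFisher_eq (h : UpPair l f g v) (hl : l ≠ 0) {p q : ℝ} (hp : p ≠ 0) (hpq : p ≠ q)
    (hd : ∀ᵐ x, x ∈ Function.support g → DifferentiableAt ℝ g x) :
    downFisher p q ((2 - l) * (p - q) / p) f = fisher p ((p - q) / p) g := by
  have hpq' : p - q ≠ 0 := sub_ne_zero.2 hpq
  rw [fisher, h.lintegral, downFisher]
  refine setLIntegral_congr_fun_ae h.isOpen.measurableSet ?_
  filter_upwards [h.ae_of_ae (measurableSet_of_differentiableAt ℝ g) hd] with y hy' hy
  have hdy : DifferentiableAt ℝ g (v y) := hy' hy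
  have hf := h.pos hy
  have hg := h.pos_right hy
  have e : p * ((2 - l) * (p - q) / p) / (p - q) = 2 - l := by field_simp
  rw [e, h.deriv_deriv_left hl hy hdy, h.abs_deriv_left hl hy]
  obtain ⟨F, hF⟩ : ∃ F, Real.exp F = f y := ⟨_, Real.exp_log hf⟩
  obtain ⟨G, hG⟩ : ∃ G, Real.exp G = g (v y) := ⟨_, Real.exp_log hg⟩
  rw [← hF, ← hG, abs_mul, abs_of_pos (Real.rpow_pos_of_pos (Real.exp_pos G) _)]
  simp only [← Real.exp_mul, ← Real.exp_sub,
    ENNReal.ofReal_rpow_of_pos (Real.exp_pos _), ENNReal.ofReal_mul (Real.exp_pos _).le]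
  rw [ENNReal.mul_rpow_of_ne_top ENNReal.ofReal_ne_top ENNReal.ofReal_ne_top,
    ENNReal.mul_rpow_of_ne_top ENNReal.ofReal_ne_top ENNReal.ofReal_ne_top]
  simp only [← Real.exp_mul, ENNReal.ofReal_rpow_of_pos (Real.exp_pos _)]
  simp only [← mul_assoc]
  rw [mul_right_comm _ (ENNReal.ofReal |_| ^ p)]
  simp only [← ENNReal.ofReal_mul (Real.exp_pos _).le, ← Real.exp_add]
  congr 3
  field_simp
  ring

end UpPair

/-! ### The Stam product -/

/-- `[N_{1-s}[g] F_{p,b}[g]^{1/(p-q)}]^{θ₂}` with `b = (p-q)/p`. -/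
def stamProduct (p q s : ℝ) (g : ℝ → ℝ) : ℝ≥0∞ :=
  (renyiPower (1 - s) g * fisher p ((p - q) / p) g ^ (1 / (p - q))) ^ theta2 s p q

theorem UpPair.factorF_eq {l : ℝ} {f g v : ℝ → ℝ} (h : UpPair l f g v) (hl : l ≠ 0) (s : ℝ) :
    factorF s l f = renyiPower (1 - s) g := by
  rw [factorF, renyiPower, h.fisher_eq hl, sub_sub_cancel]

theorem UpPair.factorPhi_eq {l : ℝ} {f g v : ℝ → ℝ} (h : UpPair l f g v) (hl : l ≠ 0) {p q : ℝ}
    (hp : p ≠ 0) (hpq : p ≠ q) (hd : ∀ᵐ x, x ∈ Function.support g → DifferentiableAt ℝ g x) :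
    factorPhi p q l f = fisher p ((p - q) / p) g ^ (1 / (p - q)) := by
  rw [factorPhi, h.downFisher_eq hl hp hpq hd]

theorem UpPair.dffProduct_eq {l : ℝ} {f g v : ℝ → ℝ} (h : UpPair l f g v) (hl : l ≠ 0) {p q : ℝ}
    (hp : p ≠ 0) (hpq : p ≠ q) (s : ℝ)
    (hd : ∀ᵐ x, x ∈ Function.support g → DifferentiableAt ℝ g x) :
    dffProduct p q s l f = stamProduct p q s g := by
  rw [dffProduct, h.factorF_eq hl, h.factorPhi_eq hl hp hpq hd, stamProduct]

/-! ### Reparametrized functions -/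

theorem reparam_apply {I : Set ℝ} {X : ℝ → ℝ} (v : ℝ → ℝ) (hX : InjOn X I) {t : ℝ} (ht : t ∈ I) :
    reparam I X v (X t) = v t := by
  rw [reparam, indicator_of_mem (mem_image_of_mem X ht), hX.leftInvOn_invFunOn ht]

theorem reparam_of_notMem {I : Set ℝ} {X : ℝ → ℝ} (v : ℝ → ℝ) {y : ℝ} (hy : y ∉ X '' I) :
    reparam I X v y = 0 := by
  rw [reparam, indicator_of_notMem hy]

theorem support_reparam {I : Set ℝ} {X v : ℝ → ℝ} (hX : InjOn X I) :
    Function.support (reparam I X v) = X '' (I ∩ Function.support v) := by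
  ext y
  constructor
  · intro hy
    by_cases h : y ∈ X '' I
    · obtain ⟨t, ht, rfl⟩ := h
      rw [Function.mem_support, reparam_apply v hX ht] at hy
      exact ⟨t, ⟨ht, hy⟩, rfl⟩
    · exact absurd (reparam_of_notMem v h) hy
  · rintro ⟨t, ⟨ht, hv⟩, rfl⟩
    rwa [Function.mem_support, reparam_apply v hX ht]

theorem reparam_nonneg {I : Set ℝ} {X v : ℝ → ℝ} (hX : InjOn X I) (hv : ∀ t ∈ I, 0 ≤ v t) (y : ℝ) :
    0 ≤ reparam I X v y := by
  by_cases h : y ∈ X '' I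
  · obtain ⟨t, ht, rfl⟩ := h
    rw [reparam_apply v hX ht]
    exact hv t ht
  · rw [reparam_of_notMem v h]

/-! ### Densities -/

theorem IsDensity.pos {f : ℝ → ℝ} (h : IsDensity f) {x : ℝ} (hx : x ∈ Function.support f) :
    0 < f x :=
  lt_of_le_of_ne (h.nonneg x) (Ne.symm hx)

theorem IsDensity.nonempty {f : ℝ → ℝ} (h : IsDensity f) : (Function.support f).Nonempty := by
  rw [Function.support_nonempty_iff]
  rintro rfl
  have := h.lintegral_eq_one
  simp at this

theorem IsDensity.convex {f : ℝ → ℝ} (h : IsDensity f) : Convex ℝ (Function.support f) :=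
  h.ordConnected_support.convex

theorem IsDensity.basePoint_mem {f : ℝ → ℝ} (h : IsDensity f) :
    basePoint f ∈ Function.support f :=
  Classical.epsilon_spec h.nonempty

/-! ### The down transformation -/

section down

variable {l : ℝ} {f : ℝ → ℝ}

theorem downVar_eq (hl : l ≠ 0) (x : ℝ) : downVar (2 - l) f x = f x ^ l / (-l) := by
  rw [downVar, if_neg (by simpa using hl)]
  ring_nf

theorem IsDecreasingDensity.hasDerivAt (hf : IsDecreasingDensity f) {x : ℝ}
    (hx : x ∈ Function.support f) : HasDerivAt f (deriv f x) x :=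
  (differentiableAt_of_deriv_ne_zero (hf.deriv_neg x hx).ne).hasDerivAt

theorem hasDerivAt_downVar (hf : IsDecreasingDensity f) (hl : l ≠ 0) {x : ℝ}
    (hx : x ∈ Function.support f) :
    HasDerivAt (downVar (2 - l) f) (f x ^ (l - 1) * |deriv f x|) x := by
  have h1 := ((hf.hasDerivAt hx).rpow_const (p := l) (Or.inl (hf.toIsDensity.pos hx).ne')).div_const
    (-l)
  have h2 : downVar (2 - l) f = fun x => f x ^ l / (-l) := funext fun x => downVar_eq hl x
  rw [h2]
  refine h1.congr_deriv ?_
  rw [abs_of_neg (hf.deriv_neg x hx)]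
  field_simp

theorem strictMonoOn_downVar (hf : IsDecreasingDensity f) (hl : l ≠ 0) :
    StrictMonoOn (downVar (2 - l) f) (Function.support f) := by
  refine strictMonoOn_of_deriv_pos hf.toIsDensity.convex
    (fun x hx => (hasDerivAt_downVar hf hl hx).continuousAt.continuousWithinAt) fun x hx => ?_
  rw [hf.isOpen_support.interior_eq] at hx
  rw [(hasDerivAt_downVar hf hl hx).deriv]
  exact mul_pos (Real.rpow_pos_of_pos (hf.toIsDensity.pos hx) _)
    (abs_pos.2 (hf.deriv_neg x hx).ne)

theorem down_apply (hf : IsDecreasingDensity f) (hl : l ≠ 0) {x : ℝ}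
    (hx : x ∈ Function.support f) :
    down (2 - l) f (downVar (2 - l) f x) = f x ^ (2 - l) * |deriv f x|⁻¹ :=
  reparam_apply _ (strictMonoOn_downVar hf hl).injOn hx

theorem support_down (hf : IsDecreasingDensity f) (hl : l ≠ 0) :
    Function.support (down (2 - l) f) = downVar (2 - l) f '' Function.support f := by
  rw [down, support_reparam (strictMonoOn_downVar hf hl).injOn]
  congr 1
  rw [inter_eq_left]
  intro x hx
  exact (mul_pos (Real.rpow_pos_of_pos (hf.toIsDensity.pos hx) _)
    (inv_pos.2 (abs_pos.2 (hf.deriv_neg x hx).ne))).ne'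

theorem upPair_down (hf : IsDecreasingDensity f) (hl : l ≠ 0) :
    UpPair l f (down (2 - l) f) (downVar (2 - l) f) := by
  have hpos : ∀ x ∈ Function.support f, 0 < f x ^ l := fun x hx =>
    Real.rpow_pos_of_pos (hf.toIsDensity.pos hx) _
  refine ⟨hf.isOpen_support, hf.nonneg, ?_, (strictMonoOn_downVar hf hl).injOn, ?_, ?_, ?_⟩
  · exact reparam_nonneg (strictMonoOn_downVar hf hl).injOn fun x hx =>
      mul_nonneg (Real.rpow_nonneg (hf.nonneg x) _) (inv_nonneg.2 (abs_nonneg _))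
  · rw [support_down hf hl, eq_comm, sdiff_eq_left, disjoint_singleton_right]
    rintro ⟨x, hx, h0⟩
    rw [downVar_eq hl, div_eq_zero_iff] at h0
    rcases h0 with h0 | h0
    · exact (hpos x hx).ne' h0
    · exact hl (neg_eq_zero.1 h0)
  · intro x hx
    rw [down_apply hf hl hx]
    convert hasDerivAt_downVar hf hl hx using 1
    have hfx := hf.toIsDensity.pos hx
    have hd : 0 < |deriv f x| := abs_pos.2 (hf.deriv_neg x hx).ne
    have e : f x ^ (l - 1) * f x ^ (2 - l) = f x := by
      rw [← Real.rpow_add hfx]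
      norm_num
    have hA : 0 < f x ^ (2 - l) := Real.rpow_pos_of_pos hfx _
    nth_rw 1 [← e]
    field_simp
  · intro x hx
    have e : |l * downVar (2 - l) f x| = f x ^ l := by
      rw [downVar_eq hl, ← abs_of_pos (hpos x hx), ← abs_neg]
      congr 1
      rw [abs_of_pos (hpos x hx)]
      field_simp
    rw [e, ← Real.rpow_mul (hf.nonneg x), mul_one_div_cancel hl, Real.rpow_one]

theorem isDensity_down (hf : IsDecreasingDensity f) (hl : l ≠ 0) : IsDensity (down (2 - l) f) := by
  have hc : ContinuousOn (downVar (2 - l) f) (Function.support f) :=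
    fun x hx => (hasDerivAt_downVar hf hl hx).continuousAt.continuousWithinAt
  have h := upPair_down hf hl
  refine ⟨h.nonneg_right, ?_, ?_, ?_⟩
  · rw [support_down hf hl]
    exact isOpen_image_of_strictMonoOn hf.isOpen_support hc (strictMonoOn_downVar hf hl)
  · rw [support_down hf hl]
    exact ordConnected_image hf.ordConnected_support hc
  · rw [← h.lintegral_ofReal_eq, hf.lintegral_eq_one]

end down

/-! ### The up transformation -/

section up

variable {l : ℝ} {g : ℝ → ℝ}

theorem upWeight_eq (hl : l ≠ 0) (x : ℝ) :
    upWeight (2 - l) g x = (|l * x| ^ (1 / l))⁻¹ * g x := by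
  rw [upWeight, if_neg (by simpa using hl), ← Real.rpow_neg (abs_nonneg _)]
  have h1 : 2 - l - 2 = -l := by ring
  rw [h1, neg_mul, abs_neg]
  congr 2
  field_simp

/-- Canonical variable of the up transformation. -/
def upVar (a : ℝ) (g : ℝ → ℝ) (x : ℝ) : ℝ := ∫ v in (basePoint g)..x, upWeight a g v

theorem up_eq_reparam (hl : l ≠ 0) :
    up (2 - l) g = reparam (Function.support g) (upVar (2 - l) g) fun x => |l * x| ^ (1 / l) := by
  have h2 : ∀ x, |(2 - l - 2) * x| = |l * x| := fun x => by
    rw [← abs_neg]; congr 1; ring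
  have h3 : (2 : ℝ) - (2 - l) = l := by ring
  have h4 : ¬ (2 - l = 2) := by simpa using hl
  simp only [up, if_neg h4, h2, h3]
  rfl

theorem upWeight_nonneg (hg : IsDensity g) (hl : l ≠ 0) (x : ℝ) : 0 ≤ upWeight (2 - l) g x := by
  rw [upWeight_eq hl]
  exact mul_nonneg (inv_nonneg.2 (Real.rpow_nonneg (abs_nonneg _) _)) (hg.nonneg x)

theorem upWeight_pos (hg : IsDensity g) (hl : l ≠ 0) {x : ℝ} (hx : x ∈ Function.support g)
    (h0 : x ≠ 0) : 0 < upWeight (2 - l) g x := by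
  rw [upWeight_eq hl]
  exact mul_pos (inv_pos.2 (Real.rpow_pos_of_pos (abs_pos.2 (mul_ne_zero hl h0)) _)) (hg.pos hx)

theorem intervalIntegrable_upWeight (hg : IsDensity g) (hu : UpDefined (2 - l) g)
    {x y : ℝ} (hx : x ∈ Function.support g) (hy : y ∈ Function.support g) :
    IntervalIntegrable (upWeight (2 - l) g) volume x y := by
  rw [intervalIntegrable_iff']
  exact hu.integrableOn_compact_subset (hg.ordConnected_support.uIcc_subset hx hy) isCompact_uIcc

theorem strictMonoOn_upVar (hg : IsDensity g) (hl : l ≠ 0) (hu : UpDefined (2 - l) g) :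
    StrictMonoOn (upVar (2 - l) g) (Function.support g) := by
  intro x hx y hy hxy
  have hb := hg.basePoint_mem
  rw [← sub_pos, upVar, upVar, intervalIntegral.integral_interval_sub_left
    (intervalIntegrable_upWeight hg hu hb hy) (intervalIntegrable_upWeight hg hu hb hx),
    intervalIntegral.integral_pos_iff_support_of_nonneg_ae
      (Eventually.of_forall fun z => upWeight_nonneg hg hl z)
      (intervalIntegrable_upWeight hg hu hx hy)]
  refine ⟨hxy, ?_⟩
  have hsub : Ioc x y \ {0} ⊆ Function.support (upWeight (2 - l) g) ∩ Ioc x y := fun z hz =>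
    ⟨(upWeight_pos hg hl (hg.ordConnected_support.out hx hy ⟨hz.1.1.le, hz.1.2⟩) hz.2).ne', hz.1⟩
  refine lt_of_lt_of_le ?_ (measure_mono hsub)
  rw [measure_sdiff_null (measure_singleton 0), Real.volume_Ioc]
  simpa using hxy

theorem continuousOn_upVar (hg : IsDensity g) (hu : UpDefined (2 - l) g) :
    ContinuousOn (upVar (2 - l) g) (Function.support g) := by
  intro x hx
  obtain ⟨a, b, ha, hb, hab⟩ := exists_Icc_subset_of_isOpen hg.isOpen_support hx
  have hp := hg.basePoint_mem
  have ha' : a ∈ Function.support g := hab ⟨le_rfl, by linarith⟩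
  have hb' : b ∈ Function.support g := hab ⟨by linarith, le_rfl⟩
  have hmin : min (basePoint g) a ∈ Function.support g := by
    rcases min_choice (basePoint g) a with h | h <;> rw [h] <;> assumption
  have hmax : max (basePoint g) b ∈ Function.support g := by
    rcases max_choice (basePoint g) b with h | h <;> rw [h] <;> assumption
  have hle : min (basePoint g) a ≤ max (basePoint g) b :=
    (min_le_left _ _).trans (le_max_left _ _)
  have := intervalIntegral.continuousOn_primitive_interval' (a := basePoint g)
    (intervalIntegrable_upWeight hg hu hmin hmax)
    (by rw [uIcc_of_le hle]; exact ⟨min_le_left _ _, le_max_left _ _⟩)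
  rw [uIcc_of_le hle] at this
  exact (this.continuousAt (Icc_mem_nhds ((min_le_right _ _).trans_lt ha)
    (hb.trans_le (le_max_right _ _)))).continuousWithinAt

theorem continuousAt_upWeight (hl : l ≠ 0) {x : ℝ} (hc : ContinuousAt g x) (h0 : x ≠ 0) :
    ContinuousAt (upWeight (2 - l) g) x := by
  have h2 : upWeight (2 - l) g = fun x => (|l * x| ^ (1 / l))⁻¹ * g x :=
    funext fun x => upWeight_eq hl x
  have h3 : |l * x| ≠ 0 := abs_ne_zero.2 (mul_ne_zero hl h0)
  rw [h2]
  refine ContinuousAt.mul (ContinuousAt.inv₀ (ContinuousAt.rpow_const ?_ (Or.inl h3)) ?_) hc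
  · exact (continuous_abs.comp (continuous_const.mul continuous_id)).continuousAt
  · exact (Real.rpow_pos_of_pos (abs_pos.2 (mul_ne_zero hl h0)) _).ne'

theorem hasDerivAt_upVar (hg : IsDensity g) (hl : l ≠ 0) (hu : UpDefined (2 - l) g)
    (hc : ContinuousOn g (Function.support g)) {x : ℝ} (hx : x ∈ Function.support g) (h0 : x ≠ 0) :
    HasDerivAt (upVar (2 - l) g) (upWeight (2 - l) g x) x := by
  have hev : ∀ᶠ z in 𝓝 x, ContinuousAt (upWeight (2 - l) g) z := by
    filter_upwards [hg.isOpen_support.mem_nhds hx, isOpen_ne.mem_nhds h0] with z hz hz0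
    exact continuousAt_upWeight hl (hc.continuousAt (hg.isOpen_support.mem_nhds hz)) hz0
  obtain ⟨U, hU, hUo, hxU⟩ := eventually_nhds_iff.1 hev
  refine intervalIntegral.integral_hasDerivAt_right
    (intervalIntegrable_upWeight hg hu hg.basePoint_mem hx) ?_ hev.self_of_nhds
  exact ContinuousOn.stronglyMeasurableAtFilter hUo
    (fun z hz => (hU z hz).continuousWithinAt) x hxU

theorem support_up (hg : IsDensity g) (hl : l ≠ 0) (hu : UpDefined (2 - l) g) :
    Function.support (up (2 - l) g) = upVar (2 - l) g '' (Function.support g \ {0}) := by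
  rw [up_eq_reparam hl, support_reparam (strictMonoOn_upVar hg hl hu).injOn]
  congr 1
  ext x
  simp only [mem_inter_iff, Function.mem_support, Set.mem_sdiff, mem_singleton_iff]
  refine and_congr_right fun _ => not_congr ?_
  rw [Real.rpow_eq_zero (abs_nonneg _) (one_div_ne_zero hl), abs_eq_zero, mul_eq_zero]
  simp [hl]

theorem upPair_up (hg : IsDensity g) (hl : l ≠ 0) (hu : UpDefined (2 - l) g)
    (hc : ContinuousOn g (Function.support g)) :
    UpPair l (up (2 - l) g) g
      (Function.invFunOn (upVar (2 - l) g) (Function.support g)) := by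
  have hm := strictMonoOn_upVar hg hl hu
  have hcu := continuousOn_upVar hg hu
  refine ⟨?_, ?_, hg.nonneg, ?_, ?_, ?_, ?_⟩
  · rw [support_up hg hl hu]
    exact isOpen_image_of_strictMonoOn (hg.isOpen_support.sdiff isClosed_singleton)
      (hcu.mono sdiff_subset) (hm.mono sdiff_subset)
  · rw [up_eq_reparam hl]
    exact reparam_nonneg hm.injOn fun _ _ => Real.rpow_nonneg (abs_nonneg _) _
  · rw [support_up hg hl hu]
    exact (strictMonoOn_invFunOn hm).injOn.mono (image_mono sdiff_subset)
  · rw [support_up hg hl hu, image_image]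
    exact (image_congr fun x hx => hm.injOn.leftInvOn_invFunOn hx.1).trans (image_id _)
  · intro y hy
    rw [support_up hg hl hu] at hy
    obtain ⟨x, ⟨hx, h0⟩, rfl⟩ := hy
    have h1 := hasDerivAt_invFunOn hg.isOpen_support hcu hm hx
      (hasDerivAt_upVar hg hl hu hc hx h0) (upWeight_pos hg hl hx h0).ne'
    convert h1 using 1
    rw [hm.injOn.leftInvOn_invFunOn hx, up_eq_reparam hl, reparam_apply _ hm.injOn hx,
      upWeight_eq hl, mul_inv, inv_inv, div_eq_mul_inv]
  · intro y hy
    rw [support_up hg hl hu] at hy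
    obtain ⟨x, ⟨hx, h0⟩, rfl⟩ := hy
    rw [hm.injOn.leftInvOn_invFunOn hx, up_eq_reparam hl, reparam_apply _ hm.injOn hx]

theorem upDefined_of_support_subset (hg : IsDensity g) (hl : l ≠ 0)
    (hc : ContinuousOn g (Function.support g)) (h0 : (0 : ℝ) ∉ Function.support g) :
    UpDefined (2 - l) g := by
  refine ContinuousOn.locallyIntegrableOn (fun x hx => ?_) hg.isOpen_support.measurableSet
  exact (continuousAt_upWeight hl (hc.continuousAt (hg.isOpen_support.mem_nhds hx))
    (fun h => h0 (h ▸ hx))).continuousWithinAt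

theorem isDecreasingDensity_up (hg : IsDensity g) (hl : l ≠ 0)
    (hc : ContinuousOn g (Function.support g))
    (hs : Function.support g ⊆ {x | 0 < -l * x}) : IsDecreasingDensity (up (2 - l) g) := by
  have h0 : (0 : ℝ) ∉ Function.support g := fun h => by simpa using hs h
  have hu := upDefined_of_support_subset hg hl hc h0
  have h := upPair_up hg hl hu hc
  refine ⟨⟨h.nonneg, h.isOpen, ?_, ?_⟩, ?_⟩
  · rw [support_up hg hl hu, sdiff_singleton_eq_self h0]
    exact ordConnected_image hg.ordConnected_support (continuousOn_upVar hg hu)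
  · rw [h.lintegral_ofReal_eq, hg.lintegral_eq_one]
  · intro y hy
    have h1 : 0 < -l * _ := hs (h.mem hy).1
    rw [(h.hasDerivAt_left hl hy).deriv, sign_neg (by linarith)]
    have := div_pos (Real.rpow_pos_of_pos (h.pos hy) (2 - l)) (h.pos_right hy)
    simpa using this

theorem down_up (hg : IsDensity g) (hl : l ≠ 0) (hc : ContinuousOn g (Function.support g))
    (hs : Function.support g ⊆ {x | 0 < -l * x}) : down (2 - l) (up (2 - l) g) = g := by
  have h0 : (0 : ℝ) ∉ Function.support g := fun h => by simpa using hs h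
  have hu := upDefined_of_support_subset hg hl hc h0
  have h := upPair_up hg hl hu hc
  have hf := isDecreasingDensity_up hg hl hc hs
  set f := up (2 - l) g
  set v := Function.invFunOn (upVar (2 - l) g) (Function.support g)
  have hv : ∀ y ∈ Function.support f, downVar (2 - l) f y = v y := by
    intro y hy
    have h1 : 0 < -l * v y := hs (h.mem hy).1
    have h2 := h.abs_rpow hl hy 1
    rw [Real.rpow_one, mul_one, abs_of_neg (by linarith)] at h2
    rw [downVar_eq hl, ← h2]
    field_simp
  ext x
  by_cases hx : x ∈ Function.support g
  · have hx' : x ∈ v '' Function.support f := by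
      rw [h.image]; exact ⟨hx, fun h' => h0 (h' ▸ hx)⟩
    obtain ⟨y, hy, rfl⟩ := hx'
    have h3 := h.pos_right hy
    have h4 := Real.rpow_pos_of_pos (h.pos hy) (2 - l)
    rw [← hv y hy, down_apply hf hl hy, h.abs_deriv_left hl hy, hv y hy]
    field_simp
  · have h1 : x ∉ Function.support (down (2 - l) f) := by
      rw [support_down hf hl, image_congr hv, h.image]
      exact fun h' => hx h'.1
    rw [Function.notMem_support.1 h1, Function.notMem_support.1 hx]

end up

/-! ### Boundary behaviour -/

theorem IsDensity.aemeasurable {g : ℝ → ℝ} (hg : IsDensity g)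
    (hc : ContinuousOn g (Function.support g)) : AEMeasurable g := by
  have h := (hc.aemeasurable (μ := volume) hg.isOpen_support.measurableSet)
  rw [← aemeasurable_indicator_iff hg.isOpen_support.measurableSet, indicator_support] at h
  exact h

theorem IsDensity.integrable {g : ℝ → ℝ} (hg : IsDensity g)
    (hc : ContinuousOn g (Function.support g)) : Integrable g := by
  refine ⟨(hg.aemeasurable hc).aestronglyMeasurable, ?_⟩
  rw [hasFiniteIntegral_iff_ofReal (Eventually.of_forall hg.nonneg), hg.lintegral_eq_one]
  exact ENNReal.one_lt_top

theorem IsDensity.integral_eq_one {g : ℝ → ℝ} (hg : IsDensity g)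
    (hc : ContinuousOn g (Function.support g)) : ∫ x, g x = 1 := by
  rw [integral_eq_lintegral_of_nonneg_ae (Eventually.of_forall hg.nonneg)
    (hg.integrable hc).aestronglyMeasurable, hg.lintegral_eq_one, ENNReal.toReal_one]

/-- At the finite endpoints of its support `g` tends to `0` or to `∞`. -/
def EndpointLimit (g : ℝ → ℝ) : Prop :=
  ∀ e ∈ frontier (Function.support g),
    Tendsto g (𝓝[Function.support g] e) (𝓝 0) ∨ Tendsto g (𝓝[Function.support g] e) atTop

theorem exists_lt_of_infinite_volume {g : ℝ → ℝ} (hg : IsDensity g) {T : Set ℝ}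
    (hT : MeasurableSet T) (hT' : volume T = ∞) {δ : ℝ} (hδ : 0 < δ) : ∃ a ∈ T, g a < δ := by
  by_contra! h
  have h1 : ENNReal.ofReal δ * volume T ≤ ∫⁻ x in T, ENNReal.ofReal (g x) := by
    rw [← setLIntegral_const]
    exact setLIntegral_mono' hT fun x hx => ENNReal.ofReal_le_ofReal (h x hx)
  have h2 := h1.trans (setLIntegral_le_lintegral _ _)
  rw [hg.lintegral_eq_one, hT', ENNReal.mul_top (ENNReal.ofReal_pos.2 hδ).ne'] at h2
  exact absurd h2 (by simp)

theorem exists_small_or_large_of_endpoint {g : ℝ → ℝ} (he : EndpointLimit g) {e δ : ℝ} (hδ : 0 < δ)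
    {F : Filter ℝ} [F.NeBot] (hF : F ≤ 𝓝[Function.support g] e) (hF' : e ∉ Function.support g)
    {T : Set ℝ} (hT : T ∈ F) : ∃ a ∈ T, g a < δ ∨ 1 / δ < g a := by
  have hcl : e ∈ closure (Function.support g) :=
    mem_closure_iff_nhdsWithin_neBot.2 (neBot_of_le hF)
  have hfr : e ∈ frontier (Function.support g) := ⟨hcl, fun h => hF' (interior_subset h)⟩
  rcases he e hfr with h | h
  · obtain ⟨a, ha⟩ := (((h.mono_left hF).eventually (gt_mem_nhds hδ)).and hT).exists
    exact ⟨a, ha.2, Or.inl ha.1⟩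
  · obtain ⟨a, ha⟩ := (((h.mono_left hF).eventually (eventually_gt_atTop (1 / δ))).and hT).exists
    exact ⟨a, ha.2, Or.inr ha.1⟩

theorem exists_left_small_or_large {g : ℝ → ℝ} (hg : IsDensity g) (he : EndpointLimit g) {x δ : ℝ}
    (hx : x ∈ Function.support g) (hδ : 0 < δ) :
    ∃ a ∈ Function.support g, a < x ∧ (g a < δ ∨ 1 / δ < g a) := by
  by_cases h : Iio x ⊆ Function.support g
  · obtain ⟨a, ha, h1⟩ := exists_lt_of_infinite_volume hg (measurableSet_Iio (a := x))
      Real.volume_Iio hδ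
    exact ⟨a, h ha, ha, Or.inl h1⟩
  · obtain ⟨z, hz, hz'⟩ := not_subset.1 h
    set B := Iic x ∩ (Function.support g)ᶜ with hB
    have hBc : IsClosed B := isClosed_Iic.inter hg.isOpen_support.isClosed_compl
    have hBb : BddAbove B := ⟨x, fun y hy => hy.1⟩
    have heB := hBc.csSup_mem ⟨z, mem_Iic.2 (mem_Iio.1 hz).le, hz'⟩ hBb
    set e := sSup B
    have hex : e < x := lt_of_le_of_ne heB.1 fun h => heB.2 (h ▸ hx)
    have hsub : Ioo e x ⊆ Function.support g := fun y hy => by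
      by_contra hy'
      exact not_lt.2 (le_csSup hBb ⟨hy.2.le, hy'⟩) hy.1
    have hF : 𝓝[>] e ≤ 𝓝[Function.support g] e :=
      nhdsWithin_le_iff.2 (mem_of_superset (Ioo_mem_nhdsGT hex) hsub)
    obtain ⟨a, ha, h1⟩ := exists_small_or_large_of_endpoint he hδ hF heB.2 (Ioo_mem_nhdsGT hex)
    exact ⟨a, hsub ha, ha.2, h1⟩

theorem exists_right_small_or_large {g : ℝ → ℝ} (hg : IsDensity g) (he : EndpointLimit g) {x δ : ℝ}
    (hx : x ∈ Function.support g) (hδ : 0 < δ) :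
    ∃ a ∈ Function.support g, x < a ∧ (g a < δ ∨ 1 / δ < g a) := by
  by_cases h : Ioi x ⊆ Function.support g
  · obtain ⟨a, ha, h1⟩ := exists_lt_of_infinite_volume hg (measurableSet_Ioi (a := x))
      Real.volume_Ioi hδ
    exact ⟨a, h ha, ha, Or.inl h1⟩
  · obtain ⟨z, hz, hz'⟩ := not_subset.1 h
    set B := Ici x ∩ (Function.support g)ᶜ with hB
    have hBc : IsClosed B := isClosed_Ici.inter hg.isOpen_support.isClosed_compl
    have hBb : BddBelow B := ⟨x, fun y hy => hy.1⟩
    have heB := hBc.csInf_mem ⟨z, mem_Ici.2 (mem_Ioi.1 hz).le, hz'⟩ hBb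
    set e := sInf B
    have hex : x < e := lt_of_le_of_ne heB.1 fun h => heB.2 (h ▸ hx)
    have hsub : Ioo x e ⊆ Function.support g := fun y hy => by
      by_contra hy'
      exact not_lt.2 (csInf_le hBb ⟨hy.1.le, hy'⟩) hy.2
    have hF : 𝓝[<] e ≤ 𝓝[Function.support g] e :=
      nhdsWithin_le_iff.2 (mem_of_superset (Ioo_mem_nhdsLT hex) hsub)
    obtain ⟨a, ha, h1⟩ := exists_small_or_large_of_endpoint he hδ hF heB.2 (Ioo_mem_nhdsLT hex)
    exact ⟨a, hsub ha, ha.1, h1⟩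

theorem rpow_lt_or_lt_of_small_or_large {b c C : ℝ} (hb : b ≠ 0) (hc : 0 < c) (hC : 0 < C) :
    ∃ δ > 0, ∀ t > 0, t < δ ∨ 1 / δ < t → t ^ b < c ∨ C < t ^ b := by
  have hab : 0 < |b| := abs_pos.2 hb
  set δ := min (c ^ (1 / |b|)) ((C⁻¹) ^ (1 / |b|)) with hδ
  have hδ0 : 0 < δ := lt_min (Real.rpow_pos_of_pos hc _) (Real.rpow_pos_of_pos (inv_pos.2 hC) _)
  have h1 : δ ^ |b| ≤ c := by
    refine (Real.rpow_le_rpow hδ0.le (min_le_left _ _) hab.le).trans_eq ?_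
    rw [← Real.rpow_mul hc.le, one_div_mul_cancel hab.ne', Real.rpow_one]
  have h2 : C ≤ (1 / δ) ^ |b| := by
    rw [one_div, Real.inv_rpow hδ0.le, le_inv_comm₀ hC (Real.rpow_pos_of_pos hδ0 _)]
    refine (Real.rpow_le_rpow hδ0.le (min_le_right _ _) hab.le).trans_eq ?_
    rw [← Real.rpow_mul (inv_pos.2 hC).le, one_div_mul_cancel hab.ne', Real.rpow_one]
  have key : ∀ t > 0, (t < δ → t ^ |b| < c) ∧ (1 / δ < t → C < t ^ |b|) := fun t ht =>
    ⟨fun h => (Real.rpow_lt_rpow ht.le h hab).trans_le h1,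
      fun h => h2.trans_lt (Real.rpow_lt_rpow (one_div_pos.2 hδ0).le h hab)⟩
  refine ⟨δ, hδ0, fun t ht h => ?_⟩
  rcases lt_or_gt_of_ne hb with hb' | hb'
  · have ht' : t ^ b = (1 / t) ^ |b| := by
      rw [abs_of_neg hb', one_div, Real.inv_rpow ht.le, Real.rpow_neg ht.le, inv_inv]
    rw [ht']
    have k := key (1 / t) (one_div_pos.2 ht)
    rcases h with h | h
    · exact Or.inr (k.2 (one_div_lt_one_div_of_lt ht h))
    · exact Or.inl (k.1 ((one_div_lt hδ0 ht).1 h))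
  · have k := key t ht
    rw [abs_of_pos hb'] at k
    exact h.imp k.1 k.2

/-- A positive function whose values along a family are neither bounded below nor bounded above is
dominated by its total variation. -/
theorem ofReal_le_of_exists {w : ℝ → ℝ} {A : Set ℝ} {x : ℝ} {I : ℝ≥0∞}
    (hI : ∀ a ∈ A, ENNReal.ofReal |w x - w a| ≤ I)
    (hA : ∀ c > 0, ∀ C > 0, ∃ a ∈ A, w a < c ∨ C < w a) : ENNReal.ofReal (w x) ≤ I := by
  by_contra! h
  have hI' : I ≠ ∞ := (h.trans_le le_top).ne
  have h1 : I.toReal < w x := by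
    have := (ENNReal.lt_ofReal_iff_toReal_lt hI').1 h
    exact this
  have h0 : 0 ≤ I.toReal := ENNReal.toReal_nonneg
  obtain ⟨a, ha, h2⟩ := hA (w x - I.toReal) (by linarith) (w x + I.toReal) (by linarith)
  have h3 := hI a ha
  rw [← ENNReal.ofReal_toReal hI', ENNReal.ofReal_le_ofReal_iff h0, abs_le] at h3
  rcases h2 with h2 | h2 <;> linarith [h3.1, h3.2]

section powerBound

variable {g : ℝ → ℝ} {b : ℝ}

theorem rpow_le_lintegral_left (hg : IsDensity g) (hac : LocallyAC g (Function.support g))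
    (he : EndpointLimit g) (hb : b ≠ 0) {x : ℝ} (hx : x ∈ Function.support g) :
    ENNReal.ofReal (g x ^ b) ≤
      ∫⁻ a in Function.support g ∩ Iio x, ENNReal.ofReal |deriv (fun t => g t ^ b) a| := by
  have hw := hac.rpow (fun x hx => hg.pos hx) b
  refine ofReal_le_of_exists (w := fun t => g t ^ b) (A := Function.support g ∩ Iio x) ?_ ?_
  · rintro a ⟨ha, hax⟩
    have hsub : Icc a x ⊆ Function.support g := hg.ordConnected_support.out ha hx
    refine (AC_abs_sub_le_lintegral (hw a x (le_of_lt hax) hsub) (le_of_lt hax)).trans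
      (lintegral_mono_set fun y hy => ⟨hsub ⟨hy.1.le, hy.2.le⟩, hy.2⟩)
  · intro c hc C hC
    obtain ⟨δ, hδ, h⟩ := rpow_lt_or_lt_of_small_or_large hb hc hC
    obtain ⟨a, ha, hax, h1⟩ := exists_left_small_or_large hg he hx hδ
    exact ⟨a, ⟨ha, hax⟩, h _ (hg.pos ha) h1⟩

theorem rpow_le_lintegral_right (hg : IsDensity g) (hac : LocallyAC g (Function.support g))
    (he : EndpointLimit g) (hb : b ≠ 0) {x : ℝ} (hx : x ∈ Function.support g) :
    ENNReal.ofReal (g x ^ b) ≤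
      ∫⁻ a in Function.support g ∩ Ioi x, ENNReal.ofReal |deriv (fun t => g t ^ b) a| := by
  have hw := hac.rpow (fun x hx => hg.pos hx) b
  refine ofReal_le_of_exists (w := fun t => g t ^ b) (A := Function.support g ∩ Ioi x) ?_ ?_
  · rintro a ⟨ha, hax⟩
    have hsub : Icc x a ⊆ Function.support g := hg.ordConnected_support.out hx ha
    rw [abs_sub_comm]
    refine (AC_abs_sub_le_lintegral (hw x a (le_of_lt hax) hsub) (le_of_lt hax)).trans
      (lintegral_mono_set fun y hy => ⟨hsub ⟨hy.1.le, hy.2.le⟩, hy.1⟩)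
  · intro c hc C hC
    obtain ⟨δ, hδ, h⟩ := rpow_lt_or_lt_of_small_or_large hb hc hC
    obtain ⟨a, ha, hax, h1⟩ := exists_right_small_or_large hg he hx hδ
    exact ⟨a, ⟨ha, hax⟩, h _ (hg.pos ha) h1⟩

theorem ae_deriv_rpow (hg : IsDensity g) (hd : ∀ᵐ x, x ∈ Function.support g → DifferentiableAt ℝ g x)
    (b : ℝ) : ∀ᵐ x, x ∈ Function.support g →
      ENNReal.ofReal |deriv (fun t => g t ^ b) x|
        = ENNReal.ofReal |b| * (ENNReal.ofReal |g x ^ (b - 2) * deriv g x| * ENNReal.ofReal (g x)) := by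
  filter_upwards [hd] with x hx hxs
  have hpos := hg.pos hxs
  have h1 := ((hx hxs).hasDerivAt.rpow_const (p := b) (Or.inl hpos.ne')).deriv
  have e : g x ^ (b - 1) = g x ^ (b - 2) * g x := by
    nth_rw 3 [← Real.rpow_one (g x)]
    rw [← Real.rpow_add hpos]
    ring_nf
  rw [h1, e, ← ENNReal.ofReal_mul (abs_nonneg _), ← ENNReal.ofReal_mul (abs_nonneg _)]
  congr 1
  nth_rw 4 [← abs_of_pos hpos]
  rw [← abs_mul, ← abs_mul]
  congr 1
  ring

end powerBound

/-! ### Monotone transport of densities -/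

theorem cdf_spec {g : ℝ → ℝ} (hg : IsDensity g) (hc : ContinuousOn g (Function.support g)) :
    ∃ t : ℝ → ℝ, (∀ x ∈ Function.support g, HasDerivAt t (g x) x) ∧
      StrictMonoOn t (Function.support g) ∧ t '' Function.support g = Ioo 0 1 := by
  set μ : Measure ℝ := volume.withDensity fun x => ENNReal.ofReal (g x) with hμ
  have hprob : IsProbabilityMeasure μ := ⟨by
    rw [hμ, withDensity_apply _ MeasurableSet.univ, setLIntegral_univ, hg.lintegral_eq_one]⟩
  have hint := hg.integrable hc
  set t : ℝ → ℝ := fun x => ∫ y in Iic x, g y with ht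
  have htc : ∀ x, t x = ProbabilityTheory.cdf μ x := by
    intro x
    rw [ProbabilityTheory.cdf_eq_real, Measure.real, hμ, withDensity_apply _ measurableSet_Iic, ht]
    simp only
    rw [integral_eq_lintegral_of_nonneg_ae (Eventually.of_forall hg.nonneg)
      hint.aestronglyMeasurable.restrict]
  have hdiff : ∀ x0 x, t x = t x0 + ∫ y in x0..x, g y := fun x0 x => by
    rw [← intervalIntegral.integral_Iic_sub_Iic hint.integrableOn hint.integrableOn]
    ring
  have hder : ∀ x ∈ Function.support g, HasDerivAt t (g x) x := by
    intro x hx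
    have hcx : ContinuousAt g x := hc.continuousAt (hg.isOpen_support.mem_nhds hx)
    have h1 : HasDerivAt (fun z => t x + ∫ y in x..z, g y) (g x) x :=
      (intervalIntegral.integral_hasDerivAt_right hint.intervalIntegrable
        (hc.stronglyMeasurableAtFilter hg.isOpen_support x hx) hcx).const_add _
    exact h1.congr_of_eventuallyEq (Eventually.of_forall fun z => hdiff x z)
  have hcont : Continuous t := by
    have h1 : t = fun x => t 0 + ∫ y in (0 : ℝ)..x, g y := funext fun x => hdiff 0 x
    rw [h1]
    exact continuous_const.add (intervalIntegral.continuous_primitive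
      (fun _ _ => hint.intervalIntegrable) 0)
  have hmono : StrictMonoOn t (Function.support g) := by
    refine strictMonoOn_of_deriv_pos hg.convex hcont.continuousOn fun x hx => ?_
    rw [hg.isOpen_support.interior_eq] at hx
    rw [(hder x hx).deriv]
    exact hg.pos hx
  refine ⟨t, hder, hmono, Subset.antisymm ?_ ?_⟩
  · rintro _ ⟨x, hx, rfl⟩
    obtain ⟨a, b, ha, hb, hab⟩ := exists_Icc_subset_of_isOpen hg.isOpen_support hx
    constructor
    · refine lt_of_le_of_lt ?_ (hmono (hab ⟨le_rfl, by linarith⟩) hx ha)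
      rw [htc]
      exact ProbabilityTheory.cdf_nonneg μ a
    · refine lt_of_lt_of_le (hmono hx (hab ⟨by linarith, le_rfl⟩) hb) ?_
      rw [htc]
      exact ProbabilityTheory.cdf_le_one μ b
  · intro c hc01
    have h0 : ∃ x, t x ≤ c := by
      have := (ProbabilityTheory.tendsto_cdf_atBot μ).eventually (gt_mem_nhds hc01.1)
      obtain ⟨x, hx⟩ := this.exists
      exact ⟨x, by rw [htc]; exact le_of_lt hx⟩
    have h1 : ∃ x, c ≤ t x := by
      have := (ProbabilityTheory.tendsto_cdf_atTop μ).eventually (lt_mem_nhds hc01.2)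
      obtain ⟨x, hx⟩ := this.exists
      exact ⟨x, by rw [htc]; exact le_of_lt hx⟩
    obtain ⟨z, hz⟩ := mem_range_of_exists_le_of_exists_ge hcont h0 h1
    by_cases hzs : z ∈ Function.support g
    · exact ⟨z, hzs, hz⟩
    · exfalso
      by_cases hlt : ∃ y ∈ Function.support g, y < z
      · obtain ⟨y, hy, hyz⟩ := hlt
        have h2 : ∀ x ∉ Iic z, g x = 0 := fun x hx => by
          by_contra hx'
          exact hzs (hg.ordConnected_support.out hy hx' ⟨hyz.le, (not_le.1 hx).le⟩)
        have : t z = 1 := by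
          rw [ht]
          simp only
          rw [setIntegral_eq_integral_of_forall_compl_eq_zero h2, hg.integral_eq_one hc]
        exact hc01.2.ne (hz.symm.trans this)
      · push Not at hlt
        have : t z = 0 := by
          refine setIntegral_eq_zero_of_forall_eq_zero fun x hx => ?_
          by_contra hx'
          exact hzs ((le_antisymm hx (hlt x hx')) ▸ hx')
        exact hc01.1.ne' (hz.symm.trans this)

/-- The increasing map pushing the density `g` forward to the density `G`. -/
theorem exists_transport {g G : ℝ → ℝ} (hg : IsDensity g)
    (hc : ContinuousOn g (Function.support g)) (hG : IsDensity G)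
    (hGc : ContinuousOn G (Function.support G)) :
    ∃ y : ℝ → ℝ, StrictMonoOn y (Function.support g) ∧
      y '' Function.support g = Function.support G ∧
      ∀ x ∈ Function.support g, HasDerivAt y (g x / G (y x)) x := by
  obtain ⟨t, ht, htm, hti⟩ := cdf_spec hg hc
  obtain ⟨T, hT, hTm, hTi⟩ := cdf_spec hG hGc
  have hTc : ContinuousOn T (Function.support G) :=
    fun x hx => (hT x hx).continuousAt.continuousWithinAt
  have hmem : ∀ x ∈ Function.support g, t x ∈ T '' Function.support G := fun x hx => by
    rw [hTi, ← hti]; exact mem_image_of_mem t hx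
  refine ⟨fun x => Function.invFunOn T (Function.support G) (t x), ?_, ?_, ?_⟩
  · intro x hx z hz hxz
    exact strictMonoOn_invFunOn hTm (hmem x hx) (hmem z hz) (htm hx hz hxz)
  · rw [← image_image (Function.invFunOn T (Function.support G)) t, hti, ← hTi,
      invFunOn_image_eq hTm.injOn]
  · intro x hx
    obtain ⟨y, hy, hyx⟩ := hmem x hx
    have h1 := hasDerivAt_invFunOn hG.isOpen_support hTc hTm hy (hT y hy) (hG.pos hy).ne'
    rw [hyx] at h1
    have h2 := h1.comp x (ht x hx)
    have h3 : Function.invFunOn T (Function.support G) (t x) = y := by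
      rw [← hyx, hTm.injOn.leftInvOn_invFunOn hy]
    simp only [h3]
    exact h2.congr_deriv (div_eq_inv_mul _ _).symm

/-! ### The Stam inequality -/

theorem lintegral_mul_le_of_kernel {W Y D Z : ℝ → ℝ≥0∞} {S T : Set ℝ} {E : Set (ℝ × ℝ)}
    (hE : MeasurableSet E) (hS : MeasurableSet S) (hT : MeasurableSet T) (hY : Measurable Y)
    (hD : Measurable D)
    (h1 : ∀ x ∈ T, W x ≤ ∫⁻ a in S, E.indicator 1 (x, a) * D a)
    (h2 : ∀ a ∈ S, ∫⁻ x in T, E.indicator 1 (x, a) * Y x ≤ Z a) :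
    ∫⁻ x in T, W x * Y x ≤ ∫⁻ a in S, D a * Z a := by
  have hi : Measurable (E.indicator (1 : ℝ × ℝ → ℝ≥0∞)) := measurable_one.indicator hE
  calc ∫⁻ x in T, W x * Y x
      ≤ ∫⁻ x in T, ∫⁻ a in S, E.indicator 1 (x, a) * D a * Y x := by
        refine setLIntegral_mono' hT fun x hx => ?_
        have hm : Measurable fun a => E.indicator 1 (x, a) * D a := (hi.comp measurable_prodMk_left).mul hD
        rw [lintegral_mul_const _ hm]
        exact mul_le_mul_left (h1 x hx) _
    _ = ∫⁻ a in S, ∫⁻ x in T, E.indicator 1 (x, a) * D a * Y x := by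
        refine lintegral_lintegral_swap (Measurable.aemeasurable ?_)
        exact (hi.mul (hD.comp measurable_snd)).mul (hY.comp measurable_fst)
    _ ≤ ∫⁻ a in S, D a * Z a := by
        refine setLIntegral_mono' hS fun a ha => ?_
        refine le_trans (le_of_eq ?_) (mul_le_mul_right (h2 a ha) (D a))
        have hm : Measurable fun x => E.indicator 1 (x, a) * Y x := (hi.comp measurable_prodMk_right).mul hY
        rw [← lintegral_const_mul _ hm]
        refine lintegral_congr fun x => ?_
        ring

section stam

variable {g G y : ℝ → ℝ} {b : ℝ}

theorem lintegral_transport (hg : IsDensity g) (hG : IsDensity G)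
    (hym : StrictMonoOn y (Function.support g))
    (hyi : y '' Function.support g = Function.support G)
    (hyd : ∀ x ∈ Function.support g, HasDerivAt y (g x / G (y x)) x) (Φ : ℝ → ℝ≥0∞) :
    ∫⁻ z in Function.support G, Φ z * ENNReal.ofReal (G z)
      = ∫⁻ x in Function.support g, Φ (y x) * ENNReal.ofReal (g x) := by
  rw [← hyi, lintegral_image_eq_lintegral_abs_deriv_mul hg.isOpen_support.measurableSet
    (fun x hx => (hyd x hx).hasDerivWithinAt) hym.injOn]
  refine setLIntegral_congr_fun hg.isOpen_support.measurableSet fun x hx => ?_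
  have hGx : 0 < G (y x) := hG.pos (hyi ▸ mem_image_of_mem y hx)
  rw [abs_of_pos (div_pos (hg.pos hx) hGx), mul_left_comm,
    ← ENNReal.ofReal_mul (div_pos (hg.pos hx) hGx).le, div_mul_cancel₀ _ hGx.ne']

theorem lintegral_deriv_le_volume {T : Set ℝ} (hT : MeasurableSet T)
    (hym : MonotoneOn y T) (hyd : ∀ x ∈ T, DifferentiableAt ℝ y x) :
    ∫⁻ x in T, ENNReal.ofReal (deriv y x) = volume (y '' T) := by
  have := lintegral_image_eq_lintegral_deriv_mul_of_monotoneOn hT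
    (fun x hx => (hyd x hx).hasDerivAt.hasDerivWithinAt) hym 1
  simpa using this.symm

theorem lintegral_rpow_mul_deriv_le (hg : IsDensity g) (hac : LocallyAC g (Function.support g))
    (he : EndpointLimit g) (hb : b ≠ 0) (h0 : (0 : ℝ) ∈ y '' Function.support g)
    (hym : StrictMonoOn y (Function.support g))
    (hyd : ∀ x ∈ Function.support g, DifferentiableAt ℝ y x) :
    ∫⁻ x in Function.support g, ENNReal.ofReal (g x ^ b) * ENNReal.ofReal (deriv y x)
      ≤ ∫⁻ a in Function.support g,
        ENNReal.ofReal |deriv (fun t => g t ^ b) a| * ENNReal.ofReal |y a| := by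
  obtain ⟨m, hm, hm0⟩ := h0
  have hS := hg.isOpen_support.measurableSet
  have hDm : Measurable fun a => ENNReal.ofReal |deriv (fun t => g t ^ b) a| :=
    (measurable_deriv _).abs.ennreal_ofReal
  have hYm : Measurable fun a => ENNReal.ofReal (deriv y a) := (measurable_deriv _).ennreal_ofReal
  have hleft := lintegral_mul_le_of_kernel (W := fun x => ENNReal.ofReal (g x ^ b))
    (Z := fun a => ENNReal.ofReal (-y a)) (S := Function.support g)
    (T := Function.support g ∩ Iic m) (E := {z : ℝ × ℝ | z.2 < z.1})
    (measurableSet_lt measurable_snd measurable_fst) hS (hS.inter measurableSet_Iic) hYm hDm ?_ ?_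
  have hright := lintegral_mul_le_of_kernel (W := fun x => ENNReal.ofReal (g x ^ b))
    (Z := fun a => ENNReal.ofReal (y a)) (S := Function.support g)
    (T := Function.support g \ Iic m) (E := {z : ℝ × ℝ | z.1 < z.2})
    (measurableSet_lt measurable_fst measurable_snd) hS (hS.diff measurableSet_Iic) hYm hDm ?_ ?_
  · rw [← lintegral_inter_add_sdiff _ (Function.support g) (measurableSet_Iic (a := m))]
    refine (add_le_add hleft hright).trans_eq ?_
    rw [← lintegral_add_left']
    · refine setLIntegral_congr_fun hS fun a _ => ?_
      rw [← mul_add]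
      congr 1
      rcases le_total 0 (y a) with h | h
      · rw [abs_of_nonneg h, ENNReal.ofReal_of_nonpos (by linarith : -y a ≤ 0), zero_add]
      · rw [abs_of_nonpos h, ENNReal.ofReal_of_nonpos h, add_zero]
    · have hyc : ContinuousOn y (Function.support g) := fun x hx =>
        (hyd x hx).continuousAt.continuousWithinAt
      exact hDm.aemeasurable.mul (hyc.aemeasurable hS).neg.ennreal_ofReal
  · rintro x ⟨hx, -⟩
    refine (rpow_le_lintegral_right hg hac he hb hx).trans_eq ?_
    rw [inter_comm, ← setLIntegral_indicator measurableSet_Ioi]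
    refine lintegral_congr fun a => ?_
    by_cases h : x < a <;> simp [h]
  · intro a ha
    have h1 : ∫⁻ x in Function.support g \ Iic m,
        ({z : ℝ × ℝ | z.1 < z.2}.indicator 1 (x, a) : ℝ≥0∞) * ENNReal.ofReal (deriv y x)
        = ∫⁻ x in Iio a ∩ (Function.support g \ Iic m), ENNReal.ofReal (deriv y x) := by
      rw [← setLIntegral_indicator measurableSet_Iio]
      refine lintegral_congr fun x => ?_
      by_cases h : x < a <;> simp [h]
    rw [h1, lintegral_deriv_le_volume (measurableSet_Iio.inter (hS.diff measurableSet_Iic))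
      (hym.monotoneOn.mono fun x hx => hx.2.1) fun x hx => hyd x hx.2.1]
    have h2 : y '' (Iio a ∩ (Function.support g \ Iic m)) ⊆ Ico 0 (y a) := by
      rintro _ ⟨x, ⟨hax, hx, hxm⟩, rfl⟩
      exact ⟨hm0 ▸ hym.monotoneOn hm hx (not_le.1 hxm).le, hym hx ha hax⟩
    refine (measure_mono h2).trans_eq ?_
    rw [Real.volume_Ico, sub_zero]
  · rintro x ⟨hx, -⟩
    refine (rpow_le_lintegral_left hg hac he hb hx).trans_eq ?_
    rw [inter_comm, ← setLIntegral_indicator measurableSet_Iio]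
    refine lintegral_congr fun a => ?_
    by_cases h : a < x <;> simp [h]
  · intro a ha
    have h1 : ∫⁻ x in Function.support g ∩ Iic m,
        ({z : ℝ × ℝ | z.2 < z.1}.indicator 1 (x, a) : ℝ≥0∞) * ENNReal.ofReal (deriv y x)
        = ∫⁻ x in Ioi a ∩ (Function.support g ∩ Iic m), ENNReal.ofReal (deriv y x) := by
      rw [← setLIntegral_indicator measurableSet_Ioi]
      refine lintegral_congr fun x => ?_
      by_cases h : a < x <;> simp [h]
    rw [h1, lintegral_deriv_le_volume (measurableSet_Ioi.inter (hS.inter measurableSet_Iic))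
      (hym.monotoneOn.mono fun x hx => hx.2.1) fun x hx => hyd x hx.2.1]
    have h2 : y '' (Ioi a ∩ (Function.support g ∩ Iic m)) ⊆ Ioc (y a) 0 := by
      rintro _ ⟨x, ⟨hax, hx, hxm⟩, rfl⟩
      exact ⟨hym ha hx hax, hm0 ▸ hym.monotoneOn hx hm hxm⟩
    refine (measure_mono h2).trans_eq ?_
    rw [Real.volume_Ioc, zero_sub]

theorem lintegral_deriv_rpow_mul_le (hg : IsDensity g) (hac : LocallyAC g (Function.support g))
    (hyc : ContinuousOn y (Function.support g)) (b : ℝ) {p : ℝ} (hp : 1 < p) :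
    ∫⁻ a in Function.support g,
        ENNReal.ofReal |deriv (fun t => g t ^ b) a| * ENNReal.ofReal |y a|
      ≤ ENNReal.ofReal |b| * (fisher p b g ^ (1 / p) *
        (∫⁻ x in Function.support g,
          ENNReal.ofReal |y x| ^ (p / (p - 1)) * ENNReal.ofReal (g x)) ^ ((p - 1) / p)) := by
  have hS := hg.isOpen_support.measurableSet
  have hgc := hac.continuousOn hg.isOpen_support
  have hgm := hgc.aemeasurable (μ := volume) hS
  have hp0 : 0 < p := by linarith
  have hp1 : 0 < p - 1 := by linarith
  have hD := ae_deriv_rpow hg (hac.ae_differentiableAt hg.isOpen_support) b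
  have h1 : ∫⁻ a in Function.support g,
        ENNReal.ofReal |deriv (fun t => g t ^ b) a| * ENNReal.ofReal |y a|
      = ENNReal.ofReal |b| * ∫⁻ a in Function.support g,
        (ENNReal.ofReal |g a ^ (b - 2) * deriv g a| ^ p * ENNReal.ofReal (g a)) ^ (1 / p) *
        (ENNReal.ofReal |y a| ^ (p / (p - 1)) * ENNReal.ofReal (g a)) ^ ((p - 1) / p) := by
    rw [← lintegral_const_mul' _ _ ENNReal.ofReal_ne_top]
    refine setLIntegral_congr_fun_ae hS ?_
    filter_upwards [hD] with x hx hxs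
    rw [hx hxs, mul_assoc]
    congr 1
    rw [ENNReal.mul_rpow_of_nonneg _ _ (by positivity), ENNReal.mul_rpow_of_nonneg _ _
      (by positivity), ← ENNReal.rpow_mul, ← ENNReal.rpow_mul, mul_one_div_cancel hp0.ne',
      div_mul_div_comm, mul_comm p (p - 1), div_self (by positivity), ENNReal.rpow_one,
      ENNReal.rpow_one, mul_mul_mul_comm, ← ENNReal.rpow_add_of_nonneg _ _ (by positivity)
      (by positivity)]
    have : 1 / p + (p - 1) / p = 1 := by field_simp; ring
    rw [this, ENNReal.rpow_one]
    ring
  rw [h1, fisher]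
  refine mul_le_mul_right (ENNReal.lintegral_mul_norm_pow_le ?_ ?_ (by positivity) (by positivity)
    (by field_simp; ring)) _
  · exact ((((hgm.pow_const _).mul (measurable_deriv g).aemeasurable).abs.ennreal_ofReal).pow_const
      _).mul hgm.ennreal_ofReal
  · exact ((hyc.aemeasurable hS).abs.ennreal_ofReal.pow_const _).mul hgm.ennreal_ofReal

end stam

/-! ### The Stam quotient -/

theorem ennreal_rpow_le_rpow_of_nonpos {x y : ℝ≥0∞} {z : ℝ} (hz : z ≤ 0) (h : x ≤ y) :
    y ^ z ≤ x ^ z := by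
  rw [← neg_neg z, ENNReal.rpow_neg, ENNReal.rpow_neg x, ENNReal.inv_le_inv]
  exact ENNReal.rpow_le_rpow h (by linarith)


/-- `∫_Ω g^c`. -/
def powInt (c : ℝ) (g : ℝ → ℝ) : ℝ≥0∞ := ∫⁻ x in Function.support g, ENNReal.ofReal (g x ^ c)

/-- `(∫_Ω g^{1-s})^{b/s} F_{p,b}[g]^{1/p}`. -/
def stamQuot (p b s : ℝ) (g : ℝ → ℝ) : ℝ≥0∞ :=
  powInt (1 - s) g ^ (b / s) * fisher p b g ^ (1 / p)

/-- The product `x * y` is not of the form `0 * ∞`. -/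
def NotZeroTop (x y : ℝ≥0∞) : Prop := ¬ (x = 0 ∧ y = ∞) ∧ ¬ (x = ∞ ∧ y = 0)

theorem NotZeroTop.mul_rpow {x y : ℝ≥0∞} (h : NotZeroTop x y) (c : ℝ) :
    (x * y) ^ c = x ^ c * y ^ c := by
  rw [ENNReal.mul_rpow_eq_ite, if_neg]
  rintro ⟨h1 | h1, -⟩
  · exact h.1 h1
  · exact h.2 h1

theorem NotZeroTop.rpow {x y : ℝ≥0∞} (h : NotZeroTop x y) (c : ℝ) :
    NotZeroTop (x ^ c) (y ^ c) := by
  obtain ⟨h1, h2⟩ := h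
  constructor <;> rintro ⟨h3, h4⟩ <;>
    rw [ENNReal.rpow_eq_zero_iff, ENNReal.rpow_eq_top_iff] at * <;> grind

theorem stamProduct_eq {p q s : ℝ} (hp : p ≠ 0) (hpq : p ≠ q) {g : ℝ → ℝ}
    (h : NotZeroTop (renyiPower (1 - s) g) (fisher p ((p - q) / p) g ^ (1 / (p - q)))) :
    stamProduct p q s g = stamQuot p ((p - q) / p) s g ^ (theta2 s p q / ((p - q) / p)) ∧
    NotZeroTop (powInt (1 - s) g ^ (((p - q) / p) / s))
      (fisher p ((p - q) / p) g ^ (1 / p)) := by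
  have hpq' : p - q ≠ 0 := sub_ne_zero.2 hpq
  set b := (p - q) / p with hb
  have hb0 : b ≠ 0 := div_ne_zero hpq' hp
  have e1 : powInt (1 - s) g ^ (b / s) = renyiPower (1 - s) g ^ b := by
    rw [renyiPower, powInt, ← ENNReal.rpow_mul, sub_sub_cancel]
    congr 1
    ring
  have e2 : fisher p b g ^ (1 / p) = (fisher p b g ^ (1 / (p - q))) ^ b := by
    rw [← ENNReal.rpow_mul]
    congr 1
    rw [hb]
    field_simp
  refine ⟨?_, ?_⟩
  · rw [stamQuot, e1, e2, ← h.mul_rpow, ← ENNReal.rpow_mul, mul_div_cancel₀ _ hb0, stamProduct]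
  · rw [e1, e2]
    exact h.rpow b

theorem powInt_pos {c : ℝ} {g : ℝ → ℝ} (hg : IsDensity g)
    (hc : ContinuousOn g (Function.support g)) : powInt c g ≠ 0 := by
  intro h0
  have hS := hg.isOpen_support.measurableSet
  rw [powInt, lintegral_eq_zero_iff'
    ((hc.aemeasurable hS).pow_const c).ennreal_ofReal, EventuallyEq, ae_restrict_iff' hS] at h0
  have h1 : volume (Function.support g) = 0 := by
    refine measure_mono_null ?_ h0
    intro x hx h2
    have h3 := h2 hx
    simp only [Pi.zero_apply, ENNReal.ofReal_eq_zero] at h3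
    exact absurd h3 (not_le.2 (Real.rpow_pos_of_pos (hg.pos hx) _))
  exact (hg.isOpen_support.measure_pos volume hg.nonempty).ne' h1

/-! ### The Stam inequality for `p > 1` -/

theorem powInt_transport {g G y : ℝ → ℝ} {μ : ℝ} (hg : IsDensity g) (hG : IsDensity G)
    (hym : StrictMonoOn y (Function.support g))
    (hyi : y '' Function.support g = Function.support G)
    (hyd : ∀ x ∈ Function.support g, HasDerivAt y (g x / G (y x)) x) :
    powInt μ G = ∫⁻ x in Function.support g,
      ENNReal.ofReal (G (y x) ^ (μ - 1)) * ENNReal.ofReal (g x) := by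
  rw [← lintegral_transport hg hG hym hyi hyd (fun z => ENNReal.ofReal (G z ^ (μ - 1))), powInt]
  refine setLIntegral_congr_fun hG.isOpen_support.measurableSet fun z hz => ?_
  have hp := hG.pos hz
  rw [← ENNReal.ofReal_mul (Real.rpow_nonneg hp.le _)]
  congr 1
  nth_rw 3 [← Real.rpow_one (G z)]
  rw [← Real.rpow_add hp]
  ring_nf

theorem powInt_rpow_le_of_transport {g G y : ℝ → ℝ} {b s : ℝ} (hb : b ≠ 0) (hs : s ≠ 0)
    (hθ : 0 < b * (b + s)) (hg : IsDensity g) (hgc : ContinuousOn g (Function.support g))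
    (hG : IsDensity G) (hGc : ContinuousOn G (Function.support G))
    (hym : StrictMonoOn y (Function.support g))
    (hyi : y '' Function.support g = Function.support G)
    (hyd : ∀ x ∈ Function.support g, HasDerivAt y (g x / G (y x)) x)
    (hQ : powInt (b / (b + s)) G ≠ ∞) {J : ℝ≥0∞}
    (hJ : J = ∫⁻ x in Function.support g, ENNReal.ofReal (g x ^ b) * ENNReal.ofReal (deriv y x))
    (hA : b / s < 0 → powInt (1 - s) g = ∞ → J = ∞ → False) :
    powInt (b / (b + s)) G ^ ((b + s) / s) ≤ J * powInt (1 - s) g ^ (b / s) := by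
  have hS := hg.isOpen_support.measurableSet
  have hθ0 : b + s ≠ 0 := fun h => by simp [h] at hθ
  have hyc : ContinuousOn y (Function.support g) :=
    fun x hx => (hyd x hx).continuousAt.continuousWithinAt
  have hGy : ContinuousOn (fun x => G (y x)) (Function.support g) :=
    hGc.comp hyc (fun x hx => hyi ▸ mem_image_of_mem y hx)
  have hgm := hgc.aemeasurable (μ := volume) hS
  have hm1 : AEMeasurable (fun x => ENNReal.ofReal (g x ^ b) * ENNReal.ofReal (deriv y x))
      (volume.restrict (Function.support g)) :=
    (hgm.pow_const b).ennreal_ofReal.mul (measurable_deriv y).ennreal_ofReal.aemeasurable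
  have hpos : ∀ x ∈ Function.support g, 0 < g x ∧ 0 < G (y x) ∧ deriv y x = g x / G (y x) :=
    fun x hx => ⟨hg.pos hx, hG.pos (hyi ▸ mem_image_of_mem y hx), (hyd x hx).deriv⟩
  have hQt := powInt_transport (μ := b / (b + s)) hg hG hym hyi hyd
  have hbθ : 0 < b / (b + s) := by
    rw [← mul_div_mul_right b (b + s) hθ0]
    exact div_pos hθ (mul_self_pos.2 hθ0)
  have hsum : s / (b + s) + b / (b + s) = 1 := by field_simp; ring
  rcases lt_or_gt_of_ne (div_ne_zero hb hs) with hbs | hbs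
  · have hsb : s / b < 0 := by rw [← inv_div]; exact inv_lt_zero.2 hbs
    have h1 : powInt (1 - s) g ≤ J ^ (-(s / b)) * powInt (b / (b + s)) G ^ (1 + s / b) := by
      rw [hJ, hQt]
      refine le_trans (le_of_eq ?_) (ENNReal.lintegral_mul_norm_pow_le hm1 ?_ (by linarith) ?_
        (by ring))
      · refine setLIntegral_congr_fun hS fun x hx => ?_
        obtain ⟨h1, h2, h3⟩ := hpos x hx
        obtain ⟨u, hu⟩ : ∃ u, Real.exp u = g x := ⟨_, Real.exp_log h1⟩
        obtain ⟨v, hv⟩ : ∃ v, Real.exp v = G (y x) := ⟨_, Real.exp_log h2⟩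
        rw [h3, ← hu, ← hv]
        simp only [← Real.exp_mul, ← Real.exp_sub, ← Real.exp_add,
          ENNReal.ofReal_rpow_of_pos (Real.exp_pos _), ← ENNReal.ofReal_mul (Real.exp_pos _).le]
        congr 2
        field_simp
        ring
      · exact ((hGy.aemeasurable hS).pow_const _).ennreal_ofReal.mul hgm.ennreal_ofReal
      · have : 1 + s / b = (b / (b + s))⁻¹ := by field_simp
        rw [this]; positivity
    have hQ0 := powInt_pos (c := b / (b + s)) hG hGc
    have hA0 := powInt_pos (c := 1 - s) hg hgc
    set Q := powInt (b / (b + s)) G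
    set A := powInt (1 - s) g
    have hAt : A ≠ ∞ := by
      intro h
      refine hA hbs h ?_
      by_contra hJt
      rw [h, top_le_iff] at h1
      refine ENNReal.mul_ne_top ?_ (ENNReal.rpow_ne_top_of_ne_zero hQ0 hQ) h1
      exact ENNReal.rpow_ne_top_of_nonneg (by linarith) hJt
    have h2 := ENNReal.rpow_le_rpow h1 (z := -(b / s)) (by linarith)
    rw [ENNReal.mul_rpow_of_nonneg _ _ (by linarith), ← ENNReal.rpow_mul, ← ENNReal.rpow_mul] at h2
    have e1 : -(s / b) * -(b / s) = 1 := by field_simp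
    have e2 : (1 + s / b) * -(b / s) = -((b + s) / s) := by field_simp
    rw [e1, e2, ENNReal.rpow_one] at h2
    calc Q ^ ((b + s) / s) = A ^ (-(b / s)) * (A ^ (b / s) * Q ^ ((b + s) / s)) := by
          rw [← mul_assoc, ← ENNReal.rpow_add _ _ hA0 hAt, neg_add_cancel, ENNReal.rpow_zero,
            one_mul]
      _ ≤ J * Q ^ (-((b + s) / s)) * (A ^ (b / s) * Q ^ ((b + s) / s)) := mul_le_mul_left h2 _
      _ = J * A ^ (b / s) * (Q ^ (-((b + s) / s)) * Q ^ ((b + s) / s)) := by ring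
      _ = J * A ^ (b / s) := by
          rw [← ENNReal.rpow_add _ _ hQ0 hQ, neg_add_cancel, ENNReal.rpow_zero, mul_one]
  · have hsθ : 0 < s / (b + s) := by
      have : s / (b + s) = (b / (b + s)) / (b / s) := by field_simp
      rw [this]; positivity
    have h1 : powInt (b / (b + s)) G ≤ J ^ (s / (b + s)) * powInt (1 - s) g ^ (b / (b + s)) := by
      rw [hJ, hQt, powInt]
      refine le_trans (le_of_eq ?_) (ENNReal.lintegral_mul_norm_pow_le hm1 ?_ hsθ.le hbθ.le hsum)
      · refine setLIntegral_congr_fun hS fun x hx => ?_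
        obtain ⟨h1, h2, h3⟩ := hpos x hx
        obtain ⟨u, hu⟩ : ∃ u, Real.exp u = g x := ⟨_, Real.exp_log h1⟩
        obtain ⟨v, hv⟩ : ∃ v, Real.exp v = G (y x) := ⟨_, Real.exp_log h2⟩
        rw [h3, ← hu, ← hv]
        simp only [← Real.exp_mul, ← Real.exp_sub, ← Real.exp_add,
          ENNReal.ofReal_rpow_of_pos (Real.exp_pos _), ← ENNReal.ofReal_mul (Real.exp_pos _).le]
        congr 2
        field_simp
        ring
      · exact (hgm.pow_const _).ennreal_ofReal
    have hθs : 0 ≤ (b + s) / s := by rw [← inv_div]; positivity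
    have h2 := ENNReal.rpow_le_rpow h1 hθs
    rw [ENNReal.mul_rpow_of_nonneg _ _ hθs, ← ENNReal.rpow_mul, ← ENNReal.rpow_mul] at h2
    have e1 : s / (b + s) * ((b + s) / s) = 1 := by field_simp
    have e2 : b / (b + s) * ((b + s) / s) = b / s := by field_simp
    rwa [e1, e2, ENNReal.rpow_one] at h2

theorem stam_inequality_of_one_lt {g G : ℝ → ℝ} {p b s : ℝ} (hp : 1 < p) (hb : b ≠ 0) (hs : s ≠ 0)
    (hθ : 0 < b * (b + s)) (hg : IsDensity g) (hac : LocallyAC g (Function.support g))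
    (he : EndpointLimit g) (hG : IsDensity G) (hGc : ContinuousOn G (Function.support G))
    (hG0 : (0 : ℝ) ∈ Function.support G) (hQ : powInt (b / (b + s)) G ≠ ∞)
    (hM : ∫⁻ z in Function.support G, ENNReal.ofReal |z| ^ (p / (p - 1)) * ENNReal.ofReal (G z) ≠ ∞)
    (hnz : NotZeroTop (powInt (1 - s) g ^ (b / s)) (fisher p b g ^ (1 / p))) :
    powInt (b / (b + s)) G ^ ((b + s) / s) ≤ ENNReal.ofReal |b| *
      (∫⁻ z in Function.support G, ENNReal.ofReal |z| ^ (p / (p - 1)) * ENNReal.ofReal (G z))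
        ^ ((p - 1) / p) * stamQuot p b s g := by
  have hgc := hac.continuousOn hg.isOpen_support
  obtain ⟨y, hym, hyi, hyd⟩ := exists_transport hg hgc hG hGc
  have hyc : ContinuousOn y (Function.support g) :=
    fun x hx => (hyd x hx).continuousAt.continuousWithinAt
  have h1 := (lintegral_rpow_mul_deriv_le hg hac he hb (hyi ▸ hG0) hym
    fun x hx => (hyd x hx).differentiableAt).trans (lintegral_deriv_rpow_mul_le hg hac hyc b hp)
  rw [← lintegral_transport hg hG hym hyi hyd (fun z => ENNReal.ofReal |z| ^ (p / (p - 1)))] at h1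
  set J := ∫⁻ x in Function.support g, ENNReal.ofReal (g x ^ b) * ENNReal.ofReal (deriv y x) with hJ
  set M := ∫⁻ z in Function.support G, ENNReal.ofReal |z| ^ (p / (p - 1)) * ENNReal.ofReal (G z)
  have hp0 : 0 < (p - 1) / p := div_pos (by linarith) (by linarith)
  have h2 := powInt_rpow_le_of_transport hb hs hθ hg hgc hG hGc hym hyi hyd hQ hJ ?_
  · refine h2.trans ((mul_le_mul_left h1 _).trans_eq ?_)
    rw [stamQuot]
    ring
  · intro hbs hA hJt
    rw [hJt, top_le_iff] at h1
    refine hnz.1 ⟨by rw [hA, ENNReal.top_rpow_of_neg hbs], ?_⟩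
    by_contra hF
    exact ENNReal.mul_ne_top ENNReal.ofReal_ne_top (ENNReal.mul_ne_top hF
      (ENNReal.rpow_ne_top_of_nonneg hp0.le hM)) h1

/-! ### The Stam inequality for `p = 1` -/

theorem stam_inequality_one {g : ℝ → ℝ} {b s : ℝ} (hb : b ≠ 0) (hs : s ≠ 0)
    (hg : IsDensity g) (hac : LocallyAC g (Function.support g))
    (he : EndpointLimit g) (hnz : NotZeroTop (powInt (1 - s) g ^ (b / s)) (fisher 1 b g ^ (1 / 1 : ℝ))) :
    ENNReal.ofReal (2 / |b|) ≤ stamQuot 1 b s g := by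
  have hS := hg.isOpen_support.measurableSet
  have hgc := hac.continuousOn hg.isOpen_support
  have hgm := hgc.aemeasurable (μ := volume) hS
  have hD := ae_deriv_rpow hg (hac.ae_differentiableAt hg.isOpen_support) b
  have hb' : 0 < |b| := abs_pos.2 hb
  set F := fisher 1 b g with hF
  have h1 : ∫⁻ a in Function.support g, ENNReal.ofReal |deriv (fun t => g t ^ b) a|
      = ENNReal.ofReal |b| * F := by
    rw [hF, fisher, ← lintegral_const_mul' _ _ ENNReal.ofReal_ne_top]
    refine setLIntegral_congr_fun_ae hS ?_
    filter_upwards [hD] with x hx hxs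
    rw [hx hxs, ENNReal.rpow_one]
  have h2 : ∀ x ∈ Function.support g,
      ENNReal.ofReal (g x ^ b) ≤ ENNReal.ofReal (|b| / 2) * F := by
    intro x hx
    have h3 : ENNReal.ofReal (g x ^ b) + ENNReal.ofReal (g x ^ b) ≤ ENNReal.ofReal |b| * F := by
      refine (add_le_add (rpow_le_lintegral_left hg hac he hb hx)
        (rpow_le_lintegral_right hg hac he hb hx)).trans ?_
      rw [← h1, ← lintegral_union (hS.inter measurableSet_Ioi)]
      · exact lintegral_mono_set (union_subset inter_subset_left inter_subset_left)
      · exact disjoint_left.2 fun z hz hz' => lt_asymm (mem_Iio.1 hz.2) (mem_Ioi.1 hz'.2)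
    have h4 : ENNReal.ofReal |b| = 2 * ENNReal.ofReal (|b| / 2) := by
      rw [← ENNReal.ofReal_ofNat, ← ENNReal.ofReal_mul (by norm_num)]
      congr 1
      ring
    rw [← two_mul, h4, mul_assoc] at h3
    exact (ENNReal.mul_le_mul_iff_right (by norm_num) (by norm_num)).1 h3
  rw [stamQuot, div_one, ENNReal.rpow_one]
  set K := ENNReal.ofReal (|b| / 2) * F with hK
  have hK0 : K ≠ 0 := by
    obtain ⟨x, hx⟩ := hg.nonempty
    exact ((ENNReal.ofReal_pos.2 (Real.rpow_pos_of_pos (hg.pos hx) b)).trans_le (h2 x hx)).ne'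
  have hA0 := powInt_pos (c := 1 - s) hg hgc
  have hint : ∫⁻ x in Function.support g, K ^ (-(s / b)) * ENNReal.ofReal (g x)
      = K ^ (-(s / b)) := by
    rw [lintegral_const_mul'' _ hgm.ennreal_ofReal, setLIntegral_support_ofReal,
      hg.lintegral_eq_one, mul_one]
  have hA : powInt (1 - s) g = ∫⁻ x in Function.support g,
      ENNReal.ofReal (g x ^ b) ^ (-(s / b)) * ENNReal.ofReal (g x) := by
    refine setLIntegral_congr_fun hS fun x hx => ?_
    have hx0 := hg.pos hx
    rw [ENNReal.ofReal_rpow_of_pos (Real.rpow_pos_of_pos hx0 _), ← Real.rpow_mul hx0.le,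
      ← ENNReal.ofReal_mul (Real.rpow_nonneg hx0.le _)]
    congr 1
    nth_rw 3 [← Real.rpow_one (g x)]
    rw [← Real.rpow_add hx0]
    congr 1
    field_simp
    ring
  have hKexp : (K ^ (-(s / b))) ^ (b / s) = K⁻¹ := by
    rw [← ENNReal.rpow_mul, ← ENNReal.rpow_neg_one]
    congr 1
    field_simp
  have h5 : K⁻¹ ≤ powInt (1 - s) g ^ (b / s) ∧
      (K = ∞ → powInt (1 - s) g ^ (b / s) ≠ 0) := by
    rw [← hKexp]
    rcases lt_or_gt_of_ne (div_ne_zero hs hb) with h | h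
    · have hbs : b / s < 0 := by rw [← inv_div]; exact inv_lt_zero.2 h
      refine ⟨ennreal_rpow_le_rpow_of_nonpos hbs.le ?_, fun hKt h0 => ?_⟩
      · rw [← hint, hA]
        refine setLIntegral_mono' hS fun x hx => mul_le_mul_left
          (ENNReal.rpow_le_rpow (h2 x hx) (by linarith)) _
      · refine hnz.1 ⟨h0, ?_⟩
        rw [div_one, ENNReal.rpow_one]
        by_contra hFt
        exact ENNReal.mul_ne_top ENNReal.ofReal_ne_top hFt hKt
    · have hbs : 0 < b / s := by rw [← inv_div]; exact inv_pos.2 h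
      refine ⟨ENNReal.rpow_le_rpow ?_ hbs.le, fun _ => ?_⟩
      · rw [← hint, hA]
        refine setLIntegral_mono' hS fun x hx => mul_le_mul_left
          (ennreal_rpow_le_rpow_of_nonpos (by linarith) (h2 x hx)) _
      · rw [Ne, ENNReal.rpow_eq_zero_iff]
        rintro (h' | h')
        · exact hA0 h'.1
        · exact absurd h'.2 (not_lt.2 hbs.le)
  have h6 : 1 ≤ K * powInt (1 - s) g ^ (b / s) := by
    by_cases hKt : K = ∞
    · rw [hKt, ENNReal.top_mul (h5.2 hKt)]
      exact le_top
    · rw [← ENNReal.mul_inv_cancel hK0 hKt]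
      exact mul_le_mul_right h5.1 K
  calc ENNReal.ofReal (2 / |b|) ≤ ENNReal.ofReal (2 / |b|) * (K * powInt (1 - s) g ^ (b / s)) :=
        le_mul_of_one_le_right zero_le h6
    _ = ENNReal.ofReal (2 / |b|) * ENNReal.ofReal (|b| / 2) * (powInt (1 - s) g ^ (b / s) * F) := by
        rw [hK]; ring
    _ = powInt (1 - s) g ^ (b / s) * F := by
        rw [← ENNReal.ofReal_mul (by positivity)]
        have : 2 / |b| * (|b| / 2) = 1 := by field_simp
        rw [this, ENNReal.ofReal_one, one_mul]

/-! ### The Stam inequality for `p < 1` -/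

theorem strictAntiOn_of_ae_deriv_neg {g : ℝ → ℝ} {S : Set ℝ} (hS : S.OrdConnected)
    (hac : LocallyAC g S) (hneg : ∀ᵐ x, x ∈ S → deriv g x < 0) : StrictAntiOn g S := by
  intro x hx z hz hxz
  have hsub : Icc x z ⊆ S := hS.out hx hz
  have h := hac x z hxz.le hsub
  have hpos : 0 < ∫ t in x..z, (-deriv g) t := by
    rw [intervalIntegral.integral_pos_iff_support_of_nonneg_ae' _ h.intervalIntegrable_deriv.neg]
    · refine ⟨hxz, ?_⟩
      have h1 : (Function.support (-deriv g) ∩ Ioc x z : Set ℝ) =ᵐ[volume] Ioc x z := by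
        filter_upwards [hneg] with t ht
        refine propext ⟨fun h => h.2, fun h => ⟨?_, h⟩⟩
        have := ht (hsub ⟨h.1.le, h.2⟩)
        simp only [Function.mem_support, Pi.neg_apply]
        linarith
      rw [measure_congr h1, Real.volume_Ioc]
      simpa using hxz
    · rw [EventuallyLE, ae_restrict_iff' measurableSet_uIoc]
      filter_upwards [hneg] with t ht h
      rw [uIoc_of_le hxz.le] at h
      have := ht (hsub ⟨h.1.le, h.2⟩)
      simp only [Pi.zero_apply, Pi.neg_apply]
      linarith
  simp only [Pi.neg_apply] at hpos
  rw [intervalIntegral.integral_neg, h.integral_deriv_eq_sub] at hpos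
  linarith

section mirrored

variable {g : ℝ → ℝ} {b p s : ℝ}

theorem lintegral_antitone_change_le (hg : IsDensity g) (hac : LocallyAC g (Function.support g))
    (hneg : ∀ᵐ x, x ∈ Function.support g → deriv g x < 0) (hb : b ≠ 0) {K : ℝ} (hK : 0 < K)
    (Φ : ℝ → ℝ≥0∞) :
    ∫⁻ x in Function.support g, ENNReal.ofReal |g x ^ (b - 2) * deriv g x| * ENNReal.ofReal (g x)
        * Φ (g x ^ b / K)
      ≤ ENNReal.ofReal (K / |b|) * ∫⁻ z in Ioi (0 : ℝ), Φ z := by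
  have hS := hg.isOpen_support.measurableSet
  have hb' : 0 < |b| := abs_pos.2 hb
  have hdiff := hac.ae_differentiableAt hg.isOpen_support
  set S' := Function.support g ∩ {x | DifferentiableAt ℝ g x} with hS'
  have hS'm : MeasurableSet S' := hS.inter (measurableSet_of_differentiableAt ℝ g)
  have hae : (S' : Set ℝ) =ᵐ[volume] Function.support g := by
    filter_upwards [hdiff] with x hx
    exact propext ⟨fun h => h.1, fun h => ⟨h, hx h⟩⟩
  have hinj : InjOn (fun x => g x ^ b / K) S' := by
    intro x hx z hz hxz
    have h1 : g x ^ b = g z ^ b := by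
      have := congrArg (· * K) hxz
      simpa [hK.ne'] using this
    have h2 := (Real.rpow_left_injOn hb) (hg.nonneg x) (hg.nonneg z) h1
    exact (strictAntiOn_of_ae_deriv_neg hg.ordConnected_support hac hneg).injOn hx.1 hz.1 h2
  have hder : ∀ x ∈ S', HasDerivWithinAt (fun x => g x ^ b / K)
      (deriv (fun t => g t ^ b) x / K) S' x := fun x hx =>
    (((hx.2.hasDerivAt.rpow_const (p := b) (Or.inl (hg.pos hx.1).ne')).differentiableAt.hasDerivAt
      ).div_const K).hasDerivWithinAt
  have h1 := lintegral_image_eq_lintegral_abs_deriv_mul hS'm hder hinj Φ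
  have h2 : (fun x => g x ^ b / K) '' S' ⊆ Ioi 0 := by
    rintro _ ⟨x, hx, rfl⟩
    exact div_pos (Real.rpow_pos_of_pos (hg.pos hx.1) _) hK
  have h3 := (h1.symm.le.trans (lintegral_mono_set h2))
  refine le_trans (le_of_eq ?_) (mul_le_mul_right h3 (ENNReal.ofReal (K / |b|)))
  rw [← lintegral_const_mul' _ _ ENNReal.ofReal_ne_top, setLIntegral_congr hae]
  refine setLIntegral_congr_fun_ae hS ?_
  filter_upwards [ae_deriv_rpow hg hdiff b] with x hx hxs
  rw [abs_div, abs_of_pos hK, ENNReal.ofReal_div_of_pos hK, hx hxs,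
    ENNReal.ofReal_div_of_pos hb']
  have hK1 : ENNReal.ofReal K ≠ 0 := (ENNReal.ofReal_pos.2 hK).ne'
  have hb1 : ENNReal.ofReal |b| ≠ 0 := (ENNReal.ofReal_pos.2 hb').ne'
  simp only [div_eq_mul_inv]
  calc _ = (ENNReal.ofReal K * (ENNReal.ofReal K)⁻¹) * (ENNReal.ofReal |b| * (ENNReal.ofReal |b|)⁻¹)
        * (ENNReal.ofReal |g x ^ (b - 2) * deriv g x| * ENNReal.ofReal (g x) * Φ (g x ^ b * K⁻¹)) := by
        rw [ENNReal.mul_inv_cancel hK1 ENNReal.ofReal_ne_top,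
          ENNReal.mul_inv_cancel hb1 ENNReal.ofReal_ne_top, one_mul, one_mul]
    _ = _ := by ring

theorem fisher_le_of_mirrored (hp0 : 0 < p) (hp1 : p < 1) (hb : b ≠ 0) (hg : IsDensity g)
    (hac : LocallyAC g (Function.support g))
    (hneg : ∀ᵐ x, x ∈ Function.support g → deriv g x < 0) {K : ℝ} (hK : 0 < K) {B : ℝ → ℝ}
    (hB : ∀ z, 0 < z → 0 < B z) (hBm : Measurable B) :
    fisher p b g ≤ (ENNReal.ofReal (K / |b|) *
        ∫⁻ z in Ioi (0 : ℝ), ENNReal.ofReal (B z ^ ((1 - p) / (-p)))) ^ p *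
      (∫⁻ x in Function.support g, ENNReal.ofReal (g x) * ENNReal.ofReal (B (g x ^ b / K)))
        ^ (1 - p) := by
  have hS := hg.isOpen_support.measurableSet
  have hgm := (hac.continuousOn hg.isOpen_support).aemeasurable (μ := volume) hS
  have hwm := (hgm.pow_const b).div_const K
  refine le_trans ?_ (mul_le_mul_left (ENNReal.rpow_le_rpow
    (lintegral_antitone_change_le hg hac hneg hb hK
      (fun z => ENNReal.ofReal (B z ^ ((1 - p) / (-p))))) hp0.le) _)
  refine le_trans (le_of_eq ?_) (ENNReal.lintegral_mul_norm_pow_le ?_ ?_ hp0.le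
    (by linarith : 0 ≤ 1 - p) (by ring))
  · rw [fisher]
    refine setLIntegral_congr_fun hS fun x hx => ?_
    have hg0 := hg.pos hx
    have hB0 := hB _ (div_pos (Real.rpow_pos_of_pos hg0 b) hK)
    obtain ⟨u, hu⟩ : ∃ u, Real.exp u = g x := ⟨_, Real.exp_log hg0⟩
    obtain ⟨v, hv⟩ : ∃ v, Real.exp v = B (g x ^ b / K) := ⟨_, Real.exp_log hB0⟩
    rw [← hv, ENNReal.mul_rpow_of_nonneg _ _ hp0.le, ENNReal.mul_rpow_of_nonneg _ _ hp0.le, mul_assoc,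
      mul_assoc]
    congr 1
    rw [← hu]
    simp only [← Real.exp_mul, ← Real.exp_add,
      ENNReal.ofReal_rpow_of_pos (Real.exp_pos _), ← ENNReal.ofReal_mul (Real.exp_pos _).le]
    congr 2
    field_simp
    ring
  · exact ((((hgm.pow_const _).mul (measurable_deriv g).aemeasurable).abs.ennreal_ofReal).mul
      hgm.ennreal_ofReal).mul ((hBm.comp_aemeasurable hwm).pow_const _).ennreal_ofReal
  · exact hgm.ennreal_ofReal.mul (hBm.comp_aemeasurable hwm).ennreal_ofReal

theorem le_fisher_of_mirrored (hp0 : p < 0) (hb : b ≠ 0) (hg : IsDensity g)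
    (hac : LocallyAC g (Function.support g))
    (hneg : ∀ᵐ x, x ∈ Function.support g → deriv g x < 0) {K : ℝ} (hK : 0 < K) {B : ℝ → ℝ}
    (hB : ∀ z, 0 < z → 0 ≤ B z) (hBm : Measurable B) :
    ∫⁻ x in Function.support g, ENNReal.ofReal (g x) * ENNReal.ofReal (B (g x ^ b / K))
      ≤ fisher p b g ^ (1 / (1 - p)) * (ENNReal.ofReal (K / |b|) *
        ∫⁻ z in Ioi (0 : ℝ), ENNReal.ofReal (B z ^ ((1 - p) / (-p)))) ^ ((-p) / (1 - p)) := by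
  have hS := hg.isOpen_support.measurableSet
  have hgm := (hac.continuousOn hg.isOpen_support).aemeasurable (μ := volume) hS
  have hwm := (hgm.pow_const b).div_const K
  have h1p : 0 < 1 - p := by linarith
  have hq : 0 ≤ -p / (1 - p) := div_nonneg (by linarith) h1p.le
  refine le_trans ?_ (mul_le_mul_right (ENNReal.rpow_le_rpow
    (lintegral_antitone_change_le hg hac hneg hb hK
      (fun z => ENNReal.ofReal (B z ^ ((1 - p) / (-p))))) hq) _)
  refine le_trans (le_of_eq ?_) (ENNReal.lintegral_mul_norm_pow_le ?_ ?_ (by positivity)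
    hq (by field_simp; ring))
  · refine setLIntegral_congr_fun_ae hS ?_
    filter_upwards [hneg] with x hx hxs
    have hg0 := hg.pos hxs
    have hd : 0 < |g x ^ (b - 2) * deriv g x| :=
      abs_pos.2 (mul_ne_zero (Real.rpow_pos_of_pos hg0 _).ne' (hx hxs).ne)
    have hB0 := hB _ (div_pos (Real.rpow_pos_of_pos hg0 b) hK)
    have e : ENNReal.ofReal (B (g x ^ b / K) ^ ((1 - p) / -p)) ^ (-p / (1 - p))
        = ENNReal.ofReal (B (g x ^ b / K)) := by
      have hnp : -p ≠ 0 := by linarith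
      rw [ENNReal.ofReal_rpow_of_nonneg (Real.rpow_nonneg hB0 _) hq, ← Real.rpow_mul hB0]
      congr 1
      have : (1 - p) / -p * (-p / (1 - p)) = 1 := by
        rw [div_mul_div_comm, mul_comm, div_self (mul_ne_zero hnp h1p.ne')]
      rw [this, Real.rpow_one]
    rw [ENNReal.mul_rpow_of_nonneg _ _ hq, e, ← mul_assoc]
    congr 1
    obtain ⟨u, hu⟩ : ∃ u, Real.exp u = g x := ⟨_, Real.exp_log hg0⟩
    obtain ⟨v, hv⟩ : ∃ v, Real.exp v = |g x ^ (b - 2) * deriv g x| := ⟨_, Real.exp_log hd⟩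
    rw [← hv, ← hu]
    simp only [← Real.exp_mul, ← Real.exp_add,
      ENNReal.ofReal_rpow_of_pos (Real.exp_pos _), ← ENNReal.ofReal_mul (Real.exp_pos _).le]
    congr 2
    field_simp
    ring
  · exact (((((hgm.pow_const _).mul (measurable_deriv g).aemeasurable).abs.ennreal_ofReal).pow_const
      _).mul hgm.ennreal_ofReal)
  · exact ((((hgm.pow_const _).mul (measurable_deriv g).aemeasurable).abs.ennreal_ofReal).mul
      hgm.ennreal_ofReal).mul ((hBm.comp_aemeasurable hwm).pow_const _).ennreal_ofReal

end mirrored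

/-! ### Generalized Gaussians -/

/-- `(1 - (μ - 1) |z|^ρ)_+`. -/
def tsallisBase (ρ μ z : ℝ) : ℝ := max (1 - (μ - 1) * |z| ^ ρ) 0

/-- `(1 - (μ - 1) |z|^ρ)_+^{1/(μ-1)}`. -/
def tsallis (ρ μ z : ℝ) : ℝ := tsallisBase ρ μ z ^ (1 / (μ - 1))

/-- Integral of `tsallis ρ μ` over the positive half-line. -/
def tsallisMass (ρ μ : ℝ) : ℝ := ∫ z in Ioi (0 : ℝ), tsallis ρ μ z

/-- Moment of order `ρ` of the normalized profile. -/
def tsallisMoment (ρ μ : ℝ) : ℝ := (∫ z in Ioi (0 : ℝ), z ^ ρ * tsallis ρ μ z) / tsallisMass ρ μ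

section tsallis

variable {ρ μ : ℝ}

theorem tsallisBase_nonneg (z : ℝ) : 0 ≤ tsallisBase ρ μ z := le_max_right _ _

theorem tsallis_nonneg (z : ℝ) : 0 ≤ tsallis ρ μ z := Real.rpow_nonneg (tsallisBase_nonneg z) _

theorem tsallisBase_abs (z : ℝ) : tsallisBase ρ μ |z| = tsallisBase ρ μ z := by
  rw [tsallisBase, tsallisBase, abs_abs]

theorem tsallis_abs (z : ℝ) : tsallis ρ μ |z| = tsallis ρ μ z := by
  rw [tsallis, tsallis, tsallisBase_abs]

theorem tsallisBase_of_lt_one (hμ : μ < 1) (z : ℝ) :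
    tsallisBase ρ μ z = 1 + (1 - μ) * |z| ^ ρ := by
  have : 0 ≤ (1 - μ) * |z| ^ ρ :=
    mul_nonneg (by linarith) (Real.rpow_nonneg (abs_nonneg _) _)
  rw [tsallisBase, max_eq_left (by linarith)]
  ring

theorem tsallisBase_pos_of_lt_one (hμ : μ < 1) (z : ℝ) : 0 < tsallisBase ρ μ z := by
  have : 0 ≤ (1 - μ) * |z| ^ ρ :=
    mul_nonneg (by linarith) (Real.rpow_nonneg (abs_nonneg _) _)
  rw [tsallisBase_of_lt_one hμ]
  linarith

theorem tsallisBase_zero (hρ : 0 < ρ) : tsallisBase ρ μ 0 = 1 := by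
  rw [tsallisBase, abs_zero, Real.zero_rpow hρ.ne']
  norm_num

theorem tsallis_zero (hρ : 0 < ρ) : tsallis ρ μ 0 = 1 := by
  rw [tsallis, tsallisBase_zero hρ, Real.one_rpow]

theorem continuous_tsallisBase (hρ : 0 < ρ) : Continuous (tsallisBase ρ μ) :=
  (continuous_const.sub (continuous_const.mul (continuous_abs.rpow_const
    fun _ => Or.inr hρ.le))).max continuous_const

theorem continuous_tsallisBase_rpow (hρ : 0 < ρ) {e : ℝ} (he : 1 < μ → 0 ≤ e)
    (hμ : μ ≠ 1) : Continuous fun z => tsallisBase ρ μ z ^ e := by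
  rcases lt_or_gt_of_ne hμ with h | h
  · exact (continuous_tsallisBase hρ).rpow_const fun z =>
      Or.inl (tsallisBase_pos_of_lt_one h z).ne'
  · exact (continuous_tsallisBase hρ).rpow_const fun z => Or.inr (he h)

theorem continuous_tsallis (hρ : 0 < ρ) (hμ : μ ≠ 1) : Continuous (tsallis ρ μ) :=
  continuous_tsallisBase_rpow hρ (fun h => one_div_nonneg.2 (by linarith)) hμ

theorem tsallis_pos_iff (hμ : μ ≠ 1) (z : ℝ) : 0 < tsallis ρ μ z ↔ 0 < tsallisBase ρ μ z := by
  refine ⟨fun h => ?_, fun h => Real.rpow_pos_of_pos h _⟩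
  refine lt_of_le_of_ne (tsallisBase_nonneg z) fun h0 => ?_
  rw [tsallis, ← h0, Real.zero_rpow (one_div_ne_zero (sub_ne_zero.2 hμ))] at h
  exact lt_irrefl _ h

theorem tsallis_rpow (hμ : μ ≠ 1) (hμ0 : 0 < μ) (z : ℝ) :
    tsallis ρ μ z ^ μ = tsallis ρ μ z * (1 - (μ - 1) * |z| ^ ρ) := by
  have hμ1 : μ - 1 ≠ 0 := sub_ne_zero.2 hμ
  rcases (tsallisBase_nonneg (ρ := ρ) (μ := μ) z).eq_or_lt with h | h
  · rw [tsallis, ← h, Real.zero_rpow (one_div_ne_zero hμ1), Real.zero_rpow hμ0.ne', zero_mul]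
  · have h1 : tsallisBase ρ μ z = 1 - (μ - 1) * |z| ^ ρ := by
      rw [tsallisBase, max_eq_left]
      by_contra hc
      rw [tsallisBase, max_eq_right (not_le.1 hc).le] at h
      exact lt_irrefl _ h
    rw [tsallis, ← Real.rpow_mul h.le, ← h1]
    nth_rw 3 [← Real.rpow_one (tsallisBase ρ μ z)]
    rw [← Real.rpow_add h]
    congr 1
    field_simp
    ring

theorem tsallisBase_rpow_eq (z : ℝ) :
    tsallisBase ρ μ z ^ (μ / (μ - 1)) = tsallis ρ μ z ^ μ := by
  rw [tsallis, ← Real.rpow_mul (tsallisBase_nonneg z), one_div_mul_eq_div]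

theorem tsallisBase_eq_zero (hρ : 0 < ρ) (hμ : 1 < μ) {z : ℝ} (hz : (1 / (μ - 1)) ^ (1 / ρ) ≤ |z|) :
    tsallisBase ρ μ z = 0 := by
  have hμ1 : 0 < μ - 1 := by linarith
  rw [tsallisBase, max_eq_right]
  have h1 : 1 / (μ - 1) ≤ |z| ^ ρ := by
    have := Real.rpow_le_rpow (by positivity) hz hρ.le
    rwa [← Real.rpow_mul (by positivity), one_div_mul_cancel hρ.ne', Real.rpow_one] at this
  have h2 := mul_le_mul_of_nonneg_left h1 hμ1.le
  rw [mul_one_div_cancel hμ1.ne'] at h2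
  linarith

theorem rpow_mul_tsallisBase_rpow_le (hμ : μ < 1) {e : ℝ} (he : e ≤ 0) {z : ℝ} (hz : 0 < z) (a : ℝ) :
    z ^ a * tsallisBase ρ μ z ^ e ≤ (1 - μ) ^ e * z ^ (a + ρ * e) := by
  have h0 : 0 < (1 - μ) * z ^ ρ := mul_pos (by linarith) (Real.rpow_pos_of_pos hz _)
  have h1 : tsallisBase ρ μ z ^ e ≤ ((1 - μ) * z ^ ρ) ^ e := by
    refine Real.rpow_le_rpow_of_nonpos h0 ?_ he
    rw [tsallisBase_of_lt_one hμ, abs_of_pos hz]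
    linarith
  rw [Real.mul_rpow (by linarith) (Real.rpow_nonneg hz.le _), ← Real.rpow_mul hz.le] at h1
  calc z ^ a * tsallisBase ρ μ z ^ e ≤ z ^ a * ((1 - μ) ^ e * z ^ (ρ * e)) :=
        mul_le_mul_of_nonneg_left h1 (Real.rpow_nonneg hz.le _)
    _ = (1 - μ) ^ e * z ^ (a + ρ * e) := by rw [Real.rpow_add hz]; ring

theorem integrableOn_rpow_mul_tsallis (hρ : 0 < ρ) (hμ : μ ≠ 1) (hμρ : 1 / (1 + ρ) < μ) :
    IntegrableOn (fun z => z ^ ρ * tsallis ρ μ z) (Ioi 0) := by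
  have hc : Continuous fun z : ℝ => z ^ ρ * tsallis ρ μ z :=
    (continuous_id.rpow_const fun _ => Or.inr hρ.le).mul (continuous_tsallis hρ hμ)
  obtain ⟨R, hR, h⟩ : ∃ R : ℝ, 0 < R ∧ IntegrableOn (fun z => z ^ ρ * tsallis ρ μ z) (Ioi R) := by
    rcases lt_or_gt_of_ne hμ with h | h
    · refine ⟨1, one_pos, ?_⟩
      have he : 1 / (μ - 1) < 0 := one_div_neg.2 (by linarith)
      have hlt : ρ + ρ * (1 / (μ - 1)) < -1 := by
        rw [div_lt_iff₀ (by linarith)] at hμρ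
        have h1 : 0 < 1 - μ := by linarith
        have : ρ + ρ * (1 / (μ - 1)) = -(ρ * μ / (1 - μ)) := by
          have h2 : μ - 1 ≠ 0 := by linarith
          have h3 : (1 : ℝ) - μ = -(μ - 1) := by ring
          rw [h3]
          field_simp
          ring
        rw [this, neg_lt_neg_iff, lt_div_iff₀ h1]
        linarith
      refine Integrable.mono' ((integrableOn_Ioi_rpow_of_lt hlt one_pos).const_mul
        ((1 - μ) ^ (1 / (μ - 1)))) hc.aestronglyMeasurable ?_
      rw [ae_restrict_iff' measurableSet_Ioi]
      filter_upwards with z hz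
      have hz0 : 0 < z := one_pos.trans hz
      rw [Real.norm_of_nonneg (mul_nonneg (Real.rpow_nonneg hz0.le _) (tsallis_nonneg z))]
      exact rpow_mul_tsallisBase_rpow_le h he.le hz0 ρ
    · have hR : 0 < (1 / (μ - 1)) ^ (1 / ρ) :=
        Real.rpow_pos_of_pos (one_div_pos.2 (by linarith)) _
      refine ⟨_, hR, ?_⟩
      refine integrableOn_zero.congr_fun (fun z hz => ?_) measurableSet_Ioi
      have hz' : (1 / (μ - 1)) ^ (1 / ρ) ≤ |z| := (le_of_lt hz).trans (le_abs_self z)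
      rw [tsallis, tsallisBase_eq_zero hρ h hz',
        Real.zero_rpow (one_div_ne_zero (sub_ne_zero.2 hμ)), mul_zero]
  rw [← Ioc_union_Ioi_eq_Ioi hR.le]
  exact ((hc.integrableOn_Icc).mono_set Ioc_subset_Icc_self).union h

theorem integrableOn_tsallis (hρ : 0 < ρ) (hμ : μ ≠ 1) (hμρ : 1 / (1 + ρ) < μ) :
    IntegrableOn (tsallis ρ μ) (Ioi 0) := by
  have hc := continuous_tsallis hρ hμ
  rw [← Ioc_union_Ioi_eq_Ioi zero_le_one]
  refine ((hc.integrableOn_Icc).mono_set Ioc_subset_Icc_self).union ?_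
  refine Integrable.mono' ((integrableOn_rpow_mul_tsallis hρ hμ hμρ).mono_set
    (Ioi_subset_Ioi zero_le_one)) hc.aestronglyMeasurable ?_
  rw [ae_restrict_iff' measurableSet_Ioi]
  filter_upwards with z hz
  rw [Real.norm_of_nonneg (tsallis_nonneg z)]
  exact le_mul_of_one_le_left (tsallis_nonneg z) (Real.one_le_rpow (le_of_lt hz) hρ.le)

theorem setIntegral_Ioi_pos_of_continuous {f : ℝ → ℝ} (hc : Continuous f) (h0 : ∀ z, 0 < z → 0 ≤ f z)
    (hi : IntegrableOn f (Ioi 0)) (hpos : ∃ z, 0 < z ∧ 0 < f z) : 0 < ∫ z in Ioi (0 : ℝ), f z := by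
  obtain ⟨z, hz, hfz⟩ := hpos
  rw [setIntegral_pos_iff_support_of_nonneg_ae _ hi]
  · refine ((isOpen_lt continuous_const hc).inter isOpen_Ioi).measure_pos volume ⟨z, hfz, hz⟩ |>.trans_le
      (measure_mono fun y hy => ⟨(ne_of_gt hy.1), hy.2⟩)
  · rw [EventuallyLE, ae_restrict_iff' measurableSet_Ioi]
    filter_upwards with z hz using h0 z hz

theorem exists_tsallis_pos (hρ : 0 < ρ) (hμ : μ ≠ 1) : ∃ z, 0 < z ∧ 0 < tsallis ρ μ z := by
  have h := (continuous_tsallis hρ hμ).continuousAt (x := 0)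
  have h1 : ∀ᶠ z in 𝓝 (0 : ℝ), 0 < tsallis ρ μ z :=
    h.eventually (lt_mem_nhds (by rw [tsallis_zero hρ]; exact one_pos))
  have h2 : ∀ᶠ z in 𝓝[>] (0 : ℝ), 0 < z ∧ 0 < tsallis ρ μ z :=
    (eventually_mem_nhdsWithin.and (h1.filter_mono nhdsWithin_le_nhds)).mono fun z hz => hz
  exact h2.exists

theorem tsallisMass_pos (hρ : 0 < ρ) (hμ : μ ≠ 1) (hμρ : 1 / (1 + ρ) < μ) :
    0 < tsallisMass ρ μ :=
  setIntegral_Ioi_pos_of_continuous (continuous_tsallis hρ hμ) (fun z _ => tsallis_nonneg z)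
    (integrableOn_tsallis hρ hμ hμρ) (exists_tsallis_pos hρ hμ)

theorem tsallisMoment_pos (hρ : 0 < ρ) (hμ : μ ≠ 1) (hμρ : 1 / (1 + ρ) < μ) :
    0 < tsallisMoment ρ μ := by
  refine div_pos (setIntegral_Ioi_pos_of_continuous ?_ (fun z hz => ?_)
    (integrableOn_rpow_mul_tsallis hρ hμ hμρ) ?_) (tsallisMass_pos hρ hμ hμρ)
  · exact (continuous_id.rpow_const fun _ => Or.inr hρ.le).mul (continuous_tsallis hρ hμ)
  · exact mul_nonneg (Real.rpow_nonneg hz.le _) (tsallis_nonneg z)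
  · obtain ⟨z, hz, h⟩ := exists_tsallis_pos (ρ := ρ) hρ hμ
    exact ⟨z, hz, mul_pos (Real.rpow_pos_of_pos hz _) h⟩

theorem integral_rpow_mul_tsallis (hI : 0 < tsallisMass ρ μ) :
    ∫ z in Ioi (0 : ℝ), z ^ ρ * tsallis ρ μ z = tsallisMoment ρ μ * tsallisMass ρ μ := by
  rw [tsallisMoment, div_mul_cancel₀ _ hI.ne']

theorem integrableOn_tsallis_rpow (hρ : 0 < ρ) (hμ : μ ≠ 1) (hμρ : 1 / (1 + ρ) < μ) :
    IntegrableOn (fun z => tsallis ρ μ z ^ μ) (Ioi 0) := by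
  have hμ0 : 0 < μ := lt_trans (by positivity) hμρ
  refine ((integrableOn_tsallis hρ hμ hμρ).sub
    ((integrableOn_rpow_mul_tsallis hρ hμ hμρ).const_mul (μ - 1))).congr_fun (fun z hz => ?_)
    measurableSet_Ioi
  rw [tsallis_rpow hμ hμ0, abs_of_pos hz]
  simp only [Pi.sub_apply]
  ring

theorem integral_tsallis_rpow (hρ : 0 < ρ) (hμ : μ ≠ 1) (hμρ : 1 / (1 + ρ) < μ) :
    ∫ z in Ioi (0 : ℝ), tsallis ρ μ z ^ μ
      = (1 - (μ - 1) * tsallisMoment ρ μ) * tsallisMass ρ μ := by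
  have hμ0 : 0 < μ := lt_trans (by positivity) hμρ
  have hI := tsallisMass_pos hρ hμ hμρ
  have h1 : ∫ z in Ioi (0 : ℝ), tsallis ρ μ z ^ μ
      = ∫ z in Ioi (0 : ℝ), (tsallis ρ μ z - (μ - 1) * (z ^ ρ * tsallis ρ μ z)) := by
    refine setIntegral_congr_fun measurableSet_Ioi fun z hz => ?_
    rw [tsallis_rpow hμ hμ0, abs_of_pos hz]
    ring
  rw [h1, integral_sub (integrableOn_tsallis hρ hμ hμρ)
    ((integrableOn_rpow_mul_tsallis hρ hμ hμρ).const_mul (μ - 1)), integral_const_mul,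
    integral_rpow_mul_tsallis hI]
  change tsallisMass ρ μ - _ = _
  ring

theorem one_sub_tsallisMoment_pos (hρ : 0 < ρ) (hμ : μ ≠ 1) (hμρ : 1 / (1 + ρ) < μ) :
    0 < 1 - (μ - 1) * tsallisMoment ρ μ := by
  have hμ0 : 0 < μ := lt_trans (by positivity) hμρ
  have h : 0 < ∫ z in Ioi (0 : ℝ), tsallis ρ μ z ^ μ := by
    refine setIntegral_Ioi_pos_of_continuous ((continuous_tsallis hρ hμ).rpow_const
      fun _ => Or.inr hμ0.le) (fun z _ => Real.rpow_nonneg (tsallis_nonneg z) _)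
      (integrableOn_tsallis_rpow hρ hμ hμρ) ?_
    obtain ⟨z, hz, h⟩ := exists_tsallis_pos (ρ := ρ) hρ hμ
    exact ⟨z, hz, Real.rpow_pos_of_pos h _⟩
  rw [integral_tsallis_rpow hρ hμ hμρ] at h
  exact pos_of_mul_pos_left h (tsallisMass_pos hρ hμ hμρ).le

theorem tsallisBase_hasDerivAt (hρ : 0 < ρ) {z : ℝ} (hz : 0 < z)
    (h : 0 < tsallisBase ρ μ z) :
    HasDerivAt (tsallisBase ρ μ) (-((μ - 1) * (ρ * z ^ (ρ - 1)))) z := by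
  have h1 : HasDerivAt (fun z : ℝ => 1 - (μ - 1) * z ^ ρ) (-((μ - 1) * (ρ * z ^ (ρ - 1)))) z :=
    (((Real.hasDerivAt_rpow_const (Or.inl hz.ne')).const_mul (μ - 1)).const_sub 1)
  refine h1.congr_of_eventuallyEq ?_
  have h2 : ∀ᶠ y in 𝓝 z, 0 < tsallisBase ρ μ y :=
    (continuous_tsallisBase hρ).continuousAt.eventually (lt_mem_nhds h)
  filter_upwards [h2, lt_mem_nhds hz] with y hy hy0
  rw [tsallisBase] at hy ⊢
  rw [abs_of_pos hy0] at hy ⊢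
  rw [max_eq_left]
  by_contra hc
  rw [max_eq_right (not_le.1 hc).le] at hy
  exact lt_irrefl _ hy

theorem tsallisBase_rpow_hasDerivAt (hρ : 0 < ρ) {z : ℝ} (hz : 0 < z)
    (h : 0 < tsallisBase ρ μ z) (e : ℝ) :
    HasDerivAt (fun z => tsallisBase ρ μ z ^ e)
      (-(e * (μ - 1) * ρ * z ^ (ρ - 1) * tsallisBase ρ μ z ^ (e - 1))) z :=
  ((tsallisBase_hasDerivAt hρ hz h).rpow_const (p := e) (Or.inl h.ne')).congr_deriv (by ring)

theorem one_sub_tsallisMoment_eq (hρ : 0 < ρ) (hμ : μ ≠ 1) (hμρ : 1 / (1 + ρ) < μ) :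
    1 - (μ - 1) * tsallisMoment ρ μ = μ * ρ * tsallisMoment ρ μ := by
  have hμ0 : 0 < μ := lt_trans (by positivity) hμρ
  have hμ1 : μ - 1 ≠ 0 := sub_ne_zero.2 hμ
  have hI := tsallisMass_pos hρ hμ hμρ
  have hi1 := integrableOn_tsallis_rpow hρ hμ hμρ
  have hi2 := (integrableOn_rpow_mul_tsallis hρ hμ hμρ).const_mul (μ * ρ)
  have hc1 : Continuous fun z => tsallis ρ μ z ^ μ :=
    (continuous_tsallis hρ hμ).rpow_const fun _ => Or.inr hμ0.le
  set h' : ℝ → ℝ := fun z => tsallis ρ μ z ^ μ - μ * ρ * (z ^ ρ * tsallis ρ μ z) with hh'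
  have hi : IntegrableOn h' (Ioi 0) := hi1.sub hi2
  have hftc : ∀ R : ℝ, 0 ≤ R → ∫ z in (0 : ℝ)..R, h' z = R * tsallis ρ μ R ^ μ := by
    intro R hR
    rw [integral_eq_of_hasDerivAt_off_countable_of_le (fun z => z * tsallis ρ μ z ^ μ) h' hR
      (countable_singleton ((1 / (μ - 1)) ^ (1 / ρ))) (continuous_id.mul hc1).continuousOn]
    · ring
    · rintro z ⟨⟨hz, -⟩, hzR⟩
      rcases (tsallisBase_nonneg (ρ := ρ) (μ := μ) z).eq_or_lt with h | h
      · have hμ2 : 1 < μ := by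
          by_contra hc
          exact (tsallisBase_pos_of_lt_one (lt_of_le_of_ne (not_lt.1 hc) hμ) z).ne h
        have hlt : (1 / (μ - 1)) ^ (1 / ρ) < z := by
          have hμ3 : 0 < μ - 1 := by linarith
          refine lt_of_le_of_ne ?_ (fun h => hzR h.symm)
          by_contra hc
          have h3 := Real.rpow_lt_rpow hz.le (not_le.1 hc) hρ
          rw [← Real.rpow_mul (by positivity), one_div_mul_cancel hρ.ne', Real.rpow_one,
            lt_div_iff₀ hμ3] at h3
          rw [tsallisBase, abs_of_pos hz] at h
          have := (h.symm ▸ le_max_left (1 - (μ - 1) * z ^ ρ) 0 : 1 - (μ - 1) * z ^ ρ ≤ 0)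
          linarith
        have hev : (fun z => z * tsallis ρ μ z ^ μ) =ᶠ[𝓝 z] fun _ => 0 := by
          filter_upwards [lt_mem_nhds hlt] with y hy
          rw [tsallis, tsallisBase_eq_zero hρ hμ2 (hy.le.trans (le_abs_self y)),
            Real.zero_rpow (one_div_ne_zero hμ1), Real.zero_rpow hμ0.ne', mul_zero]
        have h0 : h' z = 0 := by
          rw [hh']
          simp only [tsallis]
          rw [← h, Real.zero_rpow (one_div_ne_zero hμ1), Real.zero_rpow hμ0.ne']
          ring
        rw [h0]
        exact (hasDerivAt_const z (0 : ℝ)).congr_of_eventuallyEq hev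
      · have h1 := (hasDerivAt_id z).mul (tsallisBase_rpow_hasDerivAt hρ hz h (μ / (μ - 1)))
        simp only [tsallisBase_rpow_eq] at h1
        refine h1.congr_deriv ?_
        have e1 : μ / (μ - 1) - 1 = 1 / (μ - 1) := by field_simp; ring
        have e2 : z ^ ρ = z * z ^ (ρ - 1) := by
          nth_rw 2 [← Real.rpow_one z]
          rw [← Real.rpow_add hz]
          ring_nf
        rw [e1, hh']
        simp only [id]
        rw [e2, tsallis]
        field_simp
        ring
    · rw [intervalIntegrable_iff_integrableOn_Ioc_of_le hR]
      exact hi.mono_set fun z hz => hz.1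
  have hlim : Tendsto (fun R : ℝ => R * tsallis ρ μ R ^ μ) atTop (𝓝 0) := by
    rcases lt_or_gt_of_ne hμ with h | h
    · have he : μ / (μ - 1) < 0 := div_neg_of_pos_of_neg hμ0 (by linarith)
      have hlt : 0 < -(1 + ρ * (μ / (μ - 1))) := by
        rw [div_lt_iff₀ (by linarith)] at hμρ
        have h1 : 0 < 1 - μ := by linarith
        have : -(1 + ρ * (μ / (μ - 1))) = (μ * (1 + ρ) - 1) / (1 - μ) := by
          have h3 : (1 : ℝ) - μ = -(μ - 1) := by ring
          rw [h3]
          field_simp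
          ring
        rw [this]
        exact div_pos (by linarith) h1
      have h0 := (tendsto_rpow_neg_atTop hlt).const_mul ((1 - μ) ^ (μ / (μ - 1)))
      rw [mul_zero] at h0
      refine squeeze_zero' ?_ ?_ h0
      · filter_upwards [eventually_gt_atTop 0] with R hR
        exact mul_nonneg hR.le (Real.rpow_nonneg (tsallis_nonneg _) _)
      · filter_upwards [eventually_gt_atTop 0] with R hR
        have := rpow_mul_tsallisBase_rpow_le (ρ := ρ) h he.le hR 1
        rwa [Real.rpow_one, tsallisBase_rpow_eq, ← neg_neg (1 + _)] at this
    · refine tendsto_const_nhds.congr' ?_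
      filter_upwards [eventually_ge_atTop ((1 / (μ - 1)) ^ (1 / ρ))] with R hR
      rw [tsallis, tsallisBase_eq_zero hρ h (hR.trans (le_abs_self R)),
        Real.zero_rpow (one_div_ne_zero hμ1), Real.zero_rpow hμ0.ne', mul_zero]
  have h1 := intervalIntegral_tendsto_integral_Ioi 0 hi tendsto_id
  have h2 : Tendsto (fun R : ℝ => ∫ z in (0 : ℝ)..R, h' z) atTop (𝓝 0) := by
    refine hlim.congr' ?_
    filter_upwards [eventually_ge_atTop 0] with R hR using (hftc R hR).symm
  have h3 : ∫ z in Ioi (0 : ℝ), h' z = 0 := tendsto_nhds_unique h1 h2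
  rw [hh', integral_sub hi1 hi2, integral_const_mul, integral_tsallis_rpow hρ hμ hμρ] at h3
  rw [integral_rpow_mul_tsallis hI] at h3
  have h5 : (1 - (μ - 1) * tsallisMoment ρ μ - μ * ρ * tsallisMoment ρ μ) * tsallisMass ρ μ = 0 := by
    linarith
  rcases mul_eq_zero.1 h5 with h6 | h6
  · linarith
  · exact absurd h6 hI.ne'

end tsallis

theorem setLIntegral_Iio_zero_of_even {f : ℝ → ℝ≥0∞} (hf : ∀ z, f (-z) = f z) :
    ∫⁻ z in Iio (0 : ℝ), f z = ∫⁻ z in Ioi (0 : ℝ), f z := by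
  have h : (fun z : ℝ => -z) '' Ioi 0 = Iio 0 := by simp
  rw [← h, lintegral_image_eq_lintegral_abs_deriv_mul measurableSet_Ioi
    (fun x _ => (hasDerivAt_neg x).hasDerivWithinAt) neg_injective.injOn]
  simp [hf]

theorem lintegral_of_even {f : ℝ → ℝ≥0∞} (hf : ∀ z, f (-z) = f z) :
    ∫⁻ z, f z = 2 * ∫⁻ z in Ioi (0 : ℝ), f z := by
  rw [← lintegral_add_compl f measurableSet_Ioi (A := Ioi 0), compl_Ioi,
    setLIntegral_congr (Iio_ae_eq_Iic (a := (0 : ℝ))).symm, setLIntegral_Iio_zero_of_even hf, two_mul]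

theorem setLIntegral_half_of_even {f : ℝ → ℝ≥0∞} (hf : ∀ z, f (-z) = f z) {c : ℝ} (hc : c ≠ 0) :
    ∫⁻ z in {z : ℝ | 0 < c * z}, f z = ∫⁻ z in Ioi (0 : ℝ), f z := by
  rcases lt_or_gt_of_ne hc with h | h
  · have : {z : ℝ | 0 < c * z} = Iio 0 := by
      ext z; simp [mul_pos_iff, h, not_lt.2 h.le]
    rw [this, setLIntegral_Iio_zero_of_even hf]
  · have : {z : ℝ | 0 < c * z} = Ioi 0 := by
      ext z; simp [h]
    rw [this]

theorem setLIntegral_ofReal_Ioi {f : ℝ → ℝ} (hi : IntegrableOn f (Ioi 0))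
    (h0 : ∀ z, 0 < z → 0 ≤ f z) :
    ∫⁻ z in Ioi (0 : ℝ), ENNReal.ofReal (f z) = ENNReal.ofReal (∫ z in Ioi (0 : ℝ), f z) := by
  rw [ofReal_integral_eq_lintegral_ofReal hi]
  rw [EventuallyLE, ae_restrict_iff' measurableSet_Ioi]
  filter_upwards with z hz using h0 z hz

section gaussian

variable {ρ μ : ℝ}

theorem gaussian_eq (hμ : μ ≠ 1) (z : ℝ) :
    gaussian ρ μ z = tsallis ρ μ z / (2 * tsallisMass ρ μ) := by
  have h1 : ∀ y, qExp (2 - μ) (-|y| ^ ρ) = tsallis ρ μ y := fun y => by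
    rw [qExp, if_neg (by intro h; apply hμ; linarith), tsallis, tsallisBase]
    have e : 1 - (2 - μ) = μ - 1 := by ring
    rw [e]
    ring_nf
  have h2 : ∫ y, tsallis ρ μ y = 2 * tsallisMass ρ μ := by
    rw [tsallisMass, ← integral_comp_abs]
    simp_rw [tsallis_abs]
  simp only [gaussian, h1, h2]

theorem gaussian_neg (z : ℝ) : gaussian ρ μ (-z) = gaussian ρ μ z := by
  simp only [gaussian, abs_neg]

theorem gaussian_nonneg (hρ : 0 < ρ) (hμ : μ ≠ 1) (hμρ : 1 / (1 + ρ) < μ) (z : ℝ) :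
    0 ≤ gaussian ρ μ z := by
  rw [gaussian_eq hμ]
  exact div_nonneg (tsallis_nonneg z) (by linarith [tsallisMass_pos hρ hμ hμρ])

theorem continuous_gaussian (hρ : 0 < ρ) (hμ : μ ≠ 1) : Continuous (gaussian ρ μ) := by
  have : gaussian ρ μ = fun z => tsallis ρ μ z / (2 * tsallisMass ρ μ) :=
    funext fun z => gaussian_eq hμ z
  rw [this]
  exact (continuous_tsallis hρ hμ).div_const _

theorem gaussian_pos_iff (hρ : 0 < ρ) (hμ : μ ≠ 1) (hμρ : 1 / (1 + ρ) < μ) (z : ℝ) :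
    z ∈ Function.support (gaussian ρ μ) ↔ 0 < tsallisBase ρ μ z := by
  have hI := tsallisMass_pos hρ hμ hμρ
  rw [← tsallis_pos_iff hμ, Function.mem_support, gaussian_eq hμ]
  constructor
  · intro h
    exact lt_of_le_of_ne (tsallis_nonneg z) fun h0 => h (by rw [← h0, zero_div])
  · intro h
    exact (div_pos h (by linarith)).ne'

theorem tsallisBase_pos_of_abs_le (hρ : 0 < ρ) {x z : ℝ} (hxz : |z| ≤ |x|)
    (hx : 0 < tsallisBase ρ μ x) : 0 < tsallisBase ρ μ z := by
  rcases le_or_gt μ 1 with h | h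
  · refine lt_max_of_lt_left ?_
    have : 0 ≤ (1 - μ) * |z| ^ ρ :=
      mul_nonneg (by linarith) (Real.rpow_nonneg (abs_nonneg _) _)
    linarith
  · refine hx.trans_le (max_le_max_right 0 ?_)
    have := mul_le_mul_of_nonneg_left (Real.rpow_le_rpow (abs_nonneg _) hxz hρ.le)
      (by linarith : 0 ≤ μ - 1)
    linarith

theorem tsallis_anti (hρ : 0 < ρ) {x z : ℝ} (hxz : |z| ≤ |x|) (hμ : μ ≠ 1) :
    tsallis ρ μ x ≤ tsallis ρ μ z := by
  have hr := Real.rpow_le_rpow (abs_nonneg _) hxz hρ.le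
  rcases lt_or_gt_of_ne hμ with h | h
  · refine Real.rpow_le_rpow_of_nonpos (tsallisBase_pos_of_lt_one h z) ?_
      (one_div_neg.2 (by linarith)).le
    rw [tsallisBase_of_lt_one h, tsallisBase_of_lt_one h]
    have := mul_le_mul_of_nonneg_left hr (by linarith : 0 ≤ 1 - μ)
    linarith
  · refine Real.rpow_le_rpow (tsallisBase_nonneg x) (max_le_max_right 0 ?_)
      (one_div_nonneg.2 (by linarith))
    have := mul_le_mul_of_nonneg_left hr (by linarith : 0 ≤ μ - 1)
    linarith

theorem gaussian_anti (hρ : 0 < ρ) (hμ : μ ≠ 1) (hμρ : 1 / (1 + ρ) < μ) {x z : ℝ}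
    (hxz : |z| ≤ |x|) : gaussian ρ μ x ≤ gaussian ρ μ z := by
  rw [gaussian_eq hμ, gaussian_eq hμ]
  exact div_le_div_of_nonneg_right (tsallis_anti hρ hxz hμ)
    (by linarith [tsallisMass_pos hρ hμ hμρ])

theorem zero_mem_support_gaussian (hρ : 0 < ρ) (hμ : μ ≠ 1) (hμρ : 1 / (1 + ρ) < μ) :
    (0 : ℝ) ∈ Function.support (gaussian ρ μ) := by
  rw [gaussian_pos_iff hρ hμ hμρ, tsallisBase_zero hρ]
  exact one_pos

theorem isDensity_gaussian (hρ : 0 < ρ) (hμ : μ ≠ 1) (hμρ : 1 / (1 + ρ) < μ) :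
    IsDensity (gaussian ρ μ) := by
  have hI := tsallisMass_pos hρ hμ hμρ
  refine ⟨gaussian_nonneg hρ hμ hμρ, (continuous_gaussian hρ hμ).isOpen_support, ?_, ?_⟩
  · refine ⟨fun x hx y hy z hz => ?_⟩
    rw [gaussian_pos_iff hρ hμ hμρ] at *
    rcases le_max_iff.1 (abs_le_max_abs_abs hz.1 hz.2) with h | h
    · exact tsallisBase_pos_of_abs_le hρ h hx
    · exact tsallisBase_pos_of_abs_le hρ h hy
  · rw [lintegral_of_even fun z => by rw [gaussian_neg]]
    have h1 : ∀ z, gaussian ρ μ z = (2 * tsallisMass ρ μ)⁻¹ * tsallis ρ μ z := fun z => by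
      rw [gaussian_eq hμ, div_eq_inv_mul]
    simp_rw [h1]
    rw [setLIntegral_ofReal_Ioi ((integrableOn_tsallis hρ hμ hμρ).const_mul _)
      (fun z _ => mul_nonneg (by positivity) (tsallis_nonneg z)), integral_const_mul]
    change 2 * ENNReal.ofReal ((2 * tsallisMass ρ μ)⁻¹ * tsallisMass ρ μ) = 1
    rw [← ENNReal.ofReal_ofNat, ← ENNReal.ofReal_mul (by norm_num), ← ENNReal.ofReal_one]
    congr 1
    field_simp

theorem setLIntegral_gaussian_rpow (hρ : 0 < ρ) (hμ : μ ≠ 1) (hμρ : 1 / (1 + ρ) < μ) :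
    ∫⁻ z in Ioi (0 : ℝ), ENNReal.ofReal (gaussian ρ μ z ^ μ)
      = ENNReal.ofReal ((2 * tsallisMass ρ μ) ^ (-μ) * ((1 - (μ - 1) * tsallisMoment ρ μ)
        * tsallisMass ρ μ)) := by
  have hI := tsallisMass_pos hρ hμ hμρ
  have h1 : ∀ z, gaussian ρ μ z ^ μ = (2 * tsallisMass ρ μ) ^ (-μ) * tsallis ρ μ z ^ μ := fun z => by
    rw [gaussian_eq hμ, Real.div_rpow (tsallis_nonneg z) (by positivity),
      Real.rpow_neg (by positivity), div_eq_inv_mul]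
  simp_rw [h1]
  rw [setLIntegral_ofReal_Ioi ((integrableOn_tsallis_rpow hρ hμ hμρ).const_mul _)
    (fun z _ => mul_nonneg (by positivity) (Real.rpow_nonneg (tsallis_nonneg z) _)),
    integral_const_mul, integral_tsallis_rpow hρ hμ hμρ]

theorem powInt_gaussian (hρ : 0 < ρ) (hμ : μ ≠ 1) (hμρ : 1 / (1 + ρ) < μ) :
    powInt μ (gaussian ρ μ)
      = ENNReal.ofReal ((2 * tsallisMass ρ μ) ^ (1 - μ) * (1 - (μ - 1) * tsallisMoment ρ μ)) := by
  have hI := tsallisMass_pos hρ hμ hμρ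
  have hμ0 : 0 < μ := lt_trans (by positivity) hμρ
  rw [powInt, setLIntegral_eq_of_support_subset, lintegral_of_even fun z => by rw [gaussian_neg],
    setLIntegral_gaussian_rpow hρ hμ hμρ, ← ENNReal.ofReal_ofNat,
    ← ENNReal.ofReal_mul (by norm_num), Real.rpow_sub (by positivity), Real.rpow_one,
    Real.rpow_neg (by positivity)]
  · congr 1
    ring
  · intro z hz h0
    simp [h0, Real.zero_rpow hμ0.ne'] at hz

theorem lintegral_moment_gaussian (hρ : 0 < ρ) (hμ : μ ≠ 1) (hμρ : 1 / (1 + ρ) < μ) :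
    ∫⁻ z in Ioi (0 : ℝ), ENNReal.ofReal (|z| ^ ρ) * ENNReal.ofReal (gaussian ρ μ z)
      = ENNReal.ofReal (tsallisMoment ρ μ / 2) := by
  have hI := tsallisMass_pos hρ hμ hμρ
  have h1 : ∀ z ∈ Ioi (0 : ℝ), ENNReal.ofReal (|z| ^ ρ) * ENNReal.ofReal (gaussian ρ μ z)
      = ENNReal.ofReal ((2 * tsallisMass ρ μ)⁻¹ * (z ^ ρ * tsallis ρ μ z)) := fun z hz => by
    rw [← ENNReal.ofReal_mul (Real.rpow_nonneg (abs_nonneg _) _), gaussian_eq hμ, abs_of_pos hz]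
    congr 1
    ring
  rw [setLIntegral_congr_fun measurableSet_Ioi h1,
    setLIntegral_ofReal_Ioi ((integrableOn_rpow_mul_tsallis hρ hμ hμρ).const_mul _)
    (fun z hz => mul_nonneg (by positivity) (mul_nonneg (Real.rpow_nonneg hz.le _)
      (tsallis_nonneg z))), integral_const_mul, integral_rpow_mul_tsallis hI]
  congr 1
  field_simp

theorem lintegral_moment_support_gaussian (hρ : 0 < ρ) (hμ : μ ≠ 1) (hμρ : 1 / (1 + ρ) < μ) :
    ∫⁻ z in Function.support (gaussian ρ μ), ENNReal.ofReal |z| ^ ρ * ENNReal.ofReal (gaussian ρ μ z)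
      = ENNReal.ofReal (tsallisMoment ρ μ) := by
  have h0 : ∀ z : ℝ, ENNReal.ofReal |z| ^ ρ = ENNReal.ofReal (|z| ^ ρ) := fun z =>
    ENNReal.ofReal_rpow_of_nonneg (abs_nonneg _) hρ.le
  simp_rw [h0]
  rw [setLIntegral_eq_of_support_subset, lintegral_of_even fun z => by rw [gaussian_neg, abs_neg],
    lintegral_moment_gaussian hρ hμ hμρ, ← ENNReal.ofReal_ofNat, ← ENNReal.ofReal_mul (by norm_num)]
  · congr 1
    ring
  · intro z hz h0
    simp [h0] at hz

end gaussian

/-! ### The Stam inequality for `p < 1` with the explicit constant -/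

theorem stam_inequality_of_lt_one {g : ℝ → ℝ} {p b s : ℝ} (hp0 : p ≠ 0) (hp1 : p < 1) (hb : b ≠ 0)
    (hs : s ≠ 0) (hsb : 0 < -s / b) (hμρ : 1 / (1 + -s / b) < 1 - p)
    (hg : IsDensity g) (hac : LocallyAC g (Function.support g))
    (hneg : ∀ᵐ x, x ∈ Function.support g → deriv g x < 0) :
    stamQuot p b s g ≤ ENNReal.ofReal (tsallisMoment (-s / b) (1 - p) ^ (b / s) / |b| *
      (tsallisMass (-s / b) (1 - p) *
        (1 + p * tsallisMoment (-s / b) (1 - p)) ^ (1 / p))) := by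
  set ρ := -s / b with hρ
  have hμ : 1 - p ≠ 1 := by intro h; apply hp0; linarith
  set I0 := tsallisMass ρ (1 - p) with hI0
  set m := tsallisMoment ρ (1 - p) with hm
  set q := 1 + p * m with hq
  have hb' : 0 < |b| := abs_pos.2 hb
  have hI : 0 < I0 := tsallisMass_pos hsb hμ hμρ
  have hm0 : 0 < m := tsallisMoment_pos hsb hμ hμρ
  have hq0 : 0 < q := by
    have := one_sub_tsallisMoment_pos hsb hμ hμρ
    rw [hq]; linarith
  have hbs : b / s < 0 := by
    have : b / s = -(1 / ρ) := by rw [hρ]; field_simp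
    rw [this, neg_lt_zero]; positivity
  have hS := hg.isOpen_support.measurableSet
  have hgm := (hac.continuousOn hg.isOpen_support).aemeasurable (μ := volume) hS
  by_cases hAt : powInt (1 - s) g = ∞
  · rw [stamQuot, hAt, ENNReal.top_rpow_of_neg hbs, zero_mul]
    exact zero_le
  have hA0 := powInt_pos (c := 1 - s) hg (hac.continuousOn hg.isOpen_support)
  obtain ⟨A, hA, hA'⟩ : ∃ A : ℝ, 0 < A ∧ powInt (1 - s) g = ENNReal.ofReal A :=
    ⟨_, ENNReal.toReal_pos hA0 hAt, (ENNReal.ofReal_toReal hAt).symm⟩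
  set K := (A / m) ^ (1 / ρ) with hK
  have hK0 : 0 < K := Real.rpow_pos_of_pos (div_pos hA hm0) _
  have hKρ : K ^ ρ = A / m := by
    rw [hK, ← Real.rpow_mul (div_pos hA hm0).le, one_div_mul_cancel hsb.ne', Real.rpow_one]
  have hBm : Measurable (tsallisBase ρ (1 - p)) := (continuous_tsallisBase hsb).measurable
  have hprof : ∫⁻ z in Ioi (0 : ℝ), ENNReal.ofReal (tsallisBase ρ (1 - p) z ^ ((1 - p) / (-p)))
      = ENNReal.ofReal (q * I0) := by
    have e : (1 - p) / -p = (1 - p) / (1 - p - 1) := by ring_nf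
    simp_rw [e, tsallisBase_rpow_eq]
    rw [setLIntegral_ofReal_Ioi (integrableOn_tsallis_rpow hsb hμ hμρ)
      (fun z _ => Real.rpow_nonneg (tsallis_nonneg z) _), integral_tsallis_rpow hsb hμ hμρ]
    congr 2
    rw [hq]; ring
  have hmom : ∀ c : ℝ, 0 ≤ c → ∫⁻ x in Function.support g, ENNReal.ofReal (g x) *
      ENNReal.ofReal (c * (g x ^ b / K) ^ ρ) = ENNReal.ofReal (c * m) := by
    intro c hc
    have h1 : ∫⁻ x in Function.support g, ENNReal.ofReal (g x) *
        ENNReal.ofReal (c * (g x ^ b / K) ^ ρ)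
        = ENNReal.ofReal (c / (A / m)) * powInt (1 - s) g := by
      rw [powInt, ← lintegral_const_mul' _ _ ENNReal.ofReal_ne_top]
      refine setLIntegral_congr_fun hS fun x hx => ?_
      have hx0 := hg.pos hx
      rw [← ENNReal.ofReal_mul hx0.le, ← ENNReal.ofReal_mul (div_nonneg hc (div_pos hA hm0).le)]
      congr 1
      have e : g x ^ (1 - s) = g x * (g x ^ b) ^ ρ := by
        nth_rw 2 [← Real.rpow_one (g x)]
        rw [← Real.rpow_mul hx0.le, ← Real.rpow_add hx0]
        congr 1
        rw [hρ]; field_simp; ring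
      rw [Real.div_rpow (Real.rpow_nonneg hx0.le _) hK0.le, hKρ, e]
      field_simp
    rw [h1, hA', ← ENNReal.ofReal_mul (div_nonneg hc (div_pos hA hm0).le)]
    congr 1
    field_simp
  have hone : ∫⁻ x in Function.support g, ENNReal.ofReal (g x) = 1 := by
    rw [setLIntegral_support_ofReal, hg.lintegral_eq_one]
  have hKb : 0 < K / |b| := div_pos hK0 hb'
  have hF : fisher p b g ^ (1 / p) ≤ ENNReal.ofReal (K / |b| * (I0 * q ^ (1 / p))) := by
    have hc : 0 < K / |b| * (q * I0) := by positivity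
    have hfin : ENNReal.ofReal (K / |b| * (I0 * q ^ (1 / p)))
        = ENNReal.ofReal (K / |b| * (q * I0)) * ENNReal.ofReal q ^ ((1 - p) / p) := by
      rw [ENNReal.ofReal_rpow_of_pos hq0, ← ENNReal.ofReal_mul hc.le]
      congr 1
      have : q ^ (1 / p) = q * q ^ ((1 - p) / p) := by
        nth_rw 2 [← Real.rpow_one q]
        rw [← Real.rpow_add hq0]
        congr 1
        field_simp
        ring
      rw [this]; ring
    rw [hfin]
    rcases lt_or_gt_of_ne hp0 with hp | hp
    · have h1 := le_fisher_of_mirrored hp hb hg hac hneg hK0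
        (fun z _ => tsallisBase_nonneg (ρ := ρ) (μ := 1 - p) z) hBm
      rw [hprof, ← ENNReal.ofReal_mul hKb.le] at h1
      have h2 : ENNReal.ofReal q ≤ ∫⁻ x in Function.support g,
          ENNReal.ofReal (g x) * ENNReal.ofReal (tsallisBase ρ (1 - p) (g x ^ b / K)) := by
        have h3 : ENNReal.ofReal q + ENNReal.ofReal (-p * m) ≤ (∫⁻ x in Function.support g,
            ENNReal.ofReal (g x) * ENNReal.ofReal (tsallisBase ρ (1 - p) (g x ^ b / K)))
            + ENNReal.ofReal (-p * m) := by
          rw [← ENNReal.ofReal_add hq0.le (mul_pos (by linarith) hm0).le,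
            ← hmom (-p) (by linarith), ← lintegral_add_right']
          · have e : q + -p * m = 1 := by rw [hq]; ring
            rw [e, ENNReal.ofReal_one, ← hone]
            refine setLIntegral_mono' hS fun x hx => ?_
            have hx0 := hg.pos hx
            have hw : 0 < g x ^ b / K := div_pos (Real.rpow_pos_of_pos hx0 _) hK0
            rw [← mul_add, ← ENNReal.ofReal_add (tsallisBase_nonneg _)
              (mul_nonneg (by linarith) (Real.rpow_nonneg hw.le _))]
            refine le_mul_of_one_le_right zero_le ?_
            rw [← ENNReal.ofReal_one]
            refine ENNReal.ofReal_le_ofReal ?_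
            have := le_max_left (1 - (1 - p - 1) * |g x ^ b / K| ^ ρ) 0
            rw [abs_of_pos hw] at this
            rw [tsallisBase, abs_of_pos hw]
            linarith
          · exact hgm.ennreal_ofReal.mul
              (((((hgm.pow_const b).div_const K).pow_const ρ).const_mul (-p)).ennreal_ofReal)
        exact (ENNReal.add_le_add_iff_right ENNReal.ofReal_ne_top).1 h3
      have h1p : 0 < 1 - p := by linarith
      have h4 := ennreal_rpow_le_rpow_of_nonpos (z := (1 - p) / p)
        (div_nonpos_of_nonneg_of_nonpos h1p.le hp.le) (h2.trans h1)
      have hcne : ENNReal.ofReal (K / |b| * (q * I0)) ≠ 0 := (ENNReal.ofReal_pos.2 hc).ne'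
      have hnz : NotZeroTop (fisher p b g ^ (1 / (1 - p)))
          (ENNReal.ofReal (K / |b| * (q * I0)) ^ (-p / (1 - p))) :=
        ⟨fun h => ENNReal.rpow_ne_top_of_ne_zero hcne ENNReal.ofReal_ne_top h.2,
          fun h => (ENNReal.rpow_pos (ENNReal.ofReal_pos.2 hc) ENNReal.ofReal_ne_top).ne' h.2⟩
      rw [hnz.mul_rpow, ← ENNReal.rpow_mul, ← ENNReal.rpow_mul] at h4
      have e1 : 1 / (1 - p) * ((1 - p) / p) = 1 / p := by field_simp
      have e2 : -p / (1 - p) * ((1 - p) / p) = -1 := by field_simp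
      rw [e1, e2, ENNReal.rpow_neg_one] at h4
      calc fisher p b g ^ (1 / p) = ENNReal.ofReal (K / |b| * (q * I0)) * (fisher p b g ^ (1 / p) *
            (ENNReal.ofReal (K / |b| * (q * I0)))⁻¹) := by
            rw [mul_left_comm, ENNReal.mul_inv_cancel hcne ENNReal.ofReal_ne_top, mul_one]
        _ ≤ _ := mul_le_mul_right h4 _
    · have h1 := fisher_le_of_mirrored hp hp1 hb hg hac hneg hK0
        (fun z _ => tsallisBase_pos_of_lt_one (ρ := ρ) (by linarith : 1 - p < 1) z) hBm
      rw [hprof, ← ENNReal.ofReal_mul hKb.le] at h1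
      have h2 : ∫⁻ x in Function.support g,
          ENNReal.ofReal (g x) * ENNReal.ofReal (tsallisBase ρ (1 - p) (g x ^ b / K))
          = ENNReal.ofReal q := by
        rw [hq, ENNReal.ofReal_add zero_le_one (by positivity), ENNReal.ofReal_one,
          ← hmom p hp.le, ← hone, ← lintegral_add_left' hgm.ennreal_ofReal]
        refine setLIntegral_congr_fun hS fun x hx => ?_
        have hx0 := hg.pos hx
        have hw : 0 < g x ^ b / K := div_pos (Real.rpow_pos_of_pos hx0 _) hK0
        rw [tsallisBase_of_lt_one (by linarith), ENNReal.ofReal_add zero_le_one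
          (mul_nonneg (by linarith) (Real.rpow_nonneg (abs_nonneg _) _)), abs_of_pos hw,
          ENNReal.ofReal_one, mul_add, mul_one, sub_sub_cancel]
      rw [h2] at h1
      have h3 := ENNReal.rpow_le_rpow h1 (z := 1 / p) (by positivity)
      rw [ENNReal.mul_rpow_of_nonneg _ _ (by positivity), ← ENNReal.rpow_mul, ← ENNReal.rpow_mul,
        mul_one_div_cancel hp.ne', ENNReal.rpow_one, mul_one_div] at h3
      exact h3
  rw [stamQuot, hA', ENNReal.ofReal_rpow_of_pos hA]
  refine (mul_le_mul_right hF _).trans_eq ?_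
  rw [← ENNReal.ofReal_mul (Real.rpow_nonneg hA.le _)]
  congr 1
  have e : A ^ (b / s) * K = m ^ (b / s) := by
    have : 1 / ρ = -(b / s) := by rw [hρ]; field_simp
    rw [hK, this, Real.rpow_neg (div_pos hA hm0).le, Real.div_rpow hA.le hm0.le, inv_div]
    have := (Real.rpow_pos_of_pos hA (b / s)).ne'
    field_simp
  rw [← e]
  ring

section escort

/-- The variable `y(x) = ∫_0^x h^{1-e}` of the differential-escort transformation. -/
def escortVar (e : ℝ) (h : ℝ → ℝ) (x : ℝ) : ℝ := ∫ t in (0 : ℝ)..x, h t ^ (1 - e)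

/-- A density that is continuous, unimodal with mode `0`, positive at `0`, with compact
superlevel sets and differentiable away from `0` on its support. -/
structure IsUnimodalProfile (h : ℝ → ℝ) : Prop extends IsDensity h where
  continuous : Continuous h
  zero_mem : (0 : ℝ) ∈ Function.support h
  anti : ∀ x z : ℝ, |z| ≤ |x| → h x ≤ h z
  isCompact_superlevel : ∀ c, 0 < c → IsCompact {z | c ≤ h z}
  differentiableAt : ∀ z ∈ Function.support h, z ≠ 0 → DifferentiableAt ℝ h z

variable {e : ℝ} {h : ℝ → ℝ}

namespace IsUnimodalProfile

theorem continuousOn_rpow (hh : IsUnimodalProfile h) (c : ℝ) :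
    ContinuousOn (fun z => h z ^ c) (Function.support h) :=
  hh.continuous.continuousOn.rpow_const fun _ hx => Or.inl hx

theorem hasDerivAt_escortVar (hh : IsUnimodalProfile h) {z : ℝ} (hz : z ∈ Function.support h) :
    HasDerivAt (escortVar e h) (h z ^ (1 - e)) z := by
  have hsub : uIcc 0 z ⊆ Function.support h := hh.ordConnected_support.uIcc_subset hh.zero_mem hz
  refine intervalIntegral.integral_hasDerivAt_right
    ((hh.continuousOn_rpow (1 - e)).mono hsub).intervalIntegrable ?_ ?_
  · exact (hh.continuousOn_rpow (1 - e)).stronglyMeasurableAtFilter hh.isOpen_support z hz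
  · exact (hh.continuousOn_rpow (1 - e)).continuousAt (hh.isOpen_support.mem_nhds hz)

theorem continuousOn_escortVar (hh : IsUnimodalProfile h) :
    ContinuousOn (escortVar e h) (Function.support h) := fun _ hz =>
  (hh.hasDerivAt_escortVar hz).continuousAt.continuousWithinAt

theorem strictMonoOn_escortVar (hh : IsUnimodalProfile h) :
    StrictMonoOn (escortVar e h) (Function.support h) := by
  refine strictMonoOn_of_deriv_pos hh.convex hh.continuousOn_escortVar fun z hz => ?_
  have hz := interior_subset hz
  rw [(hh.hasDerivAt_escortVar hz).deriv]
  exact Real.rpow_pos_of_pos (hh.pos hz) _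

theorem escortVar_zero : escortVar e h 0 = 0 := by simp [escortVar]

theorem escort_apply (hh : IsUnimodalProfile h) {z : ℝ} (hz : z ∈ Function.support h) :
    escort e h (escortVar e h z) = h z ^ e :=
  reparam_apply _ hh.strictMonoOn_escortVar.injOn hz

theorem support_escort (hh : IsUnimodalProfile h) :
    Function.support (escort e h) = escortVar e h '' Function.support h := by
  have := support_reparam (v := fun x => h x ^ e) (hh.strictMonoOn_escortVar (e := e)).injOn
  rw [inter_eq_left.2] at this
  · exact this
  · exact fun z hz => (Real.rpow_pos_of_pos (hh.pos hz) _).ne'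

theorem escort_nonneg (hh : IsUnimodalProfile h) (y : ℝ) : 0 ≤ escort e h y :=
  reparam_nonneg hh.strictMonoOn_escortVar.injOn
    (fun z _ => Real.rpow_nonneg (hh.nonneg z) _) y

theorem lintegral_escort (hh : IsUnimodalProfile h) (Φ : ℝ → ℝ≥0∞) :
    ∫⁻ x in Function.support (escort e h), Φ x
      = ∫⁻ z in Function.support h, ENNReal.ofReal (h z ^ (1 - e)) * Φ (escortVar e h z) := by
  rw [hh.support_escort, lintegral_image_eq_lintegral_abs_deriv_mul
    hh.isOpen_support.measurableSet
    (fun x hx => (hh.hasDerivAt_escortVar hx).hasDerivWithinAt) hh.strictMonoOn_escortVar.injOn]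
  refine setLIntegral_congr_fun hh.isOpen_support.measurableSet fun z _ => ?_
  rw [abs_of_nonneg (Real.rpow_nonneg (hh.nonneg z) _)]

theorem powInt_escort (hh : IsUnimodalProfile h) (c : ℝ) :
    powInt c (escort e h) = powInt (1 - e + e * c) h := by
  rw [powInt, hh.lintegral_escort, powInt]
  refine setLIntegral_congr_fun hh.isOpen_support.measurableSet fun z hz => ?_
  rw [hh.escort_apply hz, ← ENNReal.ofReal_mul (Real.rpow_nonneg (hh.nonneg z) _),
    ← Real.rpow_mul (hh.nonneg z), ← Real.rpow_add (hh.pos hz)]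

theorem isDensity_escort (hh : IsUnimodalProfile h) : IsDensity (escort e h) where
  nonneg := hh.escort_nonneg
  isOpen_support := by
    rw [hh.support_escort]
    exact isOpen_image_of_strictMonoOn hh.isOpen_support hh.continuousOn_escortVar
      hh.strictMonoOn_escortVar
  ordConnected_support := by
    rw [hh.support_escort]
    exact ordConnected_image hh.ordConnected_support hh.continuousOn_escortVar
  lintegral_eq_one := by
    have := hh.powInt_escort (e := e) 1
    simp only [powInt, Real.rpow_one, setLIntegral_support_ofReal] at this
    rw [this]
    simp only [mul_one, sub_add_cancel, Real.rpow_one, setLIntegral_support_ofReal]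
    exact hh.lintegral_eq_one

theorem invFunOn_escortVar (hh : IsUnimodalProfile h) {z : ℝ} (hz : z ∈ Function.support h) :
    Function.invFunOn (escortVar e h) (Function.support h) (escortVar e h z) = z :=
  hh.strictMonoOn_escortVar.injOn.leftInvOn_invFunOn hz

theorem escort_eventuallyEq (hh : IsUnimodalProfile h) {z : ℝ} (hz : z ∈ Function.support h) :
    escort e h =ᶠ[𝓝 (escortVar e h z)] fun y =>
      h (Function.invFunOn (escortVar e h) (Function.support h) y) ^ e := by
  have ho := hh.isDensity_escort (e := e) |>.isOpen_support
  rw [hh.support_escort] at ho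
  filter_upwards [ho.mem_nhds (mem_image_of_mem _ hz)] with y hy
  obtain ⟨x, hx, rfl⟩ := hy
  rw [hh.escort_apply hx, hh.invFunOn_escortVar hx]

theorem hasDerivAt_escort (hh : IsUnimodalProfile h) {z d : ℝ} (hz : z ∈ Function.support h)
    (hd : HasDerivAt h d z) :
    HasDerivAt (escort e h) (e * d * h z ^ (2 * e - 2)) (escortVar e h z) := by
  have hpos := hh.pos hz
  have h1 := hasDerivAt_invFunOn hh.isOpen_support hh.continuousOn_escortVar
    hh.strictMonoOn_escortVar hz (hh.hasDerivAt_escortVar (e := e) hz)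
    (Real.rpow_pos_of_pos hpos _).ne'
  have h2 : HasDerivAt h d
      (Function.invFunOn (escortVar e h) (Function.support h) (escortVar e h z)) := by
    rwa [hh.invFunOn_escortVar hz]
  have h3 := (h2.comp _ h1).rpow_const (p := e)
    (Or.inl (by simpa [hh.invFunOn_escortVar hz] using hpos.ne'))
  refine (h3.congr_of_eventuallyEq (hh.escort_eventuallyEq hz)).congr_deriv ?_
  simp only [Function.comp_apply, hh.invFunOn_escortVar hz]
  rw [← Real.rpow_neg hpos.le, show 2 * e - 2 = -(1 - e) + (e - 1) by ring, Real.rpow_add hpos]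
  ring

theorem continuousOn_escort (hh : IsUnimodalProfile h) :
    ContinuousOn (escort e h) (Function.support (escort e h)) := by
  intro y hy
  rw [hh.support_escort] at hy
  obtain ⟨z, hz, rfl⟩ := hy
  have h1 := continuousAt_invFunOn hh.isOpen_support hh.continuousOn_escortVar
    (hh.strictMonoOn_escortVar (e := e)) hz
  have h2 : ContinuousAt h
      (Function.invFunOn (escortVar e h) (Function.support h) (escortVar e h z)) :=
    hh.continuous.continuousAt
  have h3 := (ContinuousAt.comp (f := Function.invFunOn (escortVar e h) (Function.support h))
    h2 h1).rpow_const (p := e) (Or.inl (by simpa [hh.invFunOn_escortVar hz] using (hh.pos hz).ne'))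
  exact (h3.congr_of_eventuallyEq (hh.escort_eventuallyEq hz)).continuousWithinAt

theorem fisher_escort (hh : IsUnimodalProfile h) {p : ℝ} (hp : 0 ≤ p) (b : ℝ) :
    fisher p b (escort e h) = ENNReal.ofReal |e| ^ p * fisher p (e * b) h := by
  rw [fisher, hh.lintegral_escort, fisher, ← lintegral_const_mul' _ _ (by simp [hp])]
  refine setLIntegral_congr_fun_ae hh.isOpen_support.measurableSet ?_
  filter_upwards [(compl_mem_ae_iff.2 (measure_singleton (0 : ℝ)))] with z hz0 hz
  have hpos := hh.pos hz
  rw [(hh.hasDerivAt_escort hz (hh.differentiableAt z hz hz0).hasDerivAt).deriv,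
    hh.escort_apply hz]
  have h1 : (h z ^ e) ^ (b - 2) * (e * deriv h z * h z ^ (2 * e - 2))
      = e * (h z ^ (e * b - 2) * deriv h z) := by
    rw [← Real.rpow_mul hpos.le, show e * b - 2 = e * (b - 2) + (2 * e - 2) by ring,
      Real.rpow_add hpos]
    ring
  rw [h1, abs_mul, ENNReal.ofReal_mul (abs_nonneg _), ENNReal.mul_rpow_of_nonneg _ _ hp,
    mul_comm, mul_assoc, mul_assoc, ← ENNReal.ofReal_mul (Real.rpow_nonneg hpos.le _),
    ← Real.rpow_add hpos]
  simp only [add_sub_cancel, Real.rpow_one]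

theorem tendsto_invFunOn (hh : IsUnimodalProfile h) {y : ℝ} (hy : y ∉ Function.support (escort e h)) :
    Tendsto (fun x => h (Function.invFunOn (escortVar e h) (Function.support h) x))
      (𝓝[Function.support (escort e h)] y) (𝓝[>] 0) := by
  rw [hh.support_escort] at *
  refine tendsto_nhdsWithin_iff.2 ⟨?_, ?_⟩
  · rw [Metric.tendsto_nhds]
    intro c hc
    have hK : IsCompact (escortVar e h '' {z | c ≤ h z}) :=
      (hh.isCompact_superlevel c hc).image_of_continuousOn
        (hh.continuousOn_escortVar.mono fun z (hz : c ≤ h z) => (hc.trans_le hz).ne')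
    have hyK : y ∉ escortVar e h '' {z | c ≤ h z} := fun hmem =>
      hy (image_mono (fun z (hz : c ≤ h z) => (hc.trans_le hz).ne') hmem)
    filter_upwards [self_mem_nhdsWithin,
      mem_nhdsWithin_of_mem_nhds (hK.isClosed.isOpen_compl.mem_nhds hyK)] with x hx hxK
    obtain ⟨z, hz, rfl⟩ := hx
    rw [hh.invFunOn_escortVar hz, Real.dist_0_eq_abs, abs_of_pos (hh.pos hz)]
    by_contra! hcon
    exact hxK ⟨z, hcon, rfl⟩
  · filter_upwards [self_mem_nhdsWithin] with x hx
    obtain ⟨z, hz, rfl⟩ := hx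
    rw [hh.invFunOn_escortVar hz]
    exact hh.pos hz

theorem continuous_escort (hh : IsUnimodalProfile h) (he : 0 < e) : Continuous (escort e h) := by
  rw [continuous_iff_continuousAt]
  intro y
  by_cases hy : y ∈ Function.support (escort e h)
  · exact hh.continuousOn_escort.continuousAt (hh.isDensity_escort.isOpen_support.mem_nhds hy)
  have hy0 : escort e h y = 0 := by simpa using hy
  rw [ContinuousAt, hy0, ← nhdsWithin_univ, ← union_compl_self (Function.support (escort e h)),
    nhdsWithin_union, tendsto_sup]
  constructor
  · have h1 := (hh.tendsto_invFunOn hy).mono_right nhdsWithin_le_nhds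
    have h2 := h1.rpow_const (p := e) (Or.inr he.le)
    rw [Real.zero_rpow he.ne'] at h2
    refine h2.congr' ?_
    filter_upwards [self_mem_nhdsWithin] with x hx
    rw [hh.support_escort] at hx
    obtain ⟨z, hz, rfl⟩ := hx
    rw [hh.escort_apply hz, hh.invFunOn_escortVar hz]
  · refine tendsto_const_nhds.congr' ?_
    filter_upwards [self_mem_nhdsWithin] with x hx
    simpa [eq_comm] using hx

theorem tendsto_escort_atTop (hh : IsUnimodalProfile h) (he : e < 0) {y : ℝ}
    (hy : y ∉ Function.support (escort e h)) :
    Tendsto (escort e h) (𝓝[Function.support (escort e h)] y) atTop := by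
  have h2 := (tendsto_rpow_neg_nhdsGT_zero he).comp (hh.tendsto_invFunOn hy)
  refine h2.congr' ?_
  filter_upwards [self_mem_nhdsWithin] with x hx
  rw [hh.support_escort] at hx
  obtain ⟨z, hz, rfl⟩ := hx
  simp only [Function.comp_apply]
  rw [hh.escort_apply hz, hh.invFunOn_escortVar hz]

theorem mem_support_escort (hh : IsUnimodalProfile h) {y : ℝ}
    (hy : y ∈ Function.support (escort e h)) :
    ∃ z ∈ Function.support h, escortVar e h z = y := by
  rwa [hh.support_escort] at hy

theorem zero_mem_support_escort (hh : IsUnimodalProfile h) :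
    (0 : ℝ) ∈ Function.support (escort e h) := by
  rw [hh.support_escort]
  exact ⟨0, hh.zero_mem, escortVar_zero⟩

theorem escort_le_of_between (hh : IsUnimodalProfile h) (he : 0 ≤ e) {x y : ℝ}
    (hxy : 0 ≤ x ∧ x ≤ y ∨ y ≤ x ∧ x ≤ 0) : escort e h y ≤ escort e h x := by
  by_cases hy : y ∈ Function.support (escort e h)
  · have hx : x ∈ Function.support (escort e h) := by
      have := hh.isDensity_escort (e := e) |>.ordConnected_support
      rcases hxy with hxy | hxy
      · exact this.out hh.zero_mem_support_escort hy hxy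
      · exact this.out hy hh.zero_mem_support_escort hxy
    obtain ⟨a, ha, rfl⟩ := hh.mem_support_escort hx
    obtain ⟨z, hz, rfl⟩ := hh.mem_support_escort hy
    rw [hh.escort_apply ha, hh.escort_apply hz]
    refine Real.rpow_le_rpow (hh.nonneg _) (hh.anti _ _ ?_) he
    have hm := hh.strictMonoOn_escortVar (e := e)
    have h0 := escortVar_zero (e := e) (h := h)
    rcases hxy with ⟨h1, h2⟩ | ⟨h1, h2⟩
    · rw [← h0, hm.le_iff_le hh.zero_mem ha] at h1
      rw [hm.le_iff_le ha hz] at h2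
      rwa [abs_of_nonneg h1, abs_of_nonneg (h1.trans h2)]
    · rw [← h0, hm.le_iff_le ha hh.zero_mem] at h2
      rw [hm.le_iff_le hz ha] at h1
      rw [abs_of_nonpos h2, abs_of_nonpos (h1.trans h2)]
      linarith
  · have : escort e h y = 0 := by simpa using hy
    rw [this]
    exact hh.escort_nonneg x

theorem le_escort_of_between (hh : IsUnimodalProfile h) (he : e ≤ 0) {x y : ℝ}
    (hy : y ∈ Function.support (escort e h))
    (hxy : 0 ≤ x ∧ x ≤ y ∨ y ≤ x ∧ x ≤ 0) : escort e h x ≤ escort e h y := by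
  have hx : x ∈ Function.support (escort e h) := by
    have := hh.isDensity_escort (e := e) |>.ordConnected_support
    rcases hxy with hxy | hxy
    · exact this.out hh.zero_mem_support_escort hy hxy
    · exact this.out hy hh.zero_mem_support_escort hxy
  obtain ⟨a, ha, rfl⟩ := hh.mem_support_escort hx
  obtain ⟨z, hz, rfl⟩ := hh.mem_support_escort hy
  rw [hh.escort_apply ha, hh.escort_apply hz]
  refine Real.rpow_le_rpow_of_nonpos (hh.pos hz) (hh.anti _ _ ?_) he
  have hm := hh.strictMonoOn_escortVar (e := e)
  have h0 := escortVar_zero (e := e) (h := h)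
  rcases hxy with ⟨h1, h2⟩ | ⟨h1, h2⟩
  · rw [← h0, hm.le_iff_le hh.zero_mem ha] at h1
    rw [hm.le_iff_le ha hz] at h2
    rwa [abs_of_nonneg h1, abs_of_nonneg (h1.trans h2)]
  · rw [← h0, hm.le_iff_le ha hh.zero_mem] at h2
    rw [hm.le_iff_le hz ha] at h1
    rw [abs_of_nonpos h2, abs_of_nonpos (h1.trans h2)]
    linarith

theorem differentiableAt_escort (hh : IsUnimodalProfile h) {y : ℝ}
    (hy : y ∈ Function.support (escort e h)) (hy0 : y ≠ 0) :
    DifferentiableAt ℝ (escort e h) y := by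
  obtain ⟨z, hz, rfl⟩ := hh.mem_support_escort hy
  have hz0 : z ≠ 0 := by
    rintro rfl
    exact hy0 escortVar_zero
  exact (hh.hasDerivAt_escort hz (hh.differentiableAt z hz hz0).hasDerivAt).differentiableAt

end IsUnimodalProfile

/-- The frontier of an open interval is countable. -/
theorem countable_frontier_of_ordConnected {S : Set ℝ} (hS : S.OrdConnected) (ho : IsOpen S) :
    (frontier S).Countable := by
  rcases S.eq_empty_or_nonempty with rfl | ⟨x, hx⟩
  · simp
  have h1 : (frontier S ∩ Ioi x).Subsingleton := by
    intro a ha c hc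
    by_contra hne
    wlog hlt : a < c generalizing a c
    · exact this hc ha (Ne.symm hne) (lt_of_le_of_ne (not_lt.1 hlt) (Ne.symm hne))
    obtain ⟨z, hz, hzS⟩ := mem_closure_iff.1 hc.1.1 (Ioi a) isOpen_Ioi hlt
    exact ha.1.2 (by rw [ho.interior_eq]; exact hS.out hx hzS ⟨(mem_Ioi.1 ha.2).le, (mem_Ioi.1 hz).le⟩)
  have h2 : (frontier S ∩ Iio x).Subsingleton := by
    intro a ha c hc
    by_contra hne
    wlog hlt : a < c generalizing a c
    · exact this hc ha (Ne.symm hne) (lt_of_le_of_ne (not_lt.1 hlt) (Ne.symm hne))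
    obtain ⟨z, hz, hzS⟩ := mem_closure_iff.1 ha.1.1 (Iio c) isOpen_Iio hlt
    exact hc.1.2 (by rw [ho.interior_eq]; exact hS.out hzS hx ⟨(mem_Iio.1 hz).le, (mem_Iio.1 hc.2).le⟩)
  refine ((h1.countable.union h2.countable).union (countable_singleton x)).mono fun a ha => ?_
  rcases lt_trichotomy a x with h | h | h
  · exact Or.inl (Or.inr ⟨ha, h⟩)
  · exact Or.inr h
  · exact Or.inl (Or.inl ⟨ha, h⟩)

/-- A nonnegative continuous function, increasing then decreasing, differentiable inside its
support off a countable set, is absolutely continuous. -/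
theorem locallyAC_univ_of_unimodal {f : ℝ → ℝ} {s : Set ℝ} (hc : Continuous f)
    (ho : (Function.support f).OrdConnected) (hs : s.Countable)
    (hd : ∀ x ∈ Function.support f \ s, DifferentiableAt ℝ f x)
    (h1 : MonotoneOn f (Iic 0)) (h2 : AntitoneOn f (Ici 0)) : LocallyAC f univ := by
  have hopen : IsOpen (Function.support f) := hc.isOpen_support
  intro a b hab _
  refine absolutelyContinuousOnInterval_of_unimodal (c := 0)
    (s := s ∪ frontier (Function.support f)) hab
    (hs.union (countable_frontier_of_ordConnected ho hopen)) hc.continuousOn ?_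
    (Or.inl (h1.mono inter_subset_right)) (Or.inr (h2.mono inter_subset_right))
  rintro x ⟨-, hx⟩
  by_cases hxs : x ∈ Function.support f
  · exact hd x ⟨hxs, fun h => hx (Or.inl h)⟩
  · have hx' : x ∉ closure (Function.support f) := fun h =>
      hx (Or.inr ⟨h, by rwa [hopen.interior_eq]⟩)
    have : f =ᶠ[𝓝 x] fun _ => 0 := by
      filter_upwards [isClosed_closure.isOpen_compl.mem_nhds hx'] with y hy
      by_contra h
      exact hy (subset_closure h)
    exact (differentiableAt_const 0).congr_of_eventuallyEq this

variable {e : ℝ} {h : ℝ → ℝ}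

namespace IsUnimodalProfile

theorem locallyAC_escort_of_pos (hh : IsUnimodalProfile h) (he : 0 < e) :
    LocallyAC (escort e h) univ :=
  locallyAC_univ_of_unimodal (s := {0}) (hh.continuous_escort he)
    hh.isDensity_escort.ordConnected_support (countable_singleton 0)
    (fun _ hx => hh.differentiableAt_escort hx.1 hx.2)
    (fun _ _ _ hy hxy => hh.escort_le_of_between he.le (Or.inr ⟨hxy, hy⟩))
    (fun _ hx _ _ hxy => hh.escort_le_of_between he.le (Or.inl ⟨hx, hxy⟩))

theorem locallyAC_escort_of_neg (hh : IsUnimodalProfile h) (he : e < 0) :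
    LocallyAC (escort e h) (Function.support (escort e h)) := by
  intro a b hab hsub
  refine absolutelyContinuousOnInterval_of_unimodal (c := 0) (s := {0}) hab
    (countable_singleton 0) (hh.continuousOn_escort.mono hsub)
    (fun x hx => hh.differentiableAt_escort (hsub (Ioo_subset_Icc_self hx.1)) hx.2)
    (Or.inr ?_) (Or.inl ?_)
  · intro x hx y hy hxy
    exact hh.le_escort_of_between he.le (hsub hx.1) (Or.inr ⟨hxy, hy.2⟩)
  · intro x hx y hy hxy
    exact hh.le_escort_of_between he.le (hsub hy.1) (Or.inl ⟨hx.2, hxy⟩)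

end IsUnimodalProfile

end escort

section gaussianProfile

variable {ρ μ : ℝ}

theorem hasDerivAt_gaussian (hρ : 0 < ρ) (hμ : μ ≠ 1) {z : ℝ} (hz : 0 < z)
    (h : 0 < tsallisBase ρ μ z) :
    HasDerivAt (gaussian ρ μ)
      (-(ρ * z ^ (ρ - 1) * tsallisBase ρ μ z ^ (1 / (μ - 1) - 1)) / (2 * tsallisMass ρ μ)) z := by
  have h1 := (tsallisBase_rpow_hasDerivAt hρ hz h (1 / (μ - 1))).div_const (2 * tsallisMass ρ μ)
  have h2 : gaussian ρ μ = fun z => tsallisBase ρ μ z ^ (1 / (μ - 1)) / (2 * tsallisMass ρ μ) :=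
    funext fun z => gaussian_eq hμ z
  rw [h2]
  refine h1.congr_deriv ?_
  have : μ - 1 ≠ 0 := sub_ne_zero.2 hμ
  field_simp

theorem gaussian_rpow_mul_abs_deriv (hρ : 0 < ρ) (hμ : μ ≠ 1) (hμρ : 1 / (1 + ρ) < μ) {z : ℝ}
    (hz : z ≠ 0) (h : z ∈ Function.support (gaussian ρ μ)) :
    |gaussian ρ μ z ^ (μ - 2) * deriv (gaussian ρ μ) z|
      = (2 * tsallisMass ρ μ) ^ (1 - μ) * ρ * |z| ^ (ρ - 1) := by
  wlog hz0 : 0 < z generalizing z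
  · have h1 : gaussian ρ μ = fun x => gaussian ρ μ (-x) := funext fun x => (gaussian_neg x).symm
    have h2 : deriv (gaussian ρ μ) z = -deriv (gaussian ρ μ) (-z) := by
      conv_lhs => rw [h1]
      exact deriv_comp_neg _ _
    have h3 := this (z := -z) (neg_ne_zero.2 hz)
      (by rwa [Function.mem_support, gaussian_neg])
      (neg_pos.2 (lt_of_le_of_ne (not_lt.1 hz0) hz))
    rw [h2, mul_neg, abs_neg, ← gaussian_neg z, h3, abs_neg]
  have hb := (gaussian_pos_iff hρ hμ hμρ z).1 h
  have hI := tsallisMass_pos hρ hμ hμρ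
  have hzp := Real.rpow_pos_of_pos hz0 (ρ - 1)
  rw [(hasDerivAt_gaussian hρ hμ hz0 hb).deriv, neg_div, mul_neg, abs_neg, gaussian_eq hμ,
    tsallis, abs_of_pos (by positivity), abs_of_pos hz0,
    Real.div_rpow (by positivity) (by positivity), ← Real.rpow_mul hb.le]
  have h1 : tsallisBase ρ μ z ^ (1 / (μ - 1) * (μ - 2)) * tsallisBase ρ μ z ^ (1 / (μ - 1) - 1) = 1 := by
    rw [← Real.rpow_add hb]
    have : μ - 1 ≠ 0 := sub_ne_zero.2 hμ
    rw [show 1 / (μ - 1) * (μ - 2) + (1 / (μ - 1) - 1) = 0 by field_simp; ring, Real.rpow_zero]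
  have h2 : (2 * tsallisMass ρ μ) ^ (1 - μ)
      = ((2 * tsallisMass ρ μ) ^ (μ - 2))⁻¹ * (2 * tsallisMass ρ μ)⁻¹ := by
    rw [← Real.rpow_neg (by positivity), ← Real.rpow_neg_one (2 * tsallisMass ρ μ),
      ← Real.rpow_add (by positivity)]
    congr 1; ring
  rw [h2]
  linear_combination (((2 * tsallisMass ρ μ) ^ (μ - 2))⁻¹ * (2 * tsallisMass ρ μ)⁻¹ * ρ
    * z ^ (ρ - 1)) * h1

theorem isUnimodalProfile_gaussian (hρ : 0 < ρ) (hμ : μ ≠ 1) (hμρ : 1 / (1 + ρ) < μ) :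
    IsUnimodalProfile (gaussian ρ μ) where
  toIsDensity := isDensity_gaussian hρ hμ hμρ
  continuous := continuous_gaussian hρ hμ
  zero_mem := zero_mem_support_gaussian hρ hμ hμρ
  anti _ _ hxz := gaussian_anti hρ hμ hμρ hxz
  isCompact_superlevel c hc := by
    refine Metric.isCompact_of_isClosed_isBounded
      (isClosed_le continuous_const (continuous_gaussian hρ hμ)) ?_
    refine (Metric.isBounded_Icc (-(1 / (2 * c))) (1 / (2 * c))).subset fun z (hz : c ≤ _) => ?_
    rw [mem_Icc, ← abs_le]
    have h1 : ∫⁻ _ in Icc (-|z|) |z|, ENNReal.ofReal c ≤ 1 := by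
      rw [← (isDensity_gaussian hρ hμ hμρ).lintegral_eq_one]
      refine (setLIntegral_mono' measurableSet_Icc fun x hx => ?_).trans
        (setLIntegral_le_lintegral _ _)
      exact ENNReal.ofReal_le_ofReal (hz.trans (gaussian_anti hρ hμ hμρ (abs_le.2 hx)))
    rw [setLIntegral_const, Real.volume_Icc, ← ENNReal.ofReal_mul hc.le, ENNReal.ofReal_le_one] at h1
    rw [le_div_iff₀ (by positivity)]
    linarith
  differentiableAt z hz hz0 := by
    rcases lt_or_gt_of_ne hz0 with hz1 | hz1
    · have h1 : gaussian ρ μ = fun x => gaussian ρ μ (-x) := funext fun x => (gaussian_neg x).symm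
      have h2 := (hasDerivAt_gaussian hρ hμ (neg_pos.2 hz1)
        ((gaussian_pos_iff hρ hμ hμρ (-z)).1 (by rwa [Function.mem_support, gaussian_neg])))
      rw [h1]
      exact (h2.scomp z (hasDerivAt_neg z)).differentiableAt
    · exact (hasDerivAt_gaussian hρ hμ hz1 ((gaussian_pos_iff hρ hμ hμρ z).1 hz)).differentiableAt

theorem fisher_gaussian (hρ : 0 < ρ) (hμ : μ ≠ 1) (hμρ : 1 / (1 + ρ) < μ) {p : ℝ} (hp : 0 ≤ p)
    (hpρ : (ρ - 1) * p = ρ) :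
    fisher p μ (gaussian ρ μ) = ENNReal.ofReal ((2 * tsallisMass ρ μ) ^ (1 - μ) * ρ) ^ p *
      ENNReal.ofReal (tsallisMoment ρ μ) := by
  have hI := tsallisMass_pos hρ hμ hμρ
  rw [← lintegral_moment_support_gaussian hρ hμ hμρ, fisher,
    ← lintegral_const_mul' _ _ (by simp [hp])]
  refine setLIntegral_congr_fun_ae (isDensity_gaussian hρ hμ hμρ).isOpen_support.measurableSet ?_
  filter_upwards [(compl_mem_ae_iff.2 (measure_singleton (0 : ℝ)))] with z hz0 hz
  have hz0' : 0 < |z| := abs_pos.2 hz0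
  rw [gaussian_rpow_mul_abs_deriv hρ hμ hμρ hz0 hz, ENNReal.ofReal_mul (by positivity),
    ENNReal.mul_rpow_of_nonneg _ _ hp, mul_assoc, ENNReal.ofReal_rpow_of_pos (x := |z| ^ (ρ - 1))
    (by positivity), ← Real.rpow_mul hz0'.le, hpρ, ENNReal.ofReal_rpow_of_pos hz0']

end gaussianProfile

section classicalMinimizer

variable {p b s : ℝ}

theorem classical_exponents (hp : 1 < p) (hb : b ≠ 0) (hs : s ≠ 0) (hθ : 0 < b * (b + s))
    (hsb : s / b < p / (p - 1)) : 0 < p / (p - 1) ∧ b / (b + s) ≠ 1 ∧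
      1 / (1 + p / (p - 1)) < b / (b + s) ∧ 0 < b / (b + s) := by
  have hθ0 : b + s ≠ 0 := right_ne_zero_of_mul hθ.ne'
  have h1 : 0 < 1 + s / b := by
    have : 1 + s / b = b * (b + s) / b ^ 2 := by field_simp
    rw [this]; positivity
  have h2 : b / (b + s) = 1 / (1 + s / b) := by field_simp
  refine ⟨div_pos (by linarith) (by linarith), fun h => ?_, ?_, ?_⟩
  · rw [div_eq_one_iff_eq hθ0] at h
    exact hs (by linarith)
  · rw [h2]
    exact one_div_lt_one_div_of_lt h1 (by linarith)
  · rw [h2]; positivity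

theorem stamMinimizer_of_one_lt (hp : 1 < p) : stamMinimizer p b (1 - s)
    = escort (1 / (b + s)) (gaussian (p / (p - 1)) (b / (b + s))) := by
  have : 1 + b - (1 - s) = b + s := by ring
  rw [stamMinimizer, if_pos hp, this]

theorem isUnimodalProfile_classical (hp : 1 < p) (hb : b ≠ 0) (hs : s ≠ 0) (hθ : 0 < b * (b + s))
    (hsb : s / b < p / (p - 1)) : IsUnimodalProfile (gaussian (p / (p - 1)) (b / (b + s))) := by
  obtain ⟨h1, h2, h3, -⟩ := classical_exponents hp hb hs hθ hsb
  exact isUnimodalProfile_gaussian h1 h2 h3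

theorem powInt_stamMinimizer_of_one_lt (hp : 1 < p) (hb : b ≠ 0) (hs : s ≠ 0)
    (hθ : 0 < b * (b + s)) (hsb : s / b < p / (p - 1)) :
    powInt (1 - s) (stamMinimizer p b (1 - s))
      = powInt (b / (b + s)) (gaussian (p / (p - 1)) (b / (b + s))) := by
  have hθ0 : b + s ≠ 0 := right_ne_zero_of_mul hθ.ne'
  rw [stamMinimizer_of_one_lt hp, (isUnimodalProfile_classical hp hb hs hθ hsb).powInt_escort]
  congr 1
  field_simp
  ring

theorem fisher_stamMinimizer_of_one_lt (hp : 1 < p) (hb : b ≠ 0) (hs : s ≠ 0)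
    (hθ : 0 < b * (b + s)) (hsb : s / b < p / (p - 1)) :
    fisher p b (stamMinimizer p b (1 - s)) ^ (1 / p)
      = ENNReal.ofReal (|1 / (b + s)| *
        ((2 * tsallisMass (p / (p - 1)) (b / (b + s))) ^ (1 - b / (b + s)) * (p / (p - 1)))
        * tsallisMoment (p / (p - 1)) (b / (b + s)) ^ (1 / p)) := by
  have hθ0 : b + s ≠ 0 := right_ne_zero_of_mul hθ.ne'
  obtain ⟨h1, h2, h3, -⟩ := classical_exponents hp hb hs hθ hsb
  have hp0 : 0 < p := by linarith
  have hp1 : p - 1 ≠ 0 := by linarith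
  have hI := tsallisMass_pos h1 h2 h3
  have hm := tsallisMoment_pos h1 h2 h3
  have hθ' : 0 < |1 / (b + s)| := abs_pos.2 (one_div_ne_zero hθ0)
  rw [stamMinimizer_of_one_lt hp, (isUnimodalProfile_classical hp hb hs hθ hsb).fisher_escort hp0.le,
    one_div_mul_eq_div, fisher_gaussian h1 h2 h3 hp0.le (by field_simp; ring),
    ENNReal.mul_rpow_of_nonneg _ _ (by positivity), ENNReal.mul_rpow_of_nonneg _ _ (by positivity),
    ← ENNReal.rpow_mul, ← ENNReal.rpow_mul, mul_one_div_cancel hp0.ne', ENNReal.rpow_one,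
    ENNReal.rpow_one, ENNReal.ofReal_rpow_of_pos hm, ← ENNReal.ofReal_mul (by positivity),
    ← ENNReal.ofReal_mul (by positivity)]
  congr 1
  ring

theorem stamQuot_stamMinimizer_of_one_lt (hp : 1 < p) (hb : b ≠ 0) (hs : s ≠ 0)
    (hθ : 0 < b * (b + s)) (hsb : s / b < p / (p - 1)) :
    powInt (b / (b + s)) (gaussian (p / (p - 1)) (b / (b + s))) ^ ((b + s) / s)
      = ENNReal.ofReal |b| *
        ENNReal.ofReal (tsallisMoment (p / (p - 1)) (b / (b + s))) ^ ((p - 1) / p) *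
        stamQuot p b s (stamMinimizer p b (1 - s)) := by
  have hθ0 : b + s ≠ 0 := right_ne_zero_of_mul hθ.ne'
  obtain ⟨h1, h2, h3, h4⟩ := classical_exponents hp hb hs hθ hsb
  have hp0 : 0 < p := by linarith
  have hI := tsallisMass_pos h1 h2 h3
  have hm := tsallisMoment_pos h1 h2 h3
  have hb' : 0 < |b| := abs_pos.2 hb
  have hq := one_sub_tsallisMoment_eq h1 h2 h3
  rw [stamQuot, powInt_stamMinimizer_of_one_lt hp hb hs hθ hsb,
    fisher_stamMinimizer_of_one_lt hp hb hs hθ hsb, powInt_gaussian h1 h2 h3, hq]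
  set I0 := tsallisMass (p / (p - 1)) (b / (b + s))
  set m := tsallisMoment (p / (p - 1)) (b / (b + s))
  set K := (2 * I0) ^ (1 - b / (b + s))
  have hK : 0 < K := Real.rpow_pos_of_pos (by positivity) _
  have hQ : 0 < K * (b / (b + s) * (p / (p - 1)) * m) := by positivity
  rw [ENNReal.ofReal_rpow_of_pos hQ, ENNReal.ofReal_rpow_of_pos hQ, ENNReal.ofReal_rpow_of_pos hm,
    ← ENNReal.ofReal_mul (by positivity), ← ENNReal.ofReal_mul (by positivity),
    ← ENNReal.ofReal_mul (by positivity)]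
  congr 1
  have e1 : (b + s) / s = b / s + 1 := by field_simp
  have e2 : m = m ^ ((p - 1) / p) * m ^ (1 / p) := by
    rw [← Real.rpow_add hm, ← add_div, sub_add_cancel, div_self hp0.ne', Real.rpow_one]
  have e3 : |b| * |1 / (b + s)| = b / (b + s) := by
    rw [← abs_mul, mul_one_div, abs_of_pos h4]
  rw [e1, Real.rpow_add_one hQ.ne', ← e3]
  set X := (K * (|b| * |1 / (b + s)| * (p / (p - 1)) * m)) ^ (b / s)
  linear_combination (X * K * |b| * |1 / (b + s)| * (p / (p - 1))) * e2

theorem stamMinimizer_finite_of_one_lt (hp : 1 < p) (hb : b ≠ 0) (hs : s ≠ 0)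
    (hθ : 0 < b * (b + s)) (hsb : s / b < p / (p - 1)) :
    (powInt (1 - s) (stamMinimizer p b (1 - s)) ≠ 0 ∧
      powInt (1 - s) (stamMinimizer p b (1 - s)) ≠ ∞) ∧
    fisher p b (stamMinimizer p b (1 - s)) ≠ 0 ∧ fisher p b (stamMinimizer p b (1 - s)) ≠ ∞ := by
  have hθ0 : b + s ≠ 0 := right_ne_zero_of_mul hθ.ne'
  obtain ⟨h1, h2, h3, h4⟩ := classical_exponents hp hb hs hθ hsb
  have hp0 : 0 < p := by linarith
  have hI := tsallisMass_pos h1 h2 h3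
  have hm := tsallisMoment_pos h1 h2 h3
  have hθ' : 0 < |1 / (b + s)| := abs_pos.2 (one_div_ne_zero hθ0)
  have hF := fisher_stamMinimizer_of_one_lt hp hb hs hθ hsb
  have hF' : fisher p b (stamMinimizer p b (1 - s)) ^ (1 / p) ≠ 0 := by
    rw [hF]
    exact (ENNReal.ofReal_pos.2 (by positivity)).ne'
  have hF'' : fisher p b (stamMinimizer p b (1 - s)) ^ (1 / p) ≠ ∞ := by
    rw [hF]; exact ENNReal.ofReal_ne_top
  refine ⟨?_, fun h => hF' ?_, fun h => hF'' ?_⟩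
  · rw [powInt_stamMinimizer_of_one_lt hp hb hs hθ hsb, powInt_gaussian h1 h2 h3]
    have := one_sub_tsallisMoment_pos h1 h2 h3
    exact ⟨(ENNReal.ofReal_pos.2 (by positivity)).ne', ENNReal.ofReal_ne_top⟩
  · rw [h, ENNReal.zero_rpow_of_pos (by positivity)]
  · rw [h, ENNReal.top_rpow_of_pos (by positivity)]

/-- The tri-parametric Stam inequality for `p > 1`. -/
theorem stamQuot_stamMinimizer_le (hp : 1 < p) (hb : b ≠ 0) (hs : s ≠ 0)
    (hθ : 0 < b * (b + s)) (hsb : s / b < p / (p - 1)) {g : ℝ → ℝ} (hg : IsDensity g)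
    (hac : LocallyAC g (Function.support g)) (he : EndpointLimit g)
    (hnz : NotZeroTop (powInt (1 - s) g ^ (b / s)) (fisher p b g ^ (1 / p))) :
    stamQuot p b s (stamMinimizer p b (1 - s)) ≤ stamQuot p b s g := by
  obtain ⟨h1, h2, h3, h4⟩ := classical_exponents hp hb hs hθ hsb
  have hm := tsallisMoment_pos h1 h2 h3
  have hG := isUnimodalProfile_classical hp hb hs hθ hsb
  have hM := lintegral_moment_support_gaussian h1 h2 h3
  have h := stam_inequality_of_one_lt hp hb hs hθ hg hac he hG.toIsDensity
    hG.continuous.continuousOn hG.zero_mem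
    (by rw [powInt_gaussian h1 h2 h3]; exact ENNReal.ofReal_ne_top)
    (by rw [hM]; exact ENNReal.ofReal_ne_top) hnz
  rw [hM, stamQuot_stamMinimizer_of_one_lt hp hb hs hθ hsb] at h
  have hb' : 0 < |b| := abs_pos.2 hb
  rw [ENNReal.ofReal_rpow_of_pos hm, ← ENNReal.ofReal_mul hb'.le] at h
  exact (ENNReal.mul_le_mul_iff_right (ENNReal.ofReal_pos.2 (by positivity)).ne'
    ENNReal.ofReal_ne_top).1 h

theorem isDensity_stamMinimizer_of_one_lt (hp : 1 < p) (hb : b ≠ 0) (hs : s ≠ 0)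
    (hθ : 0 < b * (b + s)) (hsb : s / b < p / (p - 1)) :
    IsDensity (stamMinimizer p b (1 - s)) := by
  rw [stamMinimizer_of_one_lt hp]
  exact (isUnimodalProfile_classical hp hb hs hθ hsb).isDensity_escort

theorem stamClass_stamMinimizer_of_one_lt (hp : 1 < p) (hb : b ≠ 0) (hs : s ≠ 0)
    (hθ : 0 < b * (b + s)) (hsb : s / b < p / (p - 1)) :
    StamClass p b (1 - s) (stamMinimizer p b (1 - s)) := by
  have hG := isUnimodalProfile_classical hp hb hs hθ hsb
  have e : 1 + b - (1 - s) = b + s := by ring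
  rw [stamMinimizer_of_one_lt hp]
  refine ⟨fun _ h => ?_, fun _ h => ⟨?_, fun y hy => ?_⟩, fun h => absurd h hp.not_gt⟩
  · rw [e] at h
    exact hG.locallyAC_escort_of_pos (by positivity)
  · rw [e] at h
    exact hG.locallyAC_escort_of_neg (one_div_neg.2 h)
  · rw [e] at h
    refine hG.tendsto_escort_atTop (one_div_neg.2 h) fun hmem => ?_
    rw [hG.isDensity_escort.isOpen_support.frontier_eq] at hy
    exact hy.2 hmem

end classicalMinimizer

theorem IsDecreasingDensity.antitoneOn {f : ℝ → ℝ} (hf : IsDecreasingDensity f) :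
    AntitoneOn f (Function.support f) :=
  antitoneOn_of_deriv_nonpos hf.convex
    (fun _ hx => (hf.hasDerivAt hx).continuousAt.continuousWithinAt)
    (fun _ hx => (hf.hasDerivAt (interior_subset hx)).differentiableAt.differentiableWithinAt)
    (fun x hx => (hf.deriv_neg x (interior_subset hx)).le)

theorem IsDecreasingDensity.locallyAC {f : ℝ → ℝ} (hf : IsDecreasingDensity f) :
    LocallyAC f (Function.support f) := by
  intro a b hab hsub
  exact absolutelyContinuousOnInterval_of_unimodal (c := a) (s := ∅) hab countable_empty
    (fun x hx => (hf.hasDerivAt (hsub hx)).continuousAt.continuousWithinAt)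
    (fun x hx => (hf.hasDerivAt (hsub (Ioo_subset_Icc_self hx.1))).differentiableAt)
    (Or.inr (hf.antitoneOn.mono (inter_subset_left.trans hsub)))
    (Or.inr (hf.antitoneOn.mono (inter_subset_left.trans hsub)))

section halfGaussian

variable {ρ μ c : ℝ}

theorem support_halfGaussian :
    Function.support (halfGaussian c ρ μ) = Function.support (gaussian ρ μ) ∩ {z | 0 < c * z} := by
  ext z
  simp [halfGaussian, and_comm]

theorem isOpen_half (c : ℝ) : IsOpen {z : ℝ | 0 < c * z} :=
  isOpen_lt continuous_const (continuous_const.mul continuous_id)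

theorem setLIntegral_support_halfGaussian (hρ : 0 < ρ) (hμ : μ ≠ 1) (hμρ : 1 / (1 + ρ) < μ)
    (hc : c ≠ 0) {Φ : ℝ → ℝ≥0∞} (h0 : ∀ z, z ∉ Function.support (gaussian ρ μ) → Φ z = 0)
    (he : ∀ z, Φ (-z) = Φ z) :
    ∫⁻ z in Function.support (halfGaussian c ρ μ), Φ z = ∫⁻ z in Ioi (0 : ℝ), Φ z := by
  rw [support_halfGaussian, ← setLIntegral_indicator
    (isDensity_gaussian hρ hμ hμρ).isOpen_support.measurableSet, ← setLIntegral_half_of_even he hc]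
  congr 1
  ext z
  by_cases hz : z ∈ Function.support (gaussian ρ μ)
  · simp only [indicator_of_mem hz]
  · rw [indicator_of_notMem hz, h0 z hz]

theorem halfGaussian_of_mem {z : ℝ} (hz : z ∈ Function.support (halfGaussian c ρ μ)) :
    halfGaussian c ρ μ z = 2 * gaussian ρ μ z := by
  rw [support_halfGaussian] at hz
  exact if_pos hz.2

theorem lintegral_halfGaussian (hρ : 0 < ρ) (hμ : μ ≠ 1) (hμρ : 1 / (1 + ρ) < μ)
    (hc : c ≠ 0) {Φ : ℝ → ℝ≥0∞} (he : ∀ z, Φ (-z) = Φ z) :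
    ∫⁻ z in Function.support (halfGaussian c ρ μ), Φ z * ENNReal.ofReal (halfGaussian c ρ μ z)
      = 2 * ∫⁻ z in Ioi (0 : ℝ), Φ z * ENNReal.ofReal (gaussian ρ μ z) := by
  rw [← lintegral_const_mul' _ _ ENNReal.ofNat_ne_top,
    ← setLIntegral_support_halfGaussian hρ hμ hμρ hc]
  · refine setLIntegral_congr_fun ?_ fun z hz => ?_
    · rw [support_halfGaussian]
      exact ((isDensity_gaussian hρ hμ hμρ).isOpen_support.inter (isOpen_half c)).measurableSet
    · rw [halfGaussian_of_mem hz, ENNReal.ofReal_mul zero_le_two, ENNReal.ofReal_ofNat]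
      ring
  · intro z hz
    have : gaussian ρ μ z = 0 := by simpa using hz
    simp [this]
  · intro z
    rw [he, gaussian_neg]

theorem isDensity_halfGaussian (hρ : 0 < ρ) (hμ : μ ≠ 1) (hμρ : 1 / (1 + ρ) < μ) (hc : c ≠ 0) :
    IsDensity (halfGaussian c ρ μ) where
  nonneg z := by
    unfold halfGaussian
    split_ifs
    · exact mul_nonneg zero_le_two (gaussian_nonneg hρ hμ hμρ z)
    · exact le_rfl
  isOpen_support := by
    rw [support_halfGaussian]
    exact (isDensity_gaussian hρ hμ hμρ).isOpen_support.inter (isOpen_half c)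
  ordConnected_support := by
    rw [support_halfGaussian]
    refine (isDensity_gaussian hρ hμ hμρ).ordConnected_support.inter ?_
    rcases lt_or_gt_of_ne hc with h | h
    · have : {z : ℝ | 0 < c * z} = Iio 0 := by
        ext z; simp [mul_pos_iff, h, not_lt.2 h.le]
      rw [this]; exact ordConnected_Iio
    · have : {z : ℝ | 0 < c * z} = Ioi 0 := by
        ext z; simp [h]
      rw [this]; exact ordConnected_Ioi
  lintegral_eq_one := by
    have h := lintegral_halfGaussian hρ hμ hμρ hc (Φ := fun _ => 1) (fun _ => rfl)
    simp only [one_mul] at h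
    rw [← setLIntegral_support_ofReal, h, ← lintegral_of_even (fun z => by rw [gaussian_neg]),
      (isDensity_gaussian hρ hμ hμρ).lintegral_eq_one]

theorem continuousOn_halfGaussian (hρ : 0 < ρ) (hμ : μ ≠ 1) :
    ContinuousOn (halfGaussian c ρ μ) (Function.support (halfGaussian c ρ μ)) :=
  ((continuous_gaussian hρ hμ).continuousOn.const_mul 2).congr fun _ hz => halfGaussian_of_mem hz

theorem powInt_halfGaussian (hρ : 0 < ρ) (hμ : μ ≠ 1) (hμρ : 1 / (1 + ρ) < μ) (hc : c ≠ 0) :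
    powInt μ (halfGaussian c ρ μ)
      = ENNReal.ofReal (tsallisMass ρ μ ^ (1 - μ) * (1 - (μ - 1) * tsallisMoment ρ μ)) := by
  have hμ0 : 0 < μ := lt_trans (by positivity) hμρ
  have hI := tsallisMass_pos hρ hμ hμρ
  have h1 : powInt μ (halfGaussian c ρ μ) = ∫⁻ z in Ioi (0 : ℝ),
      ENNReal.ofReal (2 ^ μ) * ENNReal.ofReal (gaussian ρ μ z ^ μ) := by
    rw [← setLIntegral_support_halfGaussian hρ hμ hμρ hc, powInt]
    · refine setLIntegral_congr_fun
        (isDensity_halfGaussian hρ hμ hμρ hc).isOpen_support.measurableSet fun z hz => ?_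
      rw [halfGaussian_of_mem hz, Real.mul_rpow zero_le_two (gaussian_nonneg hρ hμ hμρ z),
        ENNReal.ofReal_mul (by positivity)]
    · intro z hz
      have : gaussian ρ μ z = 0 := by simpa using hz
      simp [this, Real.zero_rpow hμ0.ne']
    · intro z
      rw [gaussian_neg]
  rw [h1, lintegral_const_mul' _ _ ENNReal.ofReal_ne_top, setLIntegral_gaussian_rpow hρ hμ hμρ,
    ← ENNReal.ofReal_mul (by positivity), Real.mul_rpow zero_le_two hI.le,
    Real.rpow_neg zero_le_two, sub_eq_neg_add 1 μ, Real.rpow_add_one hI.ne']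
  congr 1
  have : (2 : ℝ) ^ μ ≠ 0 := by positivity
  field_simp

end halfGaussian

section mirroredMinimizer

variable {p b s : ℝ}

theorem stamMinimizer_of_lt_one (hp : p < 1) :
    stamMinimizer p b (1 - s) = up (2 - b) (halfGaussian (-b) (-s / b) (1 - p)) := by
  have : (1 - s - 1) / b = -s / b := by ring
  rw [stamMinimizer, if_neg hp.not_gt, this]

theorem support_halfGaussian_subset {ρ μ c : ℝ} :
    Function.support (halfGaussian c ρ μ) ⊆ {x | 0 < c * x} := by
  rw [support_halfGaussian]
  exact inter_subset_right

theorem isDecreasingDensity_stamMinimizer (hp0 : p ≠ 0) (hp1 : p < 1) (hb : b ≠ 0) (hsb : 0 < -s / b)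
    (hμρ : 1 / (1 + -s / b) < 1 - p) :
    IsDecreasingDensity (stamMinimizer p b (1 - s)) := by
  have hμ : 1 - p ≠ 1 := by intro h; apply hp0; linarith
  rw [stamMinimizer_of_lt_one hp1]
  exact isDecreasingDensity_up (isDensity_halfGaussian hsb hμ hμρ (neg_ne_zero.2 hb)) hb
    (continuousOn_halfGaussian hsb hμ) support_halfGaussian_subset

theorem upPair_stamMinimizer (hp0 : p ≠ 0) (hp1 : p < 1) (hb : b ≠ 0) (hsb : 0 < -s / b)
    (hμρ : 1 / (1 + -s / b) < 1 - p) : ∃ v, UpPair b (stamMinimizer p b (1 - s))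
    (halfGaussian (-b) (-s / b) (1 - p)) v := by
  have hμ : 1 - p ≠ 1 := by intro h; apply hp0; linarith
  have h1 := isDensity_halfGaussian hsb hμ hμρ (neg_ne_zero.2 hb)
  have h2 := continuousOn_halfGaussian (c := -b) hsb hμ
  rw [stamMinimizer_of_lt_one hp1]
  exact ⟨_, upPair_up h1 hb (upDefined_of_support_subset h1 hb h2 fun h => by
    simpa using support_halfGaussian_subset h) h2⟩

theorem fisher_stamMinimizer_of_lt_one (hp0 : p ≠ 0) (hp1 : p < 1) (hb : b ≠ 0) (hsb : 0 < -s / b)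
    (hμρ : 1 / (1 + -s / b) < 1 - p) : fisher p b (stamMinimizer p b (1 - s))
    = ENNReal.ofReal (tsallisMass (-s / b) (1 - p) ^ p * (1 + p * tsallisMoment (-s / b) (1 - p))) := by
  have hμ : 1 - p ≠ 1 := by intro h; apply hp0; linarith
  obtain ⟨v, hv⟩ := upPair_stamMinimizer hp0 hp1 hb hsb hμρ
  rw [hv.fisher_eq hb, ← powInt, powInt_halfGaussian hsb hμ hμρ (neg_ne_zero.2 hb)]
  congr 2
  · rw [sub_sub_cancel]
  · ring

theorem powInt_stamMinimizer_of_lt_one (hp0 : p ≠ 0) (hp1 : p < 1) (hb : b ≠ 0) (hsb : 0 < -s / b)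
    (hμρ : 1 / (1 + -s / b) < 1 - p) : powInt (1 - s) (stamMinimizer p b (1 - s))
    = ENNReal.ofReal (|b| ^ (-s / b) * tsallisMoment (-s / b) (1 - p)) := by
  have hμ : 1 - p ≠ 1 := by intro h; apply hp0; linarith
  have hb' : 0 < |b| := abs_pos.2 hb
  have hH := isDensity_halfGaussian hsb hμ hμρ (neg_ne_zero.2 hb)
  obtain ⟨v, hv⟩ := upPair_stamMinimizer hp0 hp1 hb hsb hμρ
  have h1 := hv.lintegral fun x => ENNReal.ofReal (|b * x| ^ (-s / b)) *
    ENNReal.ofReal (halfGaussian (-b) (-s / b) (1 - p) x)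
  have h2 : powInt (1 - s) (stamMinimizer p b (1 - s)) = ∫⁻ x in
      Function.support (halfGaussian (-b) (-s / b) (1 - p)), ENNReal.ofReal (|b * x| ^ (-s / b)) *
      ENNReal.ofReal (halfGaussian (-b) (-s / b) (1 - p) x) := by
    rw [h1, powInt]
    refine setLIntegral_congr_fun hv.isOpen.measurableSet fun y hy => ?_
    have hy0 := hv.pos hy
    have hg0 := hv.pos_right hy
    rw [hv.abs_rpow hb hy, ← ENNReal.ofReal_mul (Real.rpow_nonneg hy0.le _),
      ← ENNReal.ofReal_mul (div_nonneg hy0.le hg0.le)]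
    congr 1
    rw [mul_div_cancel₀ _ hb, Real.rpow_sub hy0, Real.rpow_one, Real.rpow_neg hy0.le]
    generalize halfGaussian (-b) (-s / b) (1 - p) (v y) = G at *
    field_simp
  rw [h2, lintegral_halfGaussian hsb hμ hμρ (neg_ne_zero.2 hb) (fun z => by rw [mul_neg, abs_neg])]
  have h3 : ∀ z, ENNReal.ofReal (|b * z| ^ (-s / b)) *
      ENNReal.ofReal (gaussian (-s / b) (1 - p) z) = ENNReal.ofReal (|b| ^ (-s / b)) *
      (ENNReal.ofReal (|z| ^ (-s / b)) * ENNReal.ofReal (gaussian (-s / b) (1 - p) z)) := by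
    intro z
    rw [abs_mul, Real.mul_rpow (abs_nonneg _) (abs_nonneg _), ENNReal.ofReal_mul (by positivity),
      mul_assoc]
  simp only [h3]
  rw [lintegral_const_mul' _ _ ENNReal.ofReal_ne_top, lintegral_moment_gaussian hsb hμ hμρ,
    ← ENNReal.ofReal_ofNat 2, ← ENNReal.ofReal_mul (by positivity), ← ENNReal.ofReal_mul zero_le_two]
  congr 1
  ring

theorem stamMinimizer_finite_of_lt_one (hp0 : p ≠ 0) (hp1 : p < 1) (hb : b ≠ 0) (hsb : 0 < -s / b)
    (hμρ : 1 / (1 + -s / b) < 1 - p) :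
    (powInt (1 - s) (stamMinimizer p b (1 - s)) ≠ 0 ∧
      powInt (1 - s) (stamMinimizer p b (1 - s)) ≠ ∞) ∧
    fisher p b (stamMinimizer p b (1 - s)) ≠ 0 ∧ fisher p b (stamMinimizer p b (1 - s)) ≠ ∞ := by
  have hμ : 1 - p ≠ 1 := by intro h; apply hp0; linarith
  have hb' : 0 < |b| := abs_pos.2 hb
  have hI := tsallisMass_pos hsb hμ hμρ
  have hm := tsallisMoment_pos hsb hμ hμρ
  have hq := one_sub_tsallisMoment_pos hsb hμ hμρ
  have hq' : 0 < 1 + p * tsallisMoment (-s / b) (1 - p) := by linarith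
  rw [fisher_stamMinimizer_of_lt_one hp0 hp1 hb hsb hμρ,
    powInt_stamMinimizer_of_lt_one hp0 hp1 hb hsb hμρ]
  exact ⟨⟨(ENNReal.ofReal_pos.2 (by positivity)).ne', ENNReal.ofReal_ne_top⟩,
    (ENNReal.ofReal_pos.2 (by positivity)).ne', ENNReal.ofReal_ne_top⟩

/-- The mirrored Stam inequality, for `p < 1`. -/
theorem stamQuot_le_stamMinimizer (hp0 : p ≠ 0) (hp1 : p < 1) (hb : b ≠ 0) (hsb : 0 < -s / b)
    (hμρ : 1 / (1 + -s / b) < 1 - p) {g : ℝ → ℝ} (hg : IsDensity g)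
    (hac : LocallyAC g (Function.support g))
    (hneg : ∀ᵐ x, x ∈ Function.support g → deriv g x < 0) :
    stamQuot p b s g ≤ stamQuot p b s (stamMinimizer p b (1 - s)) := by
  have hμ : 1 - p ≠ 1 := by intro h; apply hp0; linarith
  have hs : s ≠ 0 := by rintro rfl; simp at hsb
  have hb' : 0 < |b| := abs_pos.2 hb
  have hI := tsallisMass_pos hsb hμ hμρ
  have hm := tsallisMoment_pos hsb hμ hμρ
  have hq := one_sub_tsallisMoment_pos hsb hμ hμρ
  have hq' : 0 < 1 + p * tsallisMoment (-s / b) (1 - p) := by linarith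
  refine (stam_inequality_of_lt_one hp0 hp1 hb hs hsb hμρ hg hac hneg).trans_eq ?_
  rw [stamQuot, fisher_stamMinimizer_of_lt_one hp0 hp1 hb hsb hμρ,
    powInt_stamMinimizer_of_lt_one hp0 hp1 hb hsb hμρ, ENNReal.ofReal_rpow_of_pos (by positivity),
    ENNReal.ofReal_rpow_of_pos (by positivity), ← ENNReal.ofReal_mul (by positivity),
    Real.mul_rpow (by positivity) hm.le, Real.mul_rpow (by positivity) hq'.le,
    ← Real.rpow_mul hI.le, mul_one_div_cancel hp0, Real.rpow_one, ← Real.rpow_mul hb'.le,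
    show -s / b * (b / s) = -1 by field_simp, Real.rpow_neg_one]
  congr 1
  ring

theorem stamClass_stamMinimizer_of_lt_one (hp0 : p ≠ 0) (hp1 : p < 1) (hb : b ≠ 0) (hsb : 0 < -s / b)
    (hμρ : 1 / (1 + -s / b) < 1 - p) :
    StamClass p b (1 - s) (stamMinimizer p b (1 - s)) := by
  have h := isDecreasingDensity_stamMinimizer hp0 hp1 hb hsb hμρ
  exact ⟨fun h => absurd h hp1.not_ge, fun h => absurd h hp1.not_ge, fun _ =>
    ⟨h.locallyAC, Eventually.of_forall h.deriv_neg⟩⟩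

end mirroredMinimizer

section translation

theorem LocallyAC.comp_sub_right {g : ℝ → ℝ} {I : Set ℝ} (h : LocallyAC g I) (m : ℝ) :
    LocallyAC (fun x => g (x - m)) ((fun x => x - m) ⁻¹' I) := by
  intro a b hab hsub
  have h1 := h (a - m) (b - m) (by linarith) fun x hx => by
    simpa using hsub (show x + m ∈ Icc a b from ⟨by linarith [hx.1], by linarith [hx.2]⟩)
  rw [absolutelyContinuousOnInterval_iff] at h1 ⊢
  intro ε hε
  obtain ⟨δ, hδ, h2⟩ := h1 ε hε
  refine ⟨δ, hδ, fun E hE hlt => ?_⟩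
  refine h2 (E.1, fun i => ((E.2 i).1 - m, (E.2 i).2 - m)) ⟨fun i hi => ?_, fun i hi j hj hij => ?_⟩ ?_
  · have := hE.1 i hi
    rw [uIcc_of_le hab] at this
    rw [uIcc_of_le (by linarith)]
    exact ⟨⟨by linarith [this.1.1], by linarith [this.1.2]⟩,
      ⟨by linarith [this.2.1], by linarith [this.2.2]⟩⟩
  · have := hE.2 hi hj hij
    simp only [Function.onFun] at this ⊢
    have e : ∀ u v : ℝ, uIoc (u - m) (v - m) = (fun x => x + m) ⁻¹' uIoc u v := by
      intro u v
      ext x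
      simp only [mem_preimage, mem_uIoc, sub_lt_iff_lt_add, le_sub_iff_add_le]
    simp only [e]
    exact this.preimage _
  · simpa using hlt

theorem support_comp_sub_right (g : ℝ → ℝ) (m : ℝ) :
    Function.support (fun x => g (x - m)) = (fun x => x - m) ⁻¹' Function.support g := rfl

theorem setLIntegral_comp_sub_right (Φ : ℝ → ℝ≥0∞) (S : Set ℝ) (m : ℝ) :
    ∫⁻ x in (fun x => x - m) ⁻¹' S, Φ (x - m) = ∫⁻ x in S, Φ x :=
  (measurePreserving_sub_right volume m).setLIntegral_comp_preimage_emb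
    (measurableEmbedding_subRight m) Φ S

theorem powInt_comp_sub_right (c : ℝ) (g : ℝ → ℝ) (m : ℝ) :
    powInt c (fun x => g (x - m)) = powInt c g :=
  setLIntegral_comp_sub_right (fun x => ENNReal.ofReal (g x ^ c)) (Function.support g) m

theorem fisher_comp_sub_right (p b : ℝ) (g : ℝ → ℝ) (m : ℝ) :
    fisher p b (fun x => g (x - m)) = fisher p b g := by
  rw [fisher, fisher, support_comp_sub_right]
  simp only [deriv_comp_sub_const]
  exact setLIntegral_comp_sub_right (fun x => ENNReal.ofReal |g x ^ (b - 2) * deriv g x| ^ p *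
    ENNReal.ofReal (g x)) (Function.support g) m

theorem IsDensity.comp_sub_right {g : ℝ → ℝ} (hg : IsDensity g) (m : ℝ) :
    IsDensity fun x => g (x - m) where
  nonneg _ := hg.nonneg _
  isOpen_support := hg.isOpen_support.preimage (continuous_id.sub continuous_const)
  ordConnected_support := hg.ordConnected_support.preimage_mono
    (fun _ _ h => sub_le_sub_right h m)
  lintegral_eq_one := by
    rw [← hg.lintegral_eq_one]
    exact lintegral_sub_right_eq_self (fun x => ENNReal.ofReal (g x)) m

theorem tendsto_sub_nhdsWithin {S : Set ℝ} (m e : ℝ) :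
    Tendsto (fun x => x - m) (𝓝[(fun x => x - m) ⁻¹' S] e) (𝓝[S] (e - m)) :=
  tendsto_nhdsWithin_iff.2 ⟨((continuous_id.sub continuous_const).tendsto e).mono_left
    nhdsWithin_le_nhds, self_mem_nhdsWithin⟩

theorem StamClass.comp_sub_right {p b l : ℝ} {g : ℝ → ℝ} (h : StamClass p b l g) (m : ℝ) :
    StamClass p b l fun x => g (x - m) := by
  refine ⟨fun h1 h2 => (h.1 h1 h2).comp_sub_right m, fun h1 h2 => ?_, fun h1 => ?_⟩
  · obtain ⟨h3, h4⟩ := h.2.1 h1 h2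
    refine ⟨h3.comp_sub_right m, fun e he => ?_⟩
    have he' : e - m ∈ frontier (Function.support g) := by
      have : frontier ((Homeomorph.subRight m) ⁻¹' Function.support g)
          = (Homeomorph.subRight m) ⁻¹' frontier (Function.support g) :=
        ((Homeomorph.subRight m).preimage_frontier _).symm
      have he2 : e ∈ frontier ((Homeomorph.subRight m) ⁻¹' Function.support g) := he
      rw [this] at he2
      exact he2
    exact (h4 _ he').comp (tendsto_sub_nhdsWithin m e)
  · obtain ⟨h3, h4⟩ := h.2.2 h1
    refine ⟨h3.comp_sub_right m, ?_⟩
    have := (measurePreserving_sub_right (volume : Measure ℝ) m).quasiMeasurePreserving.ae h4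
    filter_upwards [this] with x hx hxs
    rw [deriv_comp_sub_const]
    exact hx hxs

theorem stamProduct_comp_sub_right (p q s : ℝ) (g : ℝ → ℝ) (m : ℝ) :
    stamProduct p q s (fun x => g (x - m)) = stamProduct p q s g := by
  have := powInt_comp_sub_right (1 - s) g m
  rw [stamProduct, stamProduct, fisher_comp_sub_right]
  unfold renyiPower
  unfold powInt at this
  rw [this]

end translation

section main

variable {p q s : ℝ}

theorem NotZeroTop.of_ne {x y : ℝ≥0∞} (hx : x ≠ 0 ∧ x ≠ ∞) : NotZeroTop x y :=
  ⟨fun h => hx.1 h.1, fun h => hx.2 h.1⟩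

theorem ennreal_rpow_ne {x : ℝ≥0∞} (hx : x ≠ 0 ∧ x ≠ ∞) (c : ℝ) : x ^ c ≠ 0 ∧ x ^ c ≠ ∞ :=
  ⟨(ENNReal.rpow_pos (pos_iff_ne_zero.2 hx.1) hx.2).ne',
    ENNReal.rpow_ne_top_of_ne_zero hx.1 hx.2⟩

theorem mul_pos_of_sign_eq {x y : ℝ} (h : SignType.sign x = SignType.sign y)
    (hy : SignType.sign y ≠ 0) : 0 < x * y := by
  rcases lt_trichotomy y 0 with h0 | h0 | h0
  · rw [sign_neg h0, sign_eq_neg_one_iff] at h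
    exact mul_pos_of_neg_of_neg h h0
  · simp [h0] at hy
  · rw [sign_pos h0, sign_eq_one_iff] at h
    exact mul_pos h h0

theorem ClassicalRange.one_lt (h : ClassicalRange p q s) (hp : p ≠ 1) : 1 < p :=
  lt_of_le_of_ne h.1 hp.symm

theorem base_ne_zero (hp : p ≠ 0) (hpq : p ≠ q) : (p - q) / p ≠ 0 :=
  div_ne_zero (sub_ne_zero.2 hpq) hp

theorem ClassicalRange.mul_pos (h : ClassicalRange p q s) :
    0 < (p - q) / p * ((p - q) / p + s) := by
  obtain ⟨h1, h2, h3⟩ := h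
  by_cases hp : p = 1
  · rw [if_pos hp] at h2
    have := mul_pos_of_sign_eq h2 h3
    simpa [hp] using this
  · rw [if_neg hp] at h2
    have hp1 : 1 < p := lt_of_le_of_ne h1 (Ne.symm hp)
    have h4 := mul_pos_of_sign_eq h2 h3
    set b := (p - q) / p with hb
    have e : (p - q) / (p - 1) = p / (p - 1) * b := by
      have : p - 1 ≠ 0 := by linarith
      rw [hb]; field_simp
    rw [e] at h4
    have h5 : 0 < 1 + p / (p - 1) := by
      have : 0 < p / (p - 1) := div_pos (by linarith) (by linarith)
      linarith
    have h6 : 0 < (1 + p / (p - 1)) * (b * (b + s)) := by nlinarith [sq_nonneg (b + s)]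
    exact (mul_pos_iff_of_pos_left h5).1 h6

theorem ClassicalRange.div_lt (h : ClassicalRange p q s) (hp1 : 1 < p) :
    s / ((p - q) / p) < p / (p - 1) := by
  have hpos := h.mul_pos
  obtain ⟨-, h2, h3⟩ := h
  rw [if_neg hp1.ne'] at h2
  have h4 := mul_pos_of_sign_eq h2 h3
  set b := (p - q) / p with hb
  have hb0 : b ≠ 0 := left_ne_zero_of_mul hpos.ne'
  have hθ0 : b + s ≠ 0 := right_ne_zero_of_mul hpos.ne'
  have e : (p - q) / (p - 1) = p / (p - 1) * b := by
    have : p - 1 ≠ 0 := by linarith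
    rw [hb]; field_simp
  rw [e] at h4
  have h5 : 0 < (p / (p - 1) - s / b) := by
    have : p / (p - 1) - s / b = (p / (p - 1) * b - s) * (b + s) * (b * (b + s)) / (b * (b + s)) ^ 2 := by
      field_simp
    rw [this]; positivity
  linarith

theorem MirroredRange.neg_div_pos (h : MirroredRange p q s) : 0 < -s / ((p - q) / p) := by
  obtain ⟨-, -, -, -, h5, h6⟩ := h
  have := mul_pos_of_sign_eq h5.symm h6
  have h0 : (p - q) / p ≠ 0 := by
    intro h0
    have : (q - p) / p = -((p - q) / p) := by ring
    rw [this, h0] at h5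
    simp [h5] at h6
  have e : -s / ((p - q) / p) = (q - p) / p * s / ((p - q) / p) ^ 2 := by
    have : (q - p) / p = -((p - q) / p) := by ring
    rw [this]
    field_simp
  rw [e]; positivity

theorem MirroredRange.lt_one_sub (h : MirroredRange p q s) :
    1 / (1 + -s / ((p - q) / p)) < 1 - p := by
  have hρ := h.neg_div_pos
  obtain ⟨hp1, hp0, h3, h4, -, -⟩ := h
  have h7 := mul_pos_of_sign_eq h3 h4
  set b := (p - q) / p with hb
  have hb0 : b ≠ 0 := by
    intro h0
    rw [h0] at hρ
    simp at hρ
  set ρ := -s / b with hρd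
  have hs : s = -ρ * b := by rw [hρd]; field_simp
  have e : (p - q) / (p - 1) = p / (p - 1) * b := by
    have : p - 1 ≠ 0 := by linarith
    rw [hb]; field_simp
  rw [e, hs] at h7
  have h8 : 0 < (p / (p - 1) + ρ) * ((1 + ρ) * b ^ 2) := by linarith
  have h9 : 0 < p / (p - 1) + ρ := (mul_pos_iff_of_pos_right (by positivity)).1 h8
  have h10 : p / (p - 1) = 1 - 1 / (1 - p) := by
    have h11 : p - 1 ≠ 0 := by linarith
    have h12 : 1 - p ≠ 0 := by linarith
    rw [eq_sub_iff_add_eq, ← neg_sub 1 p]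
    field_simp
    ring
  rw [h10] at h9
  rw [div_lt_comm₀ (by positivity) (by linarith)]
  linarith

theorem theta1_eq_theta2 (hp : p ≠ 0) : theta1 p ((p - q) / p) (1 - s) = theta2 s p q := by
  unfold theta1 theta2
  split_ifs
  · field_simp; ring
  · field_simp; ring

theorem kappa2_eq_stamProduct (hp : p ≠ 0) (hp1 : p ≠ 1) :
    kappa2 s p q = stamProduct p q s (stamMinimizer p ((p - q) / p) (1 - s)) := by
  rw [kappa2, kappa1, if_neg hp1, theta1_eq_theta2 hp, stamProduct, mul_div_cancel₀ _ hp, mul_comm]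

theorem range_ne_zero (h : ClassicalRange p q s ∨ MirroredRange p q s) : p ≠ 0 := by
  rcases h with h | h
  · linarith [h.1]
  · exact h.2.1

theorem stamMinimizer_spec (hpq : p ≠ q) (hs : s ≠ 0)
    (hrange : ClassicalRange p q s ∨ MirroredRange p q s) (hp1 : p ≠ 1) :
    IsDensity (stamMinimizer p ((p - q) / p) (1 - s)) ∧
    StamClass p ((p - q) / p) (1 - s) (stamMinimizer p ((p - q) / p) (1 - s)) ∧
    (powInt (1 - s) (stamMinimizer p ((p - q) / p) (1 - s)) ≠ 0 ∧
      powInt (1 - s) (stamMinimizer p ((p - q) / p) (1 - s)) ≠ ∞) ∧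
    fisher p ((p - q) / p) (stamMinimizer p ((p - q) / p) (1 - s)) ≠ 0 ∧
      fisher p ((p - q) / p) (stamMinimizer p ((p - q) / p) (1 - s)) ≠ ∞ := by
  have hb := base_ne_zero (range_ne_zero hrange) hpq
  rcases hrange with h | h
  · have hp := h.one_lt hp1
    exact ⟨isDensity_stamMinimizer_of_one_lt hp hb hs h.mul_pos (h.div_lt hp),
      stamClass_stamMinimizer_of_one_lt hp hb hs h.mul_pos (h.div_lt hp),
      stamMinimizer_finite_of_one_lt hp hb hs h.mul_pos (h.div_lt hp)⟩
  · exact ⟨(isDecreasingDensity_stamMinimizer h.2.1 h.1 hb h.neg_div_pos h.lt_one_sub).toIsDensity,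
      stamClass_stamMinimizer_of_lt_one h.2.1 h.1 hb h.neg_div_pos h.lt_one_sub,
      stamMinimizer_finite_of_lt_one h.2.1 h.1 hb h.neg_div_pos h.lt_one_sub⟩

theorem renyiPower_ne {g : ℝ → ℝ} (h : powInt (1 - s) g ≠ 0 ∧ powInt (1 - s) g ≠ ∞) :
    renyiPower (1 - s) g ≠ 0 ∧ renyiPower (1 - s) g ≠ ∞ := ennreal_rpow_ne h _

theorem stamProduct_ne {g : ℝ → ℝ} (h : powInt (1 - s) g ≠ 0 ∧ powInt (1 - s) g ≠ ∞)
    (h' : fisher p ((p - q) / p) g ≠ 0 ∧ fisher p ((p - q) / p) g ≠ ∞) :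
    stamProduct p q s g ≠ 0 ∧ stamProduct p q s g ≠ ∞ := by
  have h1 := renyiPower_ne h
  have h2 := ennreal_rpow_ne h' (1 / (p - q))
  exact ennreal_rpow_ne ⟨mul_ne_zero h1.1 h2.1, ENNReal.mul_ne_top h1.2 h2.2⟩ _

theorem kappa2_pos_lt_top (hpq : p ≠ q) (hs : s ≠ 0)
    (hrange : ClassicalRange p q s ∨ MirroredRange p q s) :
    0 < kappa2 s p q ∧ kappa2 s p q < ∞ := by
  have hp := range_ne_zero hrange
  by_cases hp1 : p = 1
  · have hb : 0 < |(p - q) / p| := abs_pos.2 (base_ne_zero hp hpq)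
    rw [kappa2, kappa1, if_pos hp1]
    exact ⟨ENNReal.ofReal_pos.2 (by positivity), ENNReal.ofReal_lt_top⟩
  · obtain ⟨-, -, h1, h2⟩ := stamMinimizer_spec hpq hs hrange hp1
    rw [kappa2_eq_stamProduct hp hp1]
    have := stamProduct_ne h1 h2
    exact ⟨pos_iff_ne_zero.2 this.1, lt_top_iff_ne_top.2 this.2⟩

theorem StamClass.locallyAC {b : ℝ} {g : ℝ → ℝ} (h : StamClass p b (1 - s) g)
    (hθ : 1 ≤ p → b + s ≠ 0) : LocallyAC g (Function.support g) := by
  have e : 1 + b - (1 - s) = b + s := by ring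
  rw [StamClass, e] at h
  rcases le_or_gt 1 p with hp | hp
  · rcases lt_or_gt_of_ne (hθ hp) with h1 | h1
    · exact (h.2.1 hp h1).1
    · exact (h.1 hp h1).mono (subset_univ _)
  · exact (h.2.2 hp).1

theorem StamClass.endpointLimit {b : ℝ} {g : ℝ → ℝ} (h : StamClass p b (1 - s) g)
    (hg : IsDensity g) (hp : 1 ≤ p) (hθ : b + s ≠ 0) : EndpointLimit g := by
  have e : 1 + b - (1 - s) = b + s := by ring
  rw [StamClass, e] at h
  intro y hy
  rcases lt_or_gt_of_ne hθ with h1 | h1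
  · exact Or.inr ((h.2.1 hp h1).2 y hy)
  · refine Or.inl ?_
    have hc := ((h.1 hp h1).continuousOn isOpen_univ).continuousAt (x := y) univ_mem
    have hy0 : g y = 0 := by
      rw [hg.isOpen_support.frontier_eq] at hy
      simpa using hy.2
    rw [ContinuousAt, hy0] at hc
    exact hc.mono_left nhdsWithin_le_nhds

theorem range_theta_ne (hrange : ClassicalRange p q s ∨ MirroredRange p q s) (hp : 1 ≤ p) :
    (p - q) / p + s ≠ 0 := by
  rcases hrange with h | h
  · exact right_ne_zero_of_mul h.mul_pos.ne'
  · exact absurd h.1 hp.not_gt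

/-- The tri-parametric Stam inequality. -/
theorem kappa2_le_stamProduct (hpq : p ≠ q) (hs : s ≠ 0)
    (hrange : ClassicalRange p q s ∨ MirroredRange p q s) {g : ℝ → ℝ} (hg : IsDensity g)
    (hgc : StamClass p ((p - q) / p) (1 - s) g)
    (hnz : NotZeroTop (renyiPower (1 - s) g) (fisher p ((p - q) / p) g ^ (1 / (p - q)))) :
    kappa2 s p q ≤ stamProduct p q s g := by
  have hp := range_ne_zero hrange
  have hb := base_ne_zero hp hpq
  have hac := hgc.locallyAC (range_theta_ne hrange)
  obtain ⟨h1, h2⟩ := stamProduct_eq hp hpq hnz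
  rw [h1]
  by_cases hp1 : p = 1
  · have hc : ClassicalRange p q s := by
      rcases hrange with h | h
      · exact h
      · exact absurd h.1 (by simp [hp1])
    have hpos := hc.mul_pos
    have he := hgc.endpointLimit hg hc.1 (range_theta_ne hrange hc.1)
    have e2 : theta2 s p q = (p - q) / p + s := by
      rw [theta2, if_pos hc.1]; field_simp
    have hz : 0 ≤ theta2 s p q / ((p - q) / p) := by
      have : theta2 s p q / ((p - q) / p)
          = (p - q) / p * ((p - q) / p + s) / ((p - q) / p) ^ 2 := by
        rw [e2]; field_simp
      rw [this]; positivity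
    rw [kappa2, kappa1, if_pos hp1, theta1_eq_theta2 hp,
      ← ENNReal.ofReal_rpow_of_pos (div_pos two_pos (abs_pos.2 hb))]
    refine ENNReal.rpow_le_rpow ?_ hz
    subst hp1
    exact stam_inequality_one hb hs hg hac he h2
  · obtain ⟨-, -, h3, h4⟩ := stamMinimizer_spec hpq hs hrange hp1
    rw [kappa2_eq_stamProduct hp hp1,
      (stamProduct_eq hp hpq (NotZeroTop.of_ne (renyiPower_ne h3))).1]
    rcases hrange with h | h
    · have hp' := h.one_lt hp1
      have hpos := h.mul_pos
      refine ENNReal.rpow_le_rpow (stamQuot_stamMinimizer_le hp' hb hs hpos (h.div_lt hp') hg hac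
        (hgc.endpointLimit hg h.1 (right_ne_zero_of_mul hpos.ne')) h2) ?_
      have e2 : theta2 s p q = (p - q) / p + s := by
        rw [theta2, if_pos h.1]; field_simp
      have : theta2 s p q / ((p - q) / p)
          = (p - q) / p * ((p - q) / p + s) / ((p - q) / p) ^ 2 := by
        rw [e2]; field_simp
      rw [this]; positivity
    · refine ennreal_rpow_le_rpow_of_nonpos ?_ (stamQuot_le_stamMinimizer h.2.1 h.1 hb h.neg_div_pos
        h.lt_one_sub hg hac (hgc.2.2 h.1).2)
      have e2 : theta2 s p q = -((p - q) / p) := by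
        rw [theta2, if_neg h.1.not_ge]; field_simp; ring
      rw [e2, neg_div, div_self hb]
      norm_num

theorem kappa2_le_dffProduct {l : ℝ} (hpq : p ≠ q) (hl : l ≠ 0) (hs : s ≠ 0)
    (hrange : ClassicalRange p q s ∨ MirroredRange p q s) {f g v : ℝ → ℝ} (hv : UpPair l f g v)
    (hg : IsDensity g) (hgc : StamClass p ((p - q) / p) (1 - s) g)
    (hd : ProductDefined p q s l f) : kappa2 s p q ≤ dffProduct p q s l f := by
  have hp := range_ne_zero hrange
  have hdiff := (hgc.locallyAC (range_theta_ne hrange)).ae_differentiableAt hg.isOpen_support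
  rw [hv.dffProduct_eq hl hp hpq s hdiff]
  refine kappa2_le_stamProduct hpq hs hrange hg hgc ?_
  rwa [ProductDefined, hv.factorF_eq hl, hv.factorPhi_eq hl hp hpq hdiff] at hd

end main

section scaling

variable {C : ℝ} {h : ℝ → ℝ}

theorem support_const_mul_fun (hC : 0 < C) :
    Function.support (fun x => C * h x) = Function.support h := by
  ext x
  simp [hC.ne']

theorem powInt_const_mul (hC : 0 < C) (h0 : ∀ x, 0 ≤ h x) (c : ℝ) :
    powInt c (fun x => C * h x) = ENNReal.ofReal C ^ c * powInt c h := by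
  rw [powInt, powInt, support_const_mul_fun hC, ENNReal.ofReal_rpow_of_pos hC,
    ← lintegral_const_mul' _ _ ENNReal.ofReal_ne_top]
  simp_rw [Real.mul_rpow hC.le (h0 _), ENNReal.ofReal_mul (Real.rpow_nonneg hC.le c)]

theorem fisher_const_mul (hC : 0 < C) (ho : IsOpen (Function.support h)) (h0 : ∀ x, 0 ≤ h x)
    (p b : ℝ) :
    fisher p b (fun x => C * h x) = ENNReal.ofReal C ^ (p * (b - 1) + 1) * fisher p b h := by
  rw [fisher, fisher, support_const_mul_fun hC, ENNReal.ofReal_rpow_of_pos hC,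
    ← lintegral_const_mul' _ _ ENNReal.ofReal_ne_top]
  refine setLIntegral_congr_fun ho.measurableSet fun x hx => ?_
  have e : (C * h x) ^ (b - 2) * deriv (fun x => C * h x) x
      = C ^ (b - 1) * (h x ^ (b - 2) * deriv h x) := by
    rw [deriv_const_mul_field, Real.mul_rpow hC.le (h0 x), show b - 1 = b - 2 + 1 by ring,
      Real.rpow_add_one hC.ne']
    ring
  have hc : ENNReal.ofReal (C ^ (b - 1)) ≠ 0 ∧ ENNReal.ofReal (C ^ (b - 1)) ≠ ∞ :=
    ⟨(ENNReal.ofReal_pos.2 (by positivity)).ne', ENNReal.ofReal_ne_top⟩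
  rw [e, abs_mul, abs_of_pos (by positivity : 0 < C ^ (b - 1)), ENNReal.ofReal_mul (by positivity),
    (NotZeroTop.of_ne hc).mul_rpow, ENNReal.ofReal_mul hC.le, ENNReal.ofReal_rpow_of_pos (by positivity),
    ← Real.rpow_mul hC.le, Real.rpow_add_one hC.ne', ENNReal.ofReal_mul (by positivity),
    mul_comm (b - 1) p]
  ring

theorem StamClass.const_mul {p b l : ℝ} (hh : StamClass p b l h) (hC : 0 < C) :
    StamClass p b l fun x => C * h x := by
  rw [StamClass, support_const_mul_fun hC]
  refine ⟨fun h1 h2 x y hxy hs => (hh.1 h1 h2 x y hxy hs).const_mul C, fun h1 h2 =>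
    ⟨fun x y hxy hs => ((hh.2.1 h1 h2).1 x y hxy hs).const_mul C, fun e he =>
      ((hh.2.1 h1 h2).2 e he).const_mul_atTop hC⟩, fun h1 =>
    ⟨fun x y hxy hs => ((hh.2.2 h1).1 x y hxy hs).const_mul C, ?_⟩⟩
  filter_upwards [(hh.2.2 h1).2] with x hx hxs
  rw [deriv_const_mul_field]
  exact mul_neg_of_pos_of_neg hC (hx hxs)

end scaling

section sharpness

variable {p q s l : ℝ} {c : ℝ≥0∞}

theorem exists_translate_subset {S : Set ℝ} (hS : Bornology.IsBounded S) (hl : l ≠ 0) :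
    ∃ m : ℝ, (fun x => x - m) ⁻¹' S ⊆ {x | 0 < -l * x} := by
  obtain ⟨R, hR⟩ := hS.subset_closedBall 0
  rcases lt_or_gt_of_ne hl with h | h
  · refine ⟨R + 1, fun x hx => ?_⟩
    have h1 := hR hx
    rw [Metric.mem_closedBall, Real.dist_0_eq_abs, abs_le] at h1
    exact mul_pos (neg_pos.2 h) (by linarith [h1.1])
  · refine ⟨-(R + 1), fun x hx => ?_⟩
    have h1 := hR hx
    rw [Metric.mem_closedBall, Real.dist_0_eq_abs, abs_le] at h1
    exact mul_pos_of_neg_of_neg (neg_neg_of_pos h) (by linarith [h1.2])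

theorem le_stamProduct_of_isBounded (hpq : p ≠ q) (hl : l ≠ 0)
    (hrange : ClassicalRange p q s ∨ MirroredRange p q s)
    (hc : ∀ f : ℝ → ℝ, Admissible p q s l f → ProductDefined p q s l f → c ≤ dffProduct p q s l f)
    {g : ℝ → ℝ} (hg : IsDensity g) (hgc : StamClass p ((p - q) / p) (1 - s) g)
    (hb : Bornology.IsBounded (Function.support g))
    (hA : powInt (1 - s) g ≠ 0 ∧ powInt (1 - s) g ≠ ∞) : c ≤ stamProduct p q s g := by
  have hp := range_ne_zero hrange
  obtain ⟨m, hm⟩ := exists_translate_subset hb hl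
  have hg' := hg.comp_sub_right m
  have hgc' := hgc.comp_sub_right m
  have hac := hgc'.locallyAC (range_theta_ne hrange)
  have hcont := hac.continuousOn hg'.isOpen_support
  have hdiff := hac.ae_differentiableAt hg'.isOpen_support
  have hu := upDefined_of_support_subset hg' hl hcont fun h => by simpa using hm h
  have hv := upPair_up hg' hl hu hcont
  have hA' : powInt (1 - s) (fun x => g (x - m)) ≠ 0 ∧ powInt (1 - s) (fun x => g (x - m)) ≠ ∞ := by
    rwa [powInt_comp_sub_right]
  rw [← stamProduct_comp_sub_right p q s g m, ← hv.dffProduct_eq hl hp hpq s hdiff]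
  refine hc _ ⟨isDecreasingDensity_up hg' hl hcont hm, ?_⟩ ?_
  · rwa [down_up hg' hl hcont hm]
  · rw [ProductDefined, hv.factorF_eq hl]
    exact NotZeroTop.of_ne (renyiPower_ne hA')

/-- Almost extremal densities with bounded supports, up to normalization, bound `c`. -/
theorem le_of_tendsto_of_isBounded (hpq : p ≠ q) (hl : l ≠ 0)
    (hrange : ClassicalRange p q s ∨ MirroredRange p q s)
    (hc : ∀ f : ℝ → ℝ, Admissible p q s l f → ProductDefined p q s l f → c ≤ dffProduct p q s l f)
    {h : ℕ → ℝ → ℝ} (h0 : ∀ n x, 0 ≤ h n x) (ho : ∀ n, IsOpen (Function.support (h n)))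
    (hoc : ∀ n, (Function.support (h n)).OrdConnected)
    (hb : ∀ n, Bornology.IsBounded (Function.support (h n)))
    (hcl : ∀ n, StamClass p ((p - q) / p) (1 - s) (h n)) {A F : ℝ≥0∞}
    (hA : A ≠ 0 ∧ A ≠ ∞) (hF : F ≠ 0 ∧ F ≠ ∞)
    (hM : Tendsto (fun n => ∫⁻ x, ENNReal.ofReal (h n x)) atTop (𝓝 1))
    (hAt : Tendsto (fun n => powInt (1 - s) (h n)) atTop (𝓝 A))
    (hFt : Tendsto (fun n => fisher p ((p - q) / p) (h n)) atTop (𝓝 F)) :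
    c ≤ (A ^ (1 / s) * F ^ (1 / (p - q))) ^ theta2 s p q := by
  have hp := range_ne_zero hrange
  have hrp : ∀ (y : ℝ) {u : ℕ → ℝ≥0∞} {v : ℝ≥0∞}, Tendsto u atTop (𝓝 v) →
      Tendsto (fun n => u n ^ y) atTop (𝓝 (v ^ y)) := fun y u v huv =>
    (ENNReal.continuous_rpow_const.tendsto v).comp huv
  set M : ℕ → ℝ≥0∞ := fun n => ∫⁻ x, ENNReal.ofReal (h n x) with hMd
  set b := (p - q) / p with hbd
  have hMi : Tendsto (fun n => (M n)⁻¹) atTop (𝓝 1) := by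
    simpa using tendsto_inv_iff.2 hM
  have hA1 : Tendsto (fun n => ((M n)⁻¹ ^ (1 - s) * powInt (1 - s) (h n))) atTop (𝓝 A) := by
    have := ENNReal.Tendsto.mul (hrp (1 - s) hMi) (Or.inr hA.2) hAt (Or.inr (by simp))
    simpa using this
  have hF1 : Tendsto (fun n => ((M n)⁻¹ ^ (p * (b - 1) + 1) * fisher p b (h n))) atTop (𝓝 F) := by
    have := ENNReal.Tendsto.mul (hrp (p * (b - 1) + 1) hMi) (Or.inr hF.2) hFt (Or.inr (by simp))
    simpa using this
  have hA2 := ennreal_rpow_ne hA (1 / s)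
  have hF2 := ennreal_rpow_ne hF (1 / (p - q))
  have hlim := hrp (theta2 s p q) (ENNReal.Tendsto.mul (hrp (1 / s) hA1) (Or.inr hF2.2)
    (hrp (1 / (p - q)) hF1) (Or.inr hA2.2))
  refine ge_of_tendsto hlim ?_
  filter_upwards [hM.eventually_ne one_ne_zero, hM.eventually_ne ENNReal.one_ne_top,
    hAt.eventually_ne hA.1, hAt.eventually_ne hA.2] with n hM0 hMt hA0 hAtop
  have hCpos : 0 < ((M n)⁻¹).toReal :=
    ENNReal.toReal_pos (ENNReal.inv_ne_zero.2 hMt) (ENNReal.inv_ne_top.2 hM0)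
  have hC : ENNReal.ofReal ((M n)⁻¹).toReal = (M n)⁻¹ :=
    ENNReal.ofReal_toReal (ENNReal.inv_ne_top.2 hM0)
  have hg : IsDensity fun x => ((M n)⁻¹).toReal * h n x := by
    refine ⟨fun x => mul_nonneg hCpos.le (h0 n x), ?_, ?_, ?_⟩
    · rw [support_const_mul_fun hCpos]; exact ho n
    · rw [support_const_mul_fun hCpos]; exact hoc n
    · simp_rw [ENNReal.ofReal_mul hCpos.le]
      rw [lintegral_const_mul' _ _ ENNReal.ofReal_ne_top, hC]
      exact ENNReal.inv_mul_cancel hM0 hMt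
  have e1 := powInt_const_mul hCpos (h0 n) (1 - s)
  have e2 := fisher_const_mul hCpos (ho n) (h0 n) p b
  rw [hC] at e1 e2
  have hC' := ennreal_rpow_ne (x := (M n)⁻¹)
    ⟨ENNReal.inv_ne_zero.2 hMt, ENNReal.inv_ne_top.2 hM0⟩ (1 - s)
  have := le_stamProduct_of_isBounded hpq hl hrange hc hg ((hcl n).const_mul hCpos)
    (by rw [support_const_mul_fun hCpos]; exact hb n)
    (by rw [e1]; exact ⟨mul_ne_zero hC'.1 hA0, ENNReal.mul_ne_top hC'.2 hAtop⟩)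
  have e3 : renyiPower (1 - s) (fun x => ((M n)⁻¹).toReal * h n x)
      = powInt (1 - s) (fun x => ((M n)⁻¹).toReal * h n x) ^ (1 / s) := by
    rw [renyiPower, powInt, sub_sub_cancel]
  rwa [stamProduct, e3, e1, e2] at this

theorem tendsto_setLIntegral_of_monotone {S : ℕ → Set ℝ} (hS : ∀ n, MeasurableSet (S n))
    (hm : Monotone S) (Φ : ℝ → ℝ≥0∞) :
    Tendsto (fun n => ∫⁻ x in S n, Φ x) atTop (𝓝 (∫⁻ x in ⋃ n, S n, Φ x)) := by
  have := tendsto_measure_iUnion_atTop (μ := volume.withDensity Φ) hm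
  rw [withDensity_apply _ (MeasurableSet.iUnion hS)] at this
  refine this.congr fun n => ?_
  exact withDensity_apply _ (hS n)

end sharpness

section sharpness

variable {p q s l : ℝ} {c : ℝ≥0∞}

theorem LocallyAC.congr {f g : ℝ → ℝ} {I : Set ℝ} (h : LocallyAC f I) (hfg : EqOn f g I) :
    LocallyAC g I := by
  intro a b hab hs
  have h1 := h a b hab hs
  rw [absolutelyContinuousOnInterval_iff] at h1 ⊢
  intro ε hε
  obtain ⟨δ, hδ, h2⟩ := h1 ε hε
  refine ⟨δ, hδ, fun E hE hlt => ?_⟩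
  have h3 := h2 E hE hlt
  rw [← uIcc_of_le hab] at hs
  rwa [Finset.sum_congr rfl fun i hi => by rw [hfg (hs (hE.1 i hi).1), hfg (hs (hE.1 i hi).2)]] at h3

theorem iUnion_Ioo_neg_natCast : ⋃ n : ℕ, Ioo (-(n : ℝ)) n = univ := by
  refine eq_univ_of_forall fun x => ?_
  obtain ⟨n, hn⟩ := exists_nat_gt |x|
  exact mem_iUnion.2 ⟨n, abs_lt.1 hn⟩

theorem monotone_Ioo_neg_natCast : Monotone fun n : ℕ => Ioo (-(n : ℝ)) n := fun _ _ h =>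
  Ioo_subset_Ioo (neg_le_neg (Nat.cast_le.2 h)) (Nat.cast_le.2 h)

theorem kappa2_sharp_of_lt_one (hpq : p ≠ q) (hl : l ≠ 0) (hs : s ≠ 0) (hr : MirroredRange p q s)
    (hc : ∀ f : ℝ → ℝ, Admissible p q s l f → ProductDefined p q s l f → c ≤ dffProduct p q s l f) :
    c ≤ kappa2 s p q := by
  have hrange : ClassicalRange p q s ∨ MirroredRange p q s := Or.inr hr
  have hp := range_ne_zero hrange
  have hp1 := hr.1
  obtain ⟨hg, hgc, hA, hF⟩ := stamMinimizer_spec hpq hs hrange hp1.ne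
  rw [kappa2_eq_stamProduct hp hp1.ne]
  set g := stamMinimizer p ((p - q) / p) (1 - s) with hgd
  set b := (p - q) / p
  obtain ⟨hac, hneg⟩ := hgc.2.2 hp1
  have hsupp : ∀ n : ℕ, Function.support ((Ioo (-(n : ℝ)) n).indicator g)
      = Function.support g ∩ Ioo (-(n : ℝ)) n := fun n => by
    rw [support_indicator, inter_comm]
  have hopen : ∀ n : ℕ, IsOpen (Function.support g ∩ Ioo (-(n : ℝ)) n) := fun n =>
    hg.isOpen_support.inter isOpen_Ioo
  have heq : ∀ n : ℕ, EqOn g ((Ioo (-(n : ℝ)) n).indicator g)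
      (Function.support g ∩ Ioo (-(n : ℝ)) n) := fun n x hx => (indicator_of_mem hx.2 g).symm
  have hder : ∀ n : ℕ, ∀ x ∈ Function.support g ∩ Ioo (-(n : ℝ)) n,
      deriv ((Ioo (-(n : ℝ)) n).indicator g) x = deriv g x := fun n x hx =>
    ((heq n).symm.eventuallyEq_of_mem ((hopen n).mem_nhds hx)).deriv_eq
  have hlim : ∀ Φ : ℝ → ℝ≥0∞, Tendsto
      (fun n : ℕ => ∫⁻ x in Function.support g ∩ Ioo (-(n : ℝ)) n, Φ x) atTop
      (𝓝 (∫⁻ x in Function.support g, Φ x)) := by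
    intro Φ
    have h1 := tendsto_setLIntegral_of_monotone (fun n => (hopen n).measurableSet)
      (fun i j hij => inter_subset_inter_right _ (monotone_Ioo_neg_natCast hij)) Φ
    rwa [← inter_iUnion, iUnion_Ioo_neg_natCast, inter_univ] at h1
  have := le_of_tendsto_of_isBounded hpq hl hrange hc
    (h := fun n : ℕ => (Ioo (-(n : ℝ)) n).indicator g) (A := powInt (1 - s) g)
    (F := fisher p b g) (fun n x => indicator_nonneg (fun y _ => hg.nonneg y) x)
    (fun n => by rw [hsupp]; exact hopen n)
    (fun n => by rw [hsupp]; exact hg.ordConnected_support.inter ordConnected_Ioo)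
    (fun n => by rw [hsupp]; exact (Metric.isBounded_Ioo _ _).subset inter_subset_right)
    (fun n => ⟨fun h => absurd h hp1.not_ge, fun h => absurd h hp1.not_ge, fun _ => by
      rw [hsupp]
      refine ⟨(hac.mono inter_subset_left).congr (heq n), ?_⟩
      filter_upwards [hneg] with x hx hxs
      rw [hder n x hxs]
      exact hx hxs.1⟩) hA hF ?_ ?_ ?_
  · rw [stamProduct]
    have e3 : renyiPower (1 - s) g = powInt (1 - s) g ^ (1 / s) := by
      rw [renyiPower, powInt, sub_sub_cancel]
    rwa [e3]
  · have h1 := hlim fun x => ENNReal.ofReal (g x)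
    rw [setLIntegral_support_ofReal, hg.lintegral_eq_one] at h1
    refine h1.congr fun n => ?_
    rw [← setLIntegral_support_ofReal ((Ioo (-(n : ℝ)) n).indicator g), hsupp]
    exact setLIntegral_congr_fun (hopen n).measurableSet fun x hx => by rw [heq n hx]
  · refine (hlim fun x => ENNReal.ofReal (g x ^ (1 - s))).congr fun n => ?_
    rw [powInt, hsupp]
    exact setLIntegral_congr_fun (hopen n).measurableSet fun x hx => by rw [heq n hx]
  · refine (hlim fun x => ENNReal.ofReal |g x ^ (b - 2) * deriv g x| ^ p *
      ENNReal.ofReal (g x)).congr fun n => ?_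
    rw [fisher, hsupp]
    exact setLIntegral_congr_fun (hopen n).measurableSet fun x hx => by
      rw [hder n x hx, ← heq n hx]

/-! ### The case `p = 1` -/

/-- The tent function raised to a power, supported in `(-1/2, 1/2)`. -/
def tentPow (k x : ℝ) : ℝ := max (1 - 2 * |x|) 0 ^ k

theorem support_tentPow {k : ℝ} (hk : k ≠ 0) :
    Function.support (tentPow k) = Ioo (-(1 / 2)) (1 / 2) := by
  ext x
  rw [Function.mem_support, tentPow, mem_Ioo, ← abs_lt]
  constructor
  · intro h
    by_contra! hx
    rw [max_eq_right (by linarith), Real.zero_rpow hk] at h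
    exact h rfl
  · intro h
    rw [max_eq_left (by linarith)]
    exact (Real.rpow_pos_of_pos (by linarith) _).ne'

theorem tentPow_of_mem {k x : ℝ} (hx : x ∈ Ioo (-(1 / 2) : ℝ) (1 / 2)) :
    0 < 1 - 2 * |x| ∧ tentPow k x = (1 - 2 * |x|) ^ k := by
  rw [mem_Ioo, ← abs_lt] at hx
  exact ⟨by linarith, by rw [tentPow, max_eq_left (by linarith)]⟩

theorem setLIntegral_one_sub_two_mul_abs_rpow {a : ℝ} (ha : -1 < a) :
    ∫⁻ x in Ioo (-(1 / 2) : ℝ) (1 / 2), ENNReal.ofReal ((1 - 2 * |x|) ^ a)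
      = ENNReal.ofReal (1 / (1 + a)) := by
  have h1 : ∫⁻ x in Ioo (-(1 / 2) : ℝ) (1 / 2), ENNReal.ofReal ((1 - 2 * |x|) ^ a)
      = 2 * ∫⁻ x in Ioo (0 : ℝ) (1 / 2), ENNReal.ofReal ((1 - 2 * x) ^ a) := by
    rw [← lintegral_indicator measurableSet_Ioo, lintegral_of_even]
    · rw [setLIntegral_indicator measurableSet_Ioo]
      congr 1
      have : Ioo (-(1 / 2) : ℝ) (1 / 2) ∩ Ioi 0 = Ioo 0 (1 / 2) := by
        ext x
        simp only [mem_inter_iff, mem_Ioo, mem_Ioi]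
        constructor
        · rintro ⟨⟨h1, h2⟩, h3⟩; exact ⟨h3, h2⟩
        · rintro ⟨h1, h2⟩; exact ⟨⟨by linarith, h2⟩, h1⟩
      rw [this]
      exact setLIntegral_congr_fun measurableSet_Ioo fun x hx => by rw [abs_of_pos hx.1]
    · intro z
      have : -z ∈ Ioo (-(1 / 2) : ℝ) (1 / 2) ↔ z ∈ Ioo (-(1 / 2) : ℝ) (1 / 2) := by
        rw [mem_Ioo, ← abs_lt, mem_Ioo, ← abs_lt, abs_neg]
      by_cases hz : z ∈ Ioo (-(1 / 2) : ℝ) (1 / 2)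
      · rw [indicator_of_mem hz, indicator_of_mem (this.2 hz), abs_neg]
      · rw [indicator_of_notMem hz, indicator_of_notMem (mt this.1 hz)]
  have hi : IntervalIntegrable (fun y : ℝ => y ^ a) volume 0 1 :=
    intervalIntegral.intervalIntegrable_rpow' ha
  have h2 : ∫ x in (0 : ℝ)..(1 / 2), (1 - 2 * x) ^ a = 1 / 2 * (1 / (1 + a)) := by
    rw [intervalIntegral.integral_comp_sub_mul (fun y : ℝ => y ^ a) two_ne_zero]
    norm_num
    rw [integral_rpow (Or.inl ha), Real.one_rpow, Real.zero_rpow (by linarith)]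
    field_simp
    ring
  have hi2 : IntervalIntegrable (fun x : ℝ => (1 - 2 * x) ^ a) volume 0 (1 / 2) := by
    have h3 := (hi.comp_sub_left 1).comp_mul_left (c := 2)
    norm_num at h3
    simpa using h3.symm
  have h3 : ∫⁻ x in Ioo (0 : ℝ) (1 / 2), ENNReal.ofReal ((1 - 2 * x) ^ a)
      = ENNReal.ofReal (1 / 2 * (1 / (1 + a))) := by
    rw [← h2, intervalIntegral.integral_of_le (by norm_num), integral_Ioc_eq_integral_Ioo,
      ofReal_integral_eq_lintegral_ofReal]
    · exact ((intervalIntegrable_iff_integrableOn_Ioo_of_le (by norm_num)).1 hi2)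
    · rw [EventuallyLE, ae_restrict_iff' measurableSet_Ioo]
      exact Eventually.of_forall fun x hx => Real.rpow_nonneg (by linarith [hx.2]) _
  rw [h1, h3, ← ENNReal.ofReal_ofNat 2, ← ENNReal.ofReal_mul zero_le_two]
  congr 1
  ring

theorem hasDerivAt_tentPow {k x : ℝ} (hx : x ∈ Ioo (-(1 / 2) : ℝ) (1 / 2)) (hx0 : x ≠ 0) :
    HasDerivAt (tentPow k) (-(2 * (SignType.sign x : ℝ)) * k * (1 - 2 * |x|) ^ (k - 1)) x := by
  have h1 := (((hasDerivAt_abs hx0).const_mul 2).const_sub 1).rpow_const (p := k)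
    (Or.inl (tentPow_of_mem (k := k) hx).1.ne')
  refine h1.congr_of_eventuallyEq ?_
  filter_upwards [isOpen_Ioo.mem_nhds hx] with y hy using (tentPow_of_mem hy).2

theorem fisher_tentPow {k b : ℝ} (hkb : 0 < b * k) :
    fisher 1 b (tentPow k) = ENNReal.ofReal (2 / |b|) := by
  have hk : k ≠ 0 := right_ne_zero_of_mul hkb.ne'
  have hb : 0 < |b| := abs_pos.2 (left_ne_zero_of_mul hkb.ne')
  have h1 : fisher 1 b (tentPow k) = ∫⁻ x in Ioo (-(1 / 2) : ℝ) (1 / 2),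
      ENNReal.ofReal (2 * |k|) * ENNReal.ofReal ((1 - 2 * |x|) ^ (b * k - 1)) := by
    rw [fisher, support_tentPow hk]
    refine setLIntegral_congr_fun_ae measurableSet_Ioo ?_
    filter_upwards [(compl_mem_ae_iff.2 (measure_singleton (0 : ℝ)))] with x hx0 hx
    obtain ⟨hy, hty⟩ := tentPow_of_mem (k := k) hx
    have hsg : |(SignType.sign x : ℝ)| = 1 := by
      rcases lt_or_gt_of_ne hx0 with h | h <;> simp [h]
    rw [(hasDerivAt_tentPow hx hx0).deriv, hty, ENNReal.rpow_one,
      ← ENNReal.ofReal_mul (abs_nonneg _), ← ENNReal.ofReal_mul (by positivity)]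
    congr 1
    simp only [abs_mul, abs_neg, hsg]
    rw [abs_of_pos (Real.rpow_pos_of_pos (Real.rpow_pos_of_pos hy _) _),
      abs_of_pos (Real.rpow_pos_of_pos hy _), ← Real.rpow_mul hy.le,
      show b * k - 1 = k * (b - 2) + (k - 1) + k by ring, Real.rpow_add hy, Real.rpow_add hy]
    norm_num
    ring
  rw [h1, lintegral_const_mul' _ _ ENNReal.ofReal_ne_top,
    setLIntegral_one_sub_two_mul_abs_rpow (by linarith), ← ENNReal.ofReal_mul (by positivity)]
  congr 1
  have : b * k = |b| * |k| := by rw [← abs_mul, abs_of_pos hkb]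
  have hk' : 0 < |k| := abs_pos.2 hk
  rw [add_sub_cancel, this]
  field_simp

theorem powInt_tentPow {k a : ℝ} (hk : k ≠ 0) (ha : -1 < k * a) :
    powInt a (tentPow k) = ENNReal.ofReal (1 / (1 + k * a)) := by
  rw [powInt, support_tentPow hk, ← setLIntegral_one_sub_two_mul_abs_rpow ha]
  refine setLIntegral_congr_fun measurableSet_Ioo fun x hx => ?_
  obtain ⟨hy, hty⟩ := tentPow_of_mem (k := k) hx
  rw [hty, ← Real.rpow_mul hy.le]

theorem tentPow_nonneg (k x : ℝ) : 0 ≤ tentPow k x := Real.rpow_nonneg (le_max_right _ _) _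

theorem tentPow_le {k x y : ℝ} (hk : 0 ≤ k) (hxy : |x| ≤ |y|) : tentPow k y ≤ tentPow k x :=
  Real.rpow_le_rpow (le_max_right _ _) (max_le_max_right _ (by linarith)) hk

theorem le_tentPow {k x y : ℝ} (hk : k ≤ 0) (hxy : |x| ≤ |y|)
    (hy : y ∈ Ioo (-(1 / 2) : ℝ) (1 / 2)) : tentPow k x ≤ tentPow k y := by
  obtain ⟨hy', hty⟩ := tentPow_of_mem (k := k) hy
  have hx : x ∈ Ioo (-(1 / 2) : ℝ) (1 / 2) := by
    rw [mem_Ioo, ← abs_lt] at hy ⊢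
    linarith
  rw [hty, (tentPow_of_mem hx).2]
  exact Real.rpow_le_rpow_of_nonpos hy' (by linarith) hk

theorem continuousOn_tentPow {k : ℝ} : ContinuousOn (tentPow k) (Ioo (-(1 / 2)) (1 / 2)) := by
  have : ContinuousOn (fun x : ℝ => (1 - 2 * |x|) ^ k) (Ioo (-(1 / 2)) (1 / 2)) := by
    refine ContinuousOn.rpow_const (by fun_prop) fun x hx => Or.inl ?_
    exact (tentPow_of_mem (k := k) hx).1.ne'
  exact this.congr fun x hx => (tentPow_of_mem hx).2

theorem locallyAC_tentPow_of_pos {k : ℝ} (hk : 0 < k) : LocallyAC (tentPow k) univ := by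
  refine locallyAC_univ_of_unimodal (s := {0}) ?_ ?_ (countable_singleton 0) ?_ ?_ ?_
  · unfold tentPow
    exact (by fun_prop : Continuous fun x : ℝ => max (1 - 2 * |x|) 0).rpow_const
      fun _ => Or.inr hk.le
  · rw [support_tentPow hk.ne']
    exact ordConnected_Ioo
  · rw [support_tentPow hk.ne']
    exact fun x hx => (hasDerivAt_tentPow hx.1 hx.2).differentiableAt
  · intro x hx y hy hxy
    refine tentPow_le hk.le ?_
    rw [abs_of_nonpos (show x ≤ 0 from hx), abs_of_nonpos (show y ≤ 0 from hy)]
    linarith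
  · intro x hx y hy hxy
    refine tentPow_le hk.le ?_
    rwa [abs_of_nonneg hx, abs_of_nonneg hy]

theorem locallyAC_tentPow_of_neg {k : ℝ} (hk : k < 0) :
    LocallyAC (tentPow k) (Ioo (-(1 / 2)) (1 / 2)) := by
  intro a b hab hsub
  refine absolutelyContinuousOnInterval_of_unimodal (c := 0) (s := {0}) hab
    (countable_singleton 0) (continuousOn_tentPow.mono hsub)
    (fun x hx => (hasDerivAt_tentPow (hsub (Ioo_subset_Icc_self hx.1)) hx.2).differentiableAt)
    (Or.inr ?_) (Or.inl ?_)
  · intro x hx y hy hxy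
    refine le_tentPow hk.le ?_ (hsub hx.1)
    rw [abs_of_nonpos (show x ≤ 0 from hx.2), abs_of_nonpos (show y ≤ 0 from hy.2)]
    linarith
  · intro x hx y hy hxy
    refine le_tentPow hk.le ?_ (hsub hy.1)
    rwa [abs_of_nonneg hx.2, abs_of_nonneg hy.2]

theorem tendsto_tentPow_atTop {k e : ℝ} (hk : k < 0)
    (he : e ∈ frontier (Ioo (-(1 / 2) : ℝ) (1 / 2))) :
    Tendsto (tentPow k) (𝓝[Ioo (-(1 / 2)) (1 / 2)] e) atTop := by
  have he' : 1 - 2 * |e| = 0 := by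
    rw [frontier_Ioo (by norm_num)] at he
    rcases he with rfl | rfl <;> norm_num [abs_of_pos]
  have h1 : Tendsto (fun x : ℝ => 1 - 2 * |x|) (𝓝[Ioo (-(1 / 2)) (1 / 2)] e) (𝓝[>] 0) := by
    refine tendsto_nhdsWithin_iff.2 ⟨?_, ?_⟩
    · have h2 : Tendsto (fun x : ℝ => 1 - 2 * |x|) (𝓝 e) (𝓝 (1 - 2 * |e|)) :=
        (by fun_prop : Continuous fun x : ℝ => 1 - 2 * |x|).tendsto e
      rw [he'] at h2
      exact h2.mono_left nhdsWithin_le_nhds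
    · filter_upwards [self_mem_nhdsWithin] with x hx using (tentPow_of_mem (k := k) hx).1
  refine ((tendsto_rpow_neg_nhdsGT_zero hk).comp h1).congr' ?_
  filter_upwards [self_mem_nhdsWithin] with x hx using (tentPow_of_mem hx).2.symm

theorem kappa2_sharp_of_eq_one (hpq : p ≠ q) (hl : l ≠ 0) (hr : ClassicalRange p q s)
    (hp1 : p = 1)
    (hc : ∀ f : ℝ → ℝ, Admissible p q s l f → ProductDefined p q s l f → c ≤ dffProduct p q s l f) :
    c ≤ kappa2 s p q := by
  have hrange : ClassicalRange p q s ∨ MirroredRange p q s := Or.inl hr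
  have hp := range_ne_zero hrange
  have hθ := hr.mul_pos
  have hb := base_ne_zero hp hpq
  set b := (p - q) / p with hbd
  have hb' : 0 < |b| := abs_pos.2 hb
  set ε : ℕ → ℝ := fun n => 1 / ((n : ℝ) + 1) with hε
  have hε0 : ∀ n, 0 < ε n := fun n => Nat.one_div_pos_of_nat
  have hε1 : ∀ n, ε n ≤ 1 := fun n => by
    have := Nat.one_div_le_one_div (α := ℝ) (Nat.zero_le n)
    simpa [hε] using this
  have hεt : Tendsto ε atTop (𝓝 0) := tendsto_one_div_add_atTop_nhds_zero_nat
  set η : ℝ := b / (|b| * (2 * (1 + |1 - s|))) with hη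
  set k : ℕ → ℝ := fun n => η * ε n with hk
  have hbη : 0 < b * η := by
    have : b * η = b ^ 2 / (|b| * (2 * (1 + |1 - s|))) := by rw [hη]; ring
    rw [this]; positivity
  have hηabs : |η| = 1 / (2 * (1 + |1 - s|)) := by
    rw [hη, abs_div, abs_mul, abs_abs, abs_of_pos (by positivity : 0 < 2 * (1 + |1 - s|))]
    field_simp
  have hkb : ∀ n, 0 < b * k n := fun n => by
    rw [hk, ← mul_assoc]; exact mul_pos hbη (hε0 n)
  have hk0 : ∀ n, k n ≠ 0 := fun n => right_ne_zero_of_mul (hkb n).ne'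
  have hkabs : ∀ n, |k n| ≤ 1 / (2 * (1 + |1 - s|)) := fun n => by
    rw [hk, abs_mul, hηabs, abs_of_pos (hε0 n)]
    exact mul_le_of_le_one_right (by positivity) (hε1 n)
  have hk1 : ∀ (a : ℝ) n, |a| ≤ 1 + |1 - s| → -1 < k n * a := fun a n ha => by
    have h1 : |k n * a| ≤ 1 / 2 := by
      rw [abs_mul]
      calc |k n| * |a| ≤ 1 / (2 * (1 + |1 - s|)) * (1 + |1 - s|) :=
            mul_le_mul (hkabs n) ha (abs_nonneg _) (by positivity)
        _ = 1 / 2 := by field_simp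
    linarith [neg_abs_le (k n * a)]
  have hkt : Tendsto k atTop (𝓝 0) := by simpa using hεt.const_mul η
  have hpow : ∀ a : ℝ, |a| ≤ 1 + |1 - s| →
      Tendsto (fun n => powInt a (tentPow (k n))) atTop (𝓝 1) := fun a ha => by
    have h1 : Tendsto (fun n => ENNReal.ofReal (1 / (1 + k n * a))) atTop
        (𝓝 (ENNReal.ofReal (1 / (1 + 0 * a)))) :=
      ENNReal.tendsto_ofReal (tendsto_const_nhds.div
        (tendsto_const_nhds.add (hkt.mul_const a)) (by simp))
    simp only [zero_mul, add_zero, div_one, ENNReal.ofReal_one] at h1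
    exact h1.congr fun n => (powInt_tentPow (hk0 n) (hk1 a n ha)).symm
  have := le_of_tendsto_of_isBounded hpq hl hrange hc (h := fun n => tentPow (k n)) (A := 1)
    (F := ENNReal.ofReal (2 / |b|)) (fun n => tentPow_nonneg _)
    (fun n => by rw [support_tentPow (hk0 n)]; exact isOpen_Ioo)
    (fun n => by rw [support_tentPow (hk0 n)]; exact ordConnected_Ioo)
    (fun n => by rw [support_tentPow (hk0 n)]; exact Metric.isBounded_Ioo _ _)
    (fun n => ?_) ⟨one_ne_zero, ENNReal.one_ne_top⟩
    ⟨(ENNReal.ofReal_pos.2 (by positivity)).ne', ENNReal.ofReal_ne_top⟩ ?_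
    (hpow (1 - s) (by linarith)) ?_
  · rw [kappa2, kappa1, if_pos hp1, theta1_eq_theta2 hp]
    rw [ENNReal.one_rpow, one_mul, ← ENNReal.rpow_mul, ENNReal.ofReal_rpow_of_pos (by positivity)]
      at this
    refine this.trans_eq ?_
    congr 2
    rw [← hbd, hbd, hp1, div_one]
    ring
  · have e : 1 + b - (1 - s) = b + s := by ring
    rw [StamClass, e, support_tentPow (hk0 n)]
    refine ⟨fun _ h => locallyAC_tentPow_of_pos ?_, fun _ h => ?_, fun h => absurd hr.1 h.not_ge⟩
    · have hb1 : 0 < b := (mul_pos_iff_of_pos_right h).1 hθ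
      exact (mul_pos_iff_of_pos_left hb1).1 (hkb n)
    · have hb1 : b < 0 := by
        by_contra! h1
        exact (mul_nonpos_of_nonneg_of_nonpos h1 h.le).not_gt hθ
      have hk2 : k n < 0 := by
        by_contra! h1
        exact (mul_nonpos_of_nonpos_of_nonneg hb1.le h1).not_gt (hkb n)
      exact ⟨locallyAC_tentPow_of_neg hk2, fun e he => tendsto_tentPow_atTop hk2 he⟩
  · have h1 := hpow 1 (by simp)
    refine h1.congr fun n => ?_
    simp only [powInt, Real.rpow_one, setLIntegral_support_ofReal]
  · rw [← hbd, hp1]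
    simp only [fisher_tentPow (hkb _)]
    exact tendsto_const_nhds

end sharpness

section truncation

variable {κ ε : ℝ} {g : ℝ → ℝ}

/-- The function `((g^κ - ε)_+)^{1/κ}`. -/
def powTrunc (κ ε : ℝ) (g : ℝ → ℝ) (x : ℝ) : ℝ := max (g x ^ κ - ε) 0 ^ (1 / κ)

theorem powTrunc_nonneg (x : ℝ) : 0 ≤ powTrunc κ ε g x := Real.rpow_nonneg (le_max_right _ _) _

theorem mem_support_powTrunc (hκ : 0 < κ) {x : ℝ} :
    x ∈ Function.support (powTrunc κ ε g) ↔ ε < g x ^ κ := by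
  rw [Function.mem_support, powTrunc]
  constructor
  · intro h
    by_contra! hx
    rw [max_eq_right (by linarith), Real.zero_rpow (by positivity)] at h
    exact h rfl
  · intro h
    rw [max_eq_left (by linarith)]
    exact (Real.rpow_pos_of_pos (by linarith) _).ne'

theorem mem_support_of_powTrunc (hκ : 0 < κ) (hε : 0 < ε) {x : ℝ}
    (hx : x ∈ Function.support (powTrunc κ ε g)) : x ∈ Function.support g := by
  rw [mem_support_powTrunc hκ] at hx
  intro h
  rw [h, Real.zero_rpow hκ.ne'] at hx
  linarith

theorem powTrunc_le_powTrunc (hκ : 0 < κ) {x y : ℝ} (h0 : 0 ≤ g x) (h : g x ≤ g y) :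
    powTrunc κ ε g x ≤ powTrunc κ ε g y :=
  Real.rpow_le_rpow (le_max_right _ _)
    (max_le_max_right _ (sub_le_sub_right (Real.rpow_le_rpow h0 h hκ.le) _)) (by positivity)

theorem continuous_powTrunc (hκ : 0 < κ) (hg : Continuous g) : Continuous (powTrunc κ ε g) :=
  (((hg.rpow_const fun _ => Or.inr hκ.le).sub continuous_const).max continuous_const).rpow_const
    fun _ => Or.inr (by positivity)

theorem hasDerivAt_powTrunc (hκ : 0 < κ) (hε : 0 < ε) (hc : Continuous g)
    {x d : ℝ} (hx : x ∈ Function.support (powTrunc κ ε g)) (hd : HasDerivAt g d x) :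
    HasDerivAt (powTrunc κ ε g) (powTrunc κ ε g x ^ (1 - κ) * (g x ^ (κ - 1) * d)) x := by
  have hxs := mem_support_of_powTrunc hκ hε hx
  have hpos : 0 < g x ^ κ - ε := sub_pos.2 ((mem_support_powTrunc hκ).1 hx)
  have h1 := ((hd.rpow_const (p := κ) (Or.inl hxs)).sub_const ε).rpow_const (p := 1 / κ)
    (Or.inl hpos.ne')
  have h2 : powTrunc κ ε g =ᶠ[𝓝 x] fun y => (g y ^ κ - ε) ^ (1 / κ) := by
    filter_upwards [(continuous_powTrunc hκ hc).isOpen_support.mem_nhds hx] with y hy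
    rw [powTrunc, max_eq_left (sub_pos.2 ((mem_support_powTrunc hκ).1 hy)).le]
  refine (h1.congr_of_eventuallyEq h2).congr_deriv ?_
  rw [powTrunc, max_eq_left hpos.le, ← Real.rpow_mul hpos.le,
    show 1 / κ * (1 - κ) = 1 / κ - 1 by field_simp]
  field_simp

theorem powInt_eq_lintegral {a : ℝ} (ha : a ≠ 0) (g : ℝ → ℝ) :
    powInt a g = ∫⁻ x, ENNReal.ofReal (g x ^ a) := by
  refine setLIntegral_eq_of_support_subset ?_
  intro x hx h0
  simp [h0, Real.zero_rpow ha] at hx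

theorem tendsto_powInt_powTrunc (hκ : 0 < κ) (hc : Continuous g) (h0 : ∀ x, 0 ≤ g x)
    {a : ℝ} (ha : 0 < a) {ε : ℕ → ℝ} (hε : Antitone ε) (hε0 : Tendsto ε atTop (𝓝 0)) :
    Tendsto (fun n => powInt a (powTrunc κ (ε n) g)) atTop (𝓝 (powInt a g)) := by
  simp_rw [powInt_eq_lintegral ha.ne']
  refine lintegral_tendsto_of_tendsto_of_monotone (fun n => ?_) (Eventually.of_forall fun x => ?_)
    (Eventually.of_forall fun x => ?_)
  · exact ((continuous_powTrunc hκ hc).rpow_const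
      fun _ => Or.inr ha.le).measurable.ennreal_ofReal.aemeasurable
  · intro i j hij
    refine ENNReal.ofReal_le_ofReal (Real.rpow_le_rpow (powTrunc_nonneg _) ?_ ha.le)
    exact Real.rpow_le_rpow (le_max_right _ _) (max_le_max_right _ (sub_le_sub_left (hε hij) _))
      (by positivity)
  · refine ENNReal.tendsto_ofReal (Tendsto.rpow_const ?_ (Or.inr ha.le))
    have h1 : Tendsto (fun n => powTrunc κ (ε n) g x) atTop (𝓝 (max (g x ^ κ - 0) 0 ^ (1 / κ))) :=
      (((tendsto_const_nhds.sub hε0).max tendsto_const_nhds).rpow_const (Or.inr (by positivity)))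
    rwa [sub_zero, max_eq_left (Real.rpow_nonneg (h0 x) _), ← Real.rpow_mul (h0 x),
      mul_one_div_cancel hκ.ne', Real.rpow_one] at h1

theorem fisher_powTrunc (hκ : 0 < κ) (hε : 0 < ε) (hc : Continuous g) (h0 : ∀ x, 0 ≤ g x)
    (hd : ∀ᵐ x, x ∈ Function.support g → DifferentiableAt ℝ g x) {p b : ℝ} (hp : 0 < p)
    (hκb : κ = b - (p - 1) / p) :
    fisher p b (powTrunc κ ε g) = ∫⁻ x in {x | ε < g x ^ κ},
      ENNReal.ofReal |g x ^ (b - 2) * deriv g x| ^ p * ENNReal.ofReal (g x) := by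
  have hS : Function.support (powTrunc κ ε g) = {x | ε < g x ^ κ} :=
    Set.ext fun x => mem_support_powTrunc hκ
  have key : ∀ u v D : ℝ, 0 < u → ENNReal.ofReal |u ^ (b - 2) * (u ^ (1 - κ) * D)| ^ p *
      ENNReal.ofReal u = ENNReal.ofReal |D| ^ p := by
    intro u v D hu
    rw [← mul_assoc, ← Real.rpow_add hu, abs_mul, abs_of_pos (Real.rpow_pos_of_pos hu _),
      ENNReal.ofReal_mul (by positivity), ENNReal.mul_rpow_of_nonneg _ _ hp.le,
      ENNReal.ofReal_rpow_of_pos (by positivity), ← Real.rpow_mul hu.le, mul_right_comm,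
      ← ENNReal.ofReal_mul (by positivity), ← Real.rpow_add_one hu.ne',
      show (b - 2 + (1 - κ)) * p + 1 = 0 by rw [hκb]; field_simp; ring, Real.rpow_zero,
      ENNReal.ofReal_one, one_mul]
  rw [← hS, fisher]
  refine setLIntegral_congr_fun_ae (continuous_powTrunc hκ hc).isOpen_support.measurableSet ?_
  filter_upwards [hd] with x hx hxs
  have hxg := mem_support_of_powTrunc hκ hε hxs
  have hg0 : 0 < g x := lt_of_le_of_ne (h0 x) (Ne.symm hxg)
  have ht0 : 0 < powTrunc κ ε g x := lt_of_le_of_ne (powTrunc_nonneg x) (Ne.symm hxs)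
  rw [(hasDerivAt_powTrunc hκ hε hc hxs (hx hxg).hasDerivAt).deriv, key _ 0 _ ht0,
    ← key _ 0 _ hg0]
  congr 4
  rw [← mul_assoc (g x ^ (1 - κ)), ← Real.rpow_add hg0]
  simp

theorem tendsto_fisher_powTrunc (hκ : 0 < κ) (hc : Continuous g) (h0 : ∀ x, 0 ≤ g x)
    (hd : ∀ᵐ x, x ∈ Function.support g → DifferentiableAt ℝ g x) {p b : ℝ} (hp : 0 < p)
    (hκb : κ = b - (p - 1) / p) {ε : ℕ → ℝ} (hε : Antitone ε) (hεp : ∀ n, 0 < ε n)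
    (hε0 : Tendsto ε atTop (𝓝 0)) :
    Tendsto (fun n => fisher p b (powTrunc κ (ε n) g)) atTop (𝓝 (fisher p b g)) := by
  simp_rw [fun n => fisher_powTrunc hκ (hεp n) hc h0 hd hp hκb]
  have hU : ⋃ n, {x | ε n < g x ^ κ} = Function.support g := by
    ext x
    rw [mem_iUnion]
    constructor
    · rintro ⟨n, hn⟩
      exact mem_support_of_powTrunc hκ (hεp n) ((mem_support_powTrunc hκ).2 hn)
    · intro hx
      have hg0 : 0 < g x := lt_of_le_of_ne (h0 x) (Ne.symm hx)
      exact ((tendsto_order.1 hε0).2 _ (Real.rpow_pos_of_pos hg0 κ)).exists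
  rw [fisher, ← hU]
  refine tendsto_setLIntegral_of_monotone (fun n => ?_) (fun i j hij x hx => ?_) _
  · exact (isOpen_lt continuous_const (hc.rpow_const fun _ => Or.inr hκ.le)).measurableSet
  · exact (hε hij).trans_lt hx

theorem isBounded_support_powTrunc (hκ : 0 < κ) (hε : 0 < ε) (hg : IsDensity g)
    (hu : ∀ x y, (0 ≤ x ∧ x ≤ y ∨ y ≤ x ∧ x ≤ 0) → g y ≤ g x) :
    Bornology.IsBounded (Function.support (powTrunc κ ε g)) := by
  set δ := ε ^ (1 / κ) with hδ
  have hδ0 : 0 < δ := Real.rpow_pos_of_pos hε _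
  refine (Metric.isBounded_Icc (-(1 / δ)) (1 / δ)).subset fun y hy => ?_
  rw [mem_support_powTrunc hκ] at hy
  have hyδ : δ ≤ g y := by
    have h1 := Real.rpow_le_rpow hε.le hy.le (z := 1 / κ) (by positivity)
    rwa [← Real.rpow_mul (hg.nonneg y), mul_one_div_cancel hκ.ne', Real.rpow_one] at h1
  have h1 : ∫⁻ _ in uIcc 0 y, ENNReal.ofReal δ ≤ 1 := by
    rw [← hg.lintegral_eq_one]
    refine (setLIntegral_mono' measurableSet_uIcc fun x hx => ?_).trans
      (setLIntegral_le_lintegral _ _)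
    refine ENNReal.ofReal_le_ofReal (hyδ.trans (hu _ _ ?_))
    rcases le_total 0 y with h | h
    · rw [uIcc_of_le h] at hx; exact Or.inl hx
    · rw [uIcc_of_ge h] at hx; exact Or.inr hx
  rw [setLIntegral_const, Real.volume_interval, ← ENNReal.ofReal_mul hδ0.le, ENNReal.ofReal_le_one,
    sub_zero] at h1
  rw [mem_Icc, ← abs_le, le_div_iff₀ hδ0]
  linarith

end truncation

section sharpness

variable {p q s l : ℝ} {c : ℝ≥0∞}

theorem isBounded_of_volume_ne_top {S : Set ℝ} (hS : S.OrdConnected) (h0 : (0 : ℝ) ∈ S)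
    (hv : volume S ≠ ∞) : Bornology.IsBounded S := by
  refine (Metric.isBounded_Icc (-(volume S).toReal) (volume S).toReal).subset fun x hx => ?_
  have h1 := measure_mono (μ := volume) (hS.uIcc_subset h0 hx)
  rw [Real.volume_interval, sub_zero] at h1
  rw [mem_Icc, ← abs_le]
  exact (ENNReal.ofReal_le_iff_le_toReal hv).1 h1

theorem IsUnimodalProfile.volume_support_escort_ne_top {h : ℝ → ℝ} (hh : IsUnimodalProfile h)
    {e : ℝ} (he : e < 0) : volume (Function.support (escort e h)) ≠ ∞ := by
  have h1 : volume (Function.support (escort e h)) = powInt (1 - e + e * 0) h := by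
    rw [← hh.powInt_escort, powInt]
    simp
  have h2 : powInt (1 - e + e * 0) h ≤ ENNReal.ofReal (h 0 ^ (-e)) * ∫⁻ x, ENNReal.ofReal (h x) := by
    rw [← setLIntegral_support_ofReal, ← lintegral_const_mul' _ _ ENNReal.ofReal_ne_top, powInt]
    refine setLIntegral_mono' hh.isOpen_support.measurableSet fun x hx => ?_
    rw [← ENNReal.ofReal_mul (Real.rpow_nonneg (hh.nonneg 0) _)]
    refine ENNReal.ofReal_le_ofReal ?_
    rw [show 1 - e + e * 0 = -e + 1 by ring, Real.rpow_add_one (hh.pos hx).ne']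
    refine mul_le_mul_of_nonneg_right (Real.rpow_le_rpow (hh.nonneg x) (hh.anti _ _ ?_)
      (by linarith)) (hh.nonneg x)
    simp
  rw [h1]
  refine ne_top_of_le_ne_top ?_ h2
  rw [hh.lintegral_eq_one, mul_one]
  exact ENNReal.ofReal_ne_top

theorem kappa2_sharp_of_one_lt (hpq : p ≠ q) (hl : l ≠ 0) (hs : s ≠ 0) (hr : ClassicalRange p q s)
    (hp1 : 1 < p) (hb : (p - q) / p < 0 ∨ (p - 1) / p < (p - q) / p)
    (hc : ∀ f : ℝ → ℝ, Admissible p q s l f → ProductDefined p q s l f → c ≤ dffProduct p q s l f) :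
    c ≤ kappa2 s p q := by
  have hrange : ClassicalRange p q s ∨ MirroredRange p q s := Or.inl hr
  have hp := range_ne_zero hrange
  have hp0 : 0 < p := by linarith
  obtain ⟨hg, hgc, hA, hF⟩ := stamMinimizer_spec hpq hs hrange hp1.ne'
  rw [kappa2_eq_stamProduct hp hp1.ne']
  have hθ := hr.mul_pos
  have hb0 := base_ne_zero hp hpq
  have hG := isUnimodalProfile_classical hp1 hb0 hs hθ (hr.div_lt hp1)
  have hexact : volume (Function.support (stamMinimizer p ((p - q) / p) (1 - s))) ≠ ∞ →
      c ≤ stamProduct p q s (stamMinimizer p ((p - q) / p) (1 - s)) := fun hv =>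
    le_stamProduct_of_isBounded hpq hl hrange hc hg hgc
      (isBounded_of_volume_ne_top hg.ordConnected_support
        (by rw [stamMinimizer_of_one_lt hp1]; exact hG.zero_mem_support_escort) hv) hA
  rcases hb with hb | hb
  · refine hexact ?_
    rw [stamMinimizer_of_one_lt hp1]
    refine hG.volume_support_escort_ne_top (one_div_neg.2 ?_)
    by_contra! h
    exact (mul_nonpos_of_nonpos_of_nonneg hb.le h).not_gt hθ
  have hbp : 0 < (p - q) / p := lt_trans (div_pos (by linarith) hp0) hb
  have hθp : 0 < (p - q) / p + s := (mul_pos_iff_of_pos_left hbp).1 hθ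
  have he : 0 < 1 / ((p - q) / p + s) := by positivity
  have hcont : Continuous (stamMinimizer p ((p - q) / p) (1 - s)) := by
    rw [stamMinimizer_of_one_lt hp1]; exact hG.continuous_escort he
  have huni : ∀ x y, (0 ≤ x ∧ x ≤ y ∨ y ≤ x ∧ x ≤ 0) →
      stamMinimizer p ((p - q) / p) (1 - s) y ≤ stamMinimizer p ((p - q) / p) (1 - s) x := by
    rw [stamMinimizer_of_one_lt hp1]
    exact fun x y hxy => hG.escort_le_of_between he.le hxy
  have hdiff : ∀ x ∈ Function.support (stamMinimizer p ((p - q) / p) (1 - s)), x ≠ 0 →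
      DifferentiableAt ℝ (stamMinimizer p ((p - q) / p) (1 - s)) x := by
    rw [stamMinimizer_of_one_lt hp1]
    exact fun x hx hx0 => hG.differentiableAt_escort hx hx0
  have h0mem : (0 : ℝ) ∈ Function.support (stamMinimizer p ((p - q) / p) (1 - s)) := by
    rw [stamMinimizer_of_one_lt hp1]; exact hG.zero_mem_support_escort
  set g := stamMinimizer p ((p - q) / p) (1 - s) with hgd
  set b := (p - q) / p with hbd
  have hmax : ∀ x, g x ≤ g 0 := fun x => huni 0 x (by
    rcases le_total 0 x with h | h
    · exact Or.inl ⟨le_rfl, h⟩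
    · exact Or.inr ⟨h, le_rfl⟩)
  rcases le_or_gt 1 s with hs1 | hs1
  · refine hexact fun hv => hA.2 (top_unique ?_)
    have hpos : 0 < g 0 ^ (1 - s) := Real.rpow_pos_of_pos (hg.pos h0mem) _
    calc ∞ = ∫⁻ _ in Function.support g, ENNReal.ofReal (g 0 ^ (1 - s)) := by
          rw [setLIntegral_const, hv, ENNReal.mul_top (ENNReal.ofReal_pos.2 hpos).ne']
      _ ≤ powInt (1 - s) g := setLIntegral_mono' hg.isOpen_support.measurableSet fun x hx =>
          ENNReal.ofReal_le_ofReal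
            (Real.rpow_le_rpow_of_nonpos (hg.pos hx) (hmax x) (by linarith))
  set κ := b - (p - 1) / p with hκ
  have hκ0 : 0 < κ := sub_pos.2 hb
  set ε : ℕ → ℝ := fun n => 1 / ((n : ℝ) + 1) with hε
  have hεp : ∀ n, 0 < ε n := fun n => Nat.one_div_pos_of_nat
  have hεt : Tendsto ε atTop (𝓝 0) := tendsto_one_div_add_atTop_nhds_zero_nat
  have hεa : Antitone ε := fun i j hij => Nat.one_div_le_one_div hij
  have hmono : ∀ n x y, (0 ≤ x ∧ x ≤ y ∨ y ≤ x ∧ x ≤ 0) →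
      powTrunc κ (ε n) g y ≤ powTrunc κ (ε n) g x := fun n x y hxy =>
    powTrunc_le_powTrunc hκ0 (hg.nonneg y) (huni x y hxy)
  have hord : ∀ n, (Function.support (powTrunc κ (ε n) g)).OrdConnected := fun n => by
    refine ⟨fun x hx y hy z hz => ?_⟩
    have hx' : 0 < powTrunc κ (ε n) g x := lt_of_le_of_ne (powTrunc_nonneg x) (Ne.symm hx)
    have hy' : 0 < powTrunc κ (ε n) g y := lt_of_le_of_ne (powTrunc_nonneg y) (Ne.symm hy)
    rcases le_total 0 z with h | h
    · exact (hy'.trans_le (hmono n z y (Or.inl ⟨h, hz.2⟩))).ne'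
    · exact (hx'.trans_le (hmono n z x (Or.inr ⟨hz.1, h⟩))).ne'
  have hdae : ∀ᵐ x, x ∈ Function.support g → DifferentiableAt ℝ g x := by
    filter_upwards [(compl_mem_ae_iff.2 (measure_singleton (0 : ℝ)))] with x hx0 hx
    exact hdiff x hx hx0
  have := le_of_tendsto_of_isBounded hpq hl hrange hc (h := fun n => powTrunc κ (ε n) g)
    (A := powInt (1 - s) g) (F := fisher p b g) (fun n => powTrunc_nonneg)
    (fun n => (continuous_powTrunc hκ0 hcont).isOpen_support) hord
    (fun n => isBounded_support_powTrunc hκ0 (hεp n) hg huni)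
    (fun n => ⟨fun _ _ => ?_, fun _ h => absurd h (by linarith), fun h => absurd h hp1.not_gt⟩)
    hA hF ?_ (tendsto_powInt_powTrunc hκ0 hcont hg.nonneg (by linarith) hεa hεt)
    (tendsto_fisher_powTrunc hκ0 hcont hg.nonneg hdae hp0 hκ hεa hεp hεt)
  · rw [stamProduct]
    have e3 : renyiPower (1 - s) g = powInt (1 - s) g ^ (1 / s) := by
      rw [renyiPower, powInt, sub_sub_cancel]
    rwa [e3]
  · refine locallyAC_univ_of_unimodal (s := {0}) (continuous_powTrunc hκ0 hcont) (hord n)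
      (countable_singleton 0) (fun x hx => ?_)
      (fun x _ y hy hxy => hmono n y x (Or.inr ⟨hxy, hy⟩))
      (fun x hx y _ hxy => hmono n x y (Or.inl ⟨hx, hxy⟩))
    exact (hasDerivAt_powTrunc hκ0 (hεp n) hcont hx.1
      (hdiff x (mem_support_of_powTrunc hκ0 (hεp n) hx.1) hx.2).hasDerivAt).differentiableAt
  · have h1 := tendsto_powInt_powTrunc hκ0 hcont hg.nonneg one_pos hεa hεt
    simpa only [powInt, Real.rpow_one, setLIntegral_support_ofReal, hg.lintegral_eq_one] using h1

end sharpness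

end DownFisher

end

open DownFisher in
theorem mainTheorem4 (p q s l : ℝ) (hpq : p ≠ q) (hl : l ≠ 0) (hs : s ≠ 0)
    (hrange : ClassicalRange p q s ∨ MirroredRange p q s) :
    -- the constant is a positive real number
    (0 < kappa2 s p q ∧ kappa2 s p q < ∞) ∧
    -- the inequality
    (∀ f : ℝ → ℝ, Admissible p q s l f → ProductDefined p q s l f →
      kappa2 s p q ≤ dffProduct p q s l f) ∧
    -- the inequality for every up transform of an absolutely continuous density
    (∀ g : ℝ → ℝ, IsDensity g → StamClass p ((p - q) / p) (1 - s) g → UpDefined (2 - l) g →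
      ProductDefined p q s l (up (2 - l) g) →
      kappa2 s p q ≤ dffProduct p q s l (up (2 - l) g)) ∧
    -- the up transforms of the (translated) Stam minimizers are minimizers
    (p ≠ 1 → ∀ m : ℝ, ∀ g : ℝ → ℝ,
      g = (fun x => stamMinimizer p ((p - q) / p) (1 - s) (x - m)) →
      IsDensity g ∧ StamClass p ((p - q) / p) (1 - s) g ∧
      (UpDefined (2 - l) g →
        ∫⁻ x, ENNReal.ofReal (up (2 - l) g x) = 1 ∧
        dffProduct p q s l (up (2 - l) g) = kappa2 s p q) ∧
      (Function.support g ⊆ {x | 0 < -l * x} →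
        UpDefined (2 - l) g ∧ Admissible p q s l (up (2 - l) g) ∧ down (2 - l) (up (2 - l) g) = g)) ∧
    -- the constant is the best possible one
    (p ≤ 1 ∨ (p - q) / p < 0 ∨ (p - 1) / p < (p - q) / p →
      ∀ c : ℝ≥0∞, (∀ f : ℝ → ℝ, Admissible p q s l f → ProductDefined p q s l f →
        c ≤ dffProduct p q s l f) → c ≤ kappa2 s p q) := by
  have hp := range_ne_zero hrange
  have hac : ∀ g : ℝ → ℝ, StamClass p ((p - q) / p) (1 - s) g →
      LocallyAC g (Function.support g) := fun g hg => hg.locallyAC (range_theta_ne hrange)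
  refine ⟨kappa2_pos_lt_top hpq hs hrange, fun f hf hd => ?_, fun g hg hgc hu hd => ?_,
    fun hp1 m g hgm => ?_, fun hb c hc => ?_⟩
  · exact kappa2_le_dffProduct hpq hl hs hrange (upPair_down hf.1 hl) (isDensity_down hf.1 hl)
      hf.2 hd
  · exact kappa2_le_dffProduct hpq hl hs hrange
      (upPair_up hg hl hu ((hac g hgc).continuousOn hg.isOpen_support)) hg hgc hd
  · obtain ⟨h1, h2, -, -⟩ := stamMinimizer_spec hpq hs hrange hp1
    have hg : IsDensity g := hgm ▸ h1.comp_sub_right m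
    have hgc : StamClass p ((p - q) / p) (1 - s) g := hgm ▸ h2.comp_sub_right m
    have hcont := (hac g hgc).continuousOn hg.isOpen_support
    refine ⟨hg, hgc, fun hu => ?_, fun hsub => ?_⟩
    · have hv := upPair_up hg hl hu hcont
      refine ⟨hv.lintegral_ofReal_eq.trans hg.lintegral_eq_one, ?_⟩
      rw [hv.dffProduct_eq hl hp hpq s ((hac g hgc).ae_differentiableAt hg.isOpen_support), hgm,
        stamProduct_comp_sub_right, kappa2_eq_stamProduct hp hp1]
    · have hdu := down_up hg hl hcont hsub
      refine ⟨upDefined_of_support_subset hg hl hcont fun h => by simpa using hsub h,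
        ⟨isDecreasingDensity_up hg hl hcont hsub, ?_⟩, hdu⟩
      rwa [hdu]
  · rcases hrange with h | h
    · by_cases hp1 : p = 1
      · exact kappa2_sharp_of_eq_one hpq hl h hp1 hc
      · exact kappa2_sharp_of_one_lt hpq hl hs h (h.one_lt hp1)
          (hb.resolve_left (h.one_lt hp1).not_ge) hc
    · exact kappa2_sharp_of_lt_one hpq hl hs h hc
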